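/- Let $n\ge 1$ and let $N$ be an $(n+1)$-dimensional (Hausdorff, second countable) manifold of class $C^6$ with a semi-Riemannian metric $\bar g=\langle\cdot,\cdot\rangle$ of class $C^5$ that is either Riemannian (put $\sigma=1$) or Lorentzian with signature $(-,+,\dots,+)$ (put $\sigma=-1$). Let * $\Gamma\subset\mathbb R^n$ be an open, convex, symmetric cone containing the positive cone, and let $F\in C^4(\Gamma)$ be symmetric, strictly monotone ($\partial F/\partial\kappa_i>0$ in $\Gamma$ for all $i$), concave and homogeneous of degree $1$; * $J\subset\mathbb R$ be an open interval with $F(\Gamma)\subset J$, and $\Phi\in C^4(J)$ with $\Phi'>0$ and $\Phi''\le 0$ (the standard case is $J=(0,\infty)$; $J=\mathbb R$ is allowed too); * $\Omega\subset N$ be open, $f\in C^4(\Omega)$ with values in $J$, and $\tilde f=\Phi(f)$. Let $M_0$ be a compact $n$-dimensional manifold (without boundary) of class $C^6$, let $0<T^*\le\infty$, and let $x:[0,T^*)\times M_0\to\Omega$ be a solution of the curvature flow $$\dot x=-\sigma\,(\Phi-\tilde f)\,\nu ,$$ where, for every $t\in[0,T^*)$, $x(t,\cdot)$ is a spacelike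 immersion (for instance an embedding), i.e. the induced metric $g_{ij}=\langle x_i,x_j\rangle$ is Riemannian, parametrizing the hypersurface $M(t)$; $\nu$ is a unit normal field, $\langle\nu,\nu\rangle=\sigma$; the second fundamental form $h_{ij}$ is defined by the Gauss formula $x_{ij}=-\sigma h_{ij}\nu$; the principal curvatures $\kappa=(\kappa_1,\dots,\kappa_n)$ of $M(t)$, i.e. the eigenvalues of $h_{ij}$ with respect to $g_{ij}$, lie in $\Gamma$; and $\Phi-\tilde f=\Phi(F(\kappa))-\Phi(f(x))$. The solution is assumed to be sufficiently smooth, namely $x$ of class $C^3$ and $\nu$ of class $C^2$ jointly in $(t,\xi)\in[0,T^*)\times M_0$. The interval $[0,T^*)$ may be, but need not be, the maximal interval of existence. Integrals over $M(t)$ are taken over $M_0$ with respect to the volume element $\sqrt{\det(g_{ij})}\,d\xi$ of the metric induced by $x(t,\cdot)$. Suppose that $\Phi-\tilde f$ has a weak sign at $t=0$. If $\Phi-\tilde f\ge 0$ at $t=0$ and $\int_{M(0)}(\Phi-\tilde f)>0$, then $$\int_{M(t)}(\Phi-\tilde f)>0\qquad\text{for all }0\le t<T^*.$$ Likewise, if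 $\Phi-\tilde f\le 0$ at $t=0$ and $\int_{M(0)}(\Phi-\tilde f)<0$, then $\int_{M(t)}(\Phi-\tilde f)<0$ for all $0\le t<T^*$. -/

import Mathlib

open Set Function
open scoped Manifold ContDiff Topology

/-- A manifold of class `C^6` is a manifold of class `C^3`. -/
instance IsManifold.three_of_six {E H M : Type*} [NormedAddCommGroup E] [NormedSpace ℝ E]
    [TopologicalSpace H] {I : ModelWithCorners ℝ E H} [TopologicalSpace M] [ChartedSpace H M]
    [IsManifold I 6 M] : IsManifold I 3 M :=
  IsManifold.of_le (n := 6) (by norm_cast)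

namespace HypersurfaceFlow

/-! ### The ambient semi-Riemannian manifold -/

section Ambient

variable {d : ℕ} {N : Type*} [TopologicalSpace N] [ChartedSpace (EuclideanSpace ℝ (Fin d)) N]

/-- The local expression, in the chart of `N` around `q`, of a field `g` of bilinear forms on the
tangent spaces: the value at the point with coordinates `y`, as a bilinear form on `ℝ^d`. Its
matrix in the standard basis is `(g_{αβ}(y))`. (Mathlib represents a tangent vector at `p` by its
coordinates in the preferred chart around `p`, whence the transition map.) -/
noncomputable def metricInChart
    (g : ∀ p : N, TangentSpace (𝓡 d) p →L[ℝ] TangentSpace (𝓡 d) p →L[ℝ] ℝ)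
    (q : N) (y : EuclideanSpace ℝ (Fin d)) :
    EuclideanSpace ℝ (Fin d) →L[ℝ] EuclideanSpace ℝ (Fin d) →L[ℝ] ℝ :=
  let p : N := (extChartAt (𝓡 d) q).symm y
  let A : EuclideanSpace ℝ (Fin d) →L[ℝ] EuclideanSpace ℝ (Fin d) :=
    fderiv ℝ (extChartAt (𝓡 d) p ∘ (extChartAt (𝓡 d) q).symm) y
  let B : EuclideanSpace ℝ (Fin d) →L[ℝ] EuclideanSpace ℝ (Fin d) →L[ℝ] ℝ := g p
  B.bilinearComp A A

/-- `g` is a semi-Riemannian metric of class `C^5` which is Riemannian if `σ = 1` and Lorentzian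
(of signature `(-,+,…,+)`) if `σ = -1`; no other value of `σ` is allowed. -/
structure IsAmbientMetric (σ : ℝ)
    (g : ∀ p : N, TangentSpace (𝓡 d) p →L[ℝ] TangentSpace (𝓡 d) p →L[ℝ] ℝ) : Prop where
  contDiffOn : ∀ q : N, ContDiffOn ℝ 5 (metricInChart g q) (extChartAt (𝓡 d) q).target
  symm : ∀ (p : N) (v w : TangentSpace (𝓡 d) p), g p v w = g p w v
  signature :
    (σ = 1 ∧ ∀ (p : N) (v : TangentSpace (𝓡 d) p), v ≠ 0 → 0 < g p v v) ∨
    (σ = -1 ∧ ∀ p : N, ∃ e : TangentSpace (𝓡 d) p, g p e e < 0 ∧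
      ∀ v : TangentSpace (𝓡 d) p, g p e v = 0 → v ≠ 0 → 0 < g p v v)

/-- The Christoffel symbols of the first kind `[ab, c] = ½ (∂_a g_{bc} + ∂_b g_{ac} - ∂_c g_{ab})`
of `g` at the point with coordinates `y` in the chart around `q`, contracted with the vectors
`a`, `b`, `c`. -/
noncomputable def christoffelFirst
    (g : ∀ p : N, TangentSpace (𝓡 d) p →L[ℝ] TangentSpace (𝓡 d) p →L[ℝ] ℝ)
    (q : N) (y a b c : EuclideanSpace ℝ (Fin d)) : ℝ :=
  (fderiv ℝ (metricInChart g q) y a b c + fderiv ℝ (metricInChart g q) y b a c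
    - fderiv ℝ (metricInChart g q) y c a b) / 2

end Ambient

/-! ### Spacelike hypersurfaces -/

section Hypersurface

variable {n : ℕ} {M N : Type*}
  [TopologicalSpace M] [ChartedSpace (EuclideanSpace ℝ (Fin n)) M]
  [TopologicalSpace N] [ChartedSpace (EuclideanSpace ℝ (Fin (n + 1))) N]

/-- The induced metric `g_{ij} = ⟨x_i, x_j⟩` of `x : M → N` at `ξ`. -/
noncomputable def inducedMetric
    (g : ∀ p : N, TangentSpace (𝓡 (n + 1)) p →L[ℝ] TangentSpace (𝓡 (n + 1)) p →L[ℝ] ℝ)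
    (x : M → N) (ξ : M) (v w : TangentSpace (𝓡 n) ξ) : ℝ :=
  g (x ξ) (mfderiv (𝓡 n) (𝓡 (n + 1)) x ξ v) (mfderiv (𝓡 n) (𝓡 (n + 1)) x ξ w)

/-- The induced metric is Riemannian. -/
def IsSpacelike
    (g : ∀ p : N, TangentSpace (𝓡 (n + 1)) p →L[ℝ] TangentSpace (𝓡 (n + 1)) p →L[ℝ] ℝ)
    (x : M → N) : Prop :=
  ∀ (ξ : M) (v : TangentSpace (𝓡 n) ξ), v ≠ 0 → 0 < inducedMetric g x ξ v v

/-- `ν` is a field of normals along `x` with `⟨ν, ν⟩ = σ`. -/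
def IsUnitNormal (σ : ℝ)
    (g : ∀ p : N, TangentSpace (𝓡 (n + 1)) p →L[ℝ] TangentSpace (𝓡 (n + 1)) p →L[ℝ] ℝ)
    (x : M → N) (ν : ∀ ξ : M, TangentSpace (𝓡 (n + 1)) (x ξ)) : Prop :=
  ∀ ξ : M, g (x ξ) (ν ξ) (ν ξ) = σ ∧
    ∀ v : TangentSpace (𝓡 n) ξ, g (x ξ) (mfderiv (𝓡 n) (𝓡 (n + 1)) x ξ v) (ν ξ) = 0

/-- The second fundamental form `h_{ij}` of `x` at `ξ` with respect to `-σν`, as determined by the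
Gauss formula `x_{ij} = -σ h_{ij} ν`. Taking the inner product with `ν`, the formula reads
`h_{ij} = -⟨x_{ij}, ν⟩ = -(g_{αβ} x^α_{,ij} + [γδ, β] x^γ_i x^δ_j) ν^β`, where the Christoffel
symbols of the hypersurface drop out because they only contribute a tangential vector. The
coordinates used are those of the charts around `ξ` and `x ξ`, which are also the coordinates in
which Mathlib represents the vectors of `TangentSpace _ ξ` and `TangentSpace _ (x ξ)`. -/
noncomputable def secondFundamentalForm
    (g : ∀ p : N, TangentSpace (𝓡 (n + 1)) p →L[ℝ] TangentSpace (𝓡 (n + 1)) p →L[ℝ] ℝ)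
    (x : M → N) (ξ : M) (ν : TangentSpace (𝓡 (n + 1)) (x ξ)) (v w : TangentSpace (𝓡 n) ξ) : ℝ :=
  let X : EuclideanSpace ℝ (Fin n) → EuclideanSpace ℝ (Fin (n + 1)) :=
    writtenInExtChartAt (𝓡 n) (𝓡 (n + 1)) ξ x
  let z : EuclideanSpace ℝ (Fin n) := extChartAt (𝓡 n) ξ ξ;
  -(metricInChart g (x ξ) (X z) (fderiv ℝ (fderiv ℝ X) z v w) ν
    + christoffelFirst g (x ξ) (X z) (fderiv ℝ X z v) (fderiv ℝ X z w) ν)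

/-- `κ` lists the principal curvatures of `x` at `ξ` with respect to the normal `ν`, i.e. the
eigenvalues of the second fundamental form with respect to the induced metric, with
multiplicities. They are unique up to their order. -/
def IsPrincipalCurvatures
    (g : ∀ p : N, TangentSpace (𝓡 (n + 1)) p →L[ℝ] TangentSpace (𝓡 (n + 1)) p →L[ℝ] ℝ)
    (x : M → N) (ξ : M) (ν : TangentSpace (𝓡 (n + 1)) (x ξ)) (κ : Fin n → ℝ) : Prop :=
  ∃ b : Fin n → TangentSpace (𝓡 n) ξ, ∀ i j : Fin n,
    inducedMetric g x ξ (b i) (b j) = (if i = j then 1 else 0) ∧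
    secondFundamentalForm g x ξ ν (b i) (b j) = (if i = j then κ i else 0)

/-- The density `√(det (g_{ij}))` of the volume element of the hypersurface `x`, in the chart of
`M` around `c`. -/
noncomputable def volumeDensity
    (g : ∀ p : N, TangentSpace (𝓡 (n + 1)) p →L[ℝ] TangentSpace (𝓡 (n + 1)) p →L[ℝ] ℝ)
    (x : M → N) (c : M) (y : EuclideanSpace ℝ (Fin n)) : ℝ :=
  let ξ : M := (extChartAt (𝓡 n) c).symm y
  let A : EuclideanSpace ℝ (Fin n) →L[ℝ] EuclideanSpace ℝ (Fin n) :=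
    fderiv ℝ (extChartAt (𝓡 n) ξ ∘ (extChartAt (𝓡 n) c).symm) y
  Real.sqrt (Matrix.det (Matrix.of fun i j : Fin n =>
    inducedMetric g x ξ (A (EuclideanSpace.single i 1)) (A (EuclideanSpace.single j 1))))

variable (n M) in
theorem exists_chartPartition [CompactSpace M] [T2Space M] :
    ∃ ρ : PartitionOfUnity M M univ,
      ρ.IsSubordinate fun c : M => (chartAt (EuclideanSpace ℝ (Fin n)) c).source :=
  PartitionOfUnity.exists_isSubordinate isClosed_univ _
    (fun c => (chartAt (EuclideanSpace ℝ (Fin n)) c).open_source)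
    fun c _ => mem_iUnion.2 ⟨c, mem_chart_source _ c⟩

variable (n M) in
/-- A partition of unity on `M` subordinate to the coordinate domains. -/
noncomputable def chartPartition [CompactSpace M] [T2Space M] : PartitionOfUnity M M univ :=
  (exists_chartPartition n M).choose

/-- The integral `∫_M u` of a continuous function `u` with respect to the volume element of the
metric induced by `x : M → N`: in local coordinates the volume element is `√(det (g_{ij})) dy`, and
the pieces are put together by a partition of unity. (The sum has only finitely many non-zero
terms, since `M` is compact; the value does not depend on the partition of unity.) -/
noncomputable def hypersurfaceIntegral [CompactSpace M] [T2Space M]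
    (g : ∀ p : N, TangentSpace (𝓡 (n + 1)) p →L[ℝ] TangentSpace (𝓡 (n + 1)) p →L[ℝ] ℝ)
    (x : M → N) (u : M → ℝ) : ℝ :=
  ∑ᶠ c : M, ∫ y in (extChartAt (𝓡 n) c).target,
    chartPartition n M c ((extChartAt (𝓡 n) c).symm y) * u ((extChartAt (𝓡 n) c).symm y)
      * volumeDensity g x c y

end Hypersurface

/-! ### Curvature functions and the curvature flow -/

/-- `Γ ⊆ ℝⁿ` is an open, convex, symmetric cone containing the positive cone. -/
structure IsCurvatureCone {n : ℕ} (Γ : Set (Fin n → ℝ)) : Prop where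
  isOpen : IsOpen Γ
  convex : Convex ℝ Γ
  symmetric : ∀ κ ∈ Γ, ∀ π : Equiv.Perm (Fin n), κ ∘ π ∈ Γ
  cone : ∀ κ ∈ Γ, ∀ r : ℝ, 0 < r → r • κ ∈ Γ
  positive : ∀ κ : Fin n → ℝ, (∀ i, 0 < κ i) → κ ∈ Γ

/-- `F` is a symmetric, strictly monotone, concave curvature function on `Γ`, of class `C^4` and
homogeneous of degree `1`. -/
structure IsCurvatureFunction {n : ℕ} (Γ : Set (Fin n → ℝ)) (F : (Fin n → ℝ) → ℝ) : Prop where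
  contDiffOn : ContDiffOn ℝ 4 F Γ
  symmetric : ∀ κ ∈ Γ, ∀ π : Equiv.Perm (Fin n), F (κ ∘ π) = F κ
  strictMono : ∀ κ ∈ Γ, ∀ i : Fin n, 0 < fderiv ℝ F κ (Pi.single i 1)
  concave : ConcaveOn ℝ Γ F
  homogeneous : ∀ κ ∈ Γ, ∀ r : ℝ, 0 < r → F (r • κ) = r * F κ

/-- `Φ` is a function of class `C^4` on the open interval `J` with `Φ' > 0` and `Φ'' ≤ 0`. -/
structure IsSpeedFunction (J : Set ℝ) (Φ : ℝ → ℝ) : Prop where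
  isOpen : IsOpen J
  ordConnected : J.OrdConnected
  contDiffOn : ContDiffOn ℝ 4 Φ J
  deriv_pos : ∀ r ∈ J, 0 < deriv Φ r
  deriv_deriv_nonpos : ∀ r ∈ J, deriv (deriv Φ) r ≤ 0

/-- The interval `[0, T)`, where `T` may be `∞`. -/
def timeInterval (T : EReal) : Set ℝ := {t : ℝ | 0 ≤ t ∧ (t : EReal) < T}

section Flow

variable {n : ℕ} {M N : Type*}
  [TopologicalSpace M] [ChartedSpace (EuclideanSpace ℝ (Fin n)) M]
  [TopologicalSpace N] [ChartedSpace (EuclideanSpace ℝ (Fin (n + 1))) N]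

/-- The function `Φ - f̃` on the hypersurface `M(t)`, where `Φ = Φ(F)` is evaluated at the principal
curvatures `κ t ξ` and `f̃ = Φ(f)`. -/
def speed (Φ : ℝ → ℝ) (F : (Fin n → ℝ) → ℝ) (f : N → ℝ) (x : ℝ → M → N)
    (κ : ℝ → M → Fin n → ℝ) (t : ℝ) (ξ : M) : ℝ :=
  Φ (F (κ t ξ)) - Φ (f (x t ξ))

/-- `x t`, `t ∈ [0, T)`, is a solution of the curvature flow `ẋ = -σ (Φ(F) - f̃) ν` by admissible
spacelike hypersurfaces contained in `Ω`, with unit normals `ν t` and principal curvatures `κ t`.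
At `t = 0` derivatives in `t` are one-sided. -/
structure IsCurvatureFlow [IsManifold (𝓡 (n + 1)) 6 N] (σ : ℝ)
    (g : ∀ p : N, TangentSpace (𝓡 (n + 1)) p →L[ℝ] TangentSpace (𝓡 (n + 1)) p →L[ℝ] ℝ)
    (Γ : Set (Fin n → ℝ)) (F : (Fin n → ℝ) → ℝ) (Φ : ℝ → ℝ) (Ω : Set N) (f : N → ℝ)
    (T : EReal) (x : ℝ → M → N) (ν : ∀ (t : ℝ) (ξ : M), TangentSpace (𝓡 (n + 1)) (x t ξ))
    (κ : ℝ → M → Fin n → ℝ) : Prop where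
  contMDiffOn : ContMDiffOn (𝓘(ℝ, ℝ).prod (𝓡 n)) (𝓡 (n + 1)) 3
    (fun p : ℝ × M => x p.1 p.2) (timeInterval T ×ˢ univ)
  mem : ∀ t ∈ timeInterval T, ∀ ξ : M, x t ξ ∈ Ω
  spacelike : ∀ t ∈ timeInterval T, IsSpacelike g (x t)
  normal : ∀ t ∈ timeInterval T, IsUnitNormal σ g (x t) (ν t)
  contMDiffOn_normal : ContMDiffOn (𝓘(ℝ, ℝ).prod (𝓡 n)) (𝓡 (n + 1)).tangent 2
    (fun p : ℝ × M => (⟨x p.1 p.2, ν p.1 p.2⟩ : TangentBundle (𝓡 (n + 1)) N))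
    (timeInterval T ×ˢ univ)
  principal : ∀ t ∈ timeInterval T, ∀ ξ : M, IsPrincipalCurvatures g (x t) ξ (ν t ξ) (κ t ξ)
  admissible : ∀ t ∈ timeInterval T, ∀ ξ : M, κ t ξ ∈ Γ
  evolution : ∀ t ∈ timeInterval T, ∀ ξ : M,
    HasMFDerivWithinAt 𝓘(ℝ, ℝ) (𝓡 (n + 1)) (fun s => x s ξ) (timeInterval T) t
      ((1 : ℝ →L[ℝ] ℝ).smulRight ((-σ * speed Φ F f x κ t ξ) • ν t ξ))

end Flow

end HypersurfaceFlow

set_option maxSynthPendingDepth 3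
set_option autoImplicit false

namespace HypersurfaceFlow

/-! ### Orthonormal frames and eigenvalues -/

/-! Let `u` denote the speed Φ(F) − f̃. Along the flow `u` solves, in local coordinates and for
positive times, a linear parabolic equation that is uniformly elliptic with bounded coefficients
over compact sets. The theorem is therefore a maximum principle. If `u` is nonnegative initially, it
stays so (`IsLocallyParabolic.nonneg`), and a point ξ₀ with `u 0 ξ₀ > 0` keeps `u t ξ₀ > 0`
(`IsLocallyParabolic.pos`). A nonzero integral provides such a point at time 0, and a continuous
nonnegative function that is positive somewhere has positive integral. The equation is linear in
`u`, so the other sign follows by passing to `-u`.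

The equation is `IsLocalFlow.deriv_speed_eq`. The time derivatives of the induced metric and of the
second fundamental form are computed in coordinates (`deriv_metric_eq`, `deriv_sff_eq`); the normal
velocity −σu contributes the Hessian of `u` to the latter. The difficulty is that `F` is a function
of the eigenvalues, which need not be differentiable in time. However, `u` is of class C² since `u`
= −⟨ẋ, ν⟩ (`IsLocalFlow.contDiffOn_speed`). Moreover the diagonal `d` of the second fundamental form
in a differentiable orthonormal frame is differentiable, lies in the convex hull of the permutations
of κ (Schur), and equals κ at the chosen time. By concavity and symmetry F(d) ≥ F(κ), with equality
at that time, so Φ(F(d)) and Φ(F(κ)) have the same derivative there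
(`hasDerivAt_eq_of_eigenvalues`).

Eigenframes cannot in general be chosen continuously. The coefficients are therefore regarded as
continuous functions on the compact set of all orthonormal frames over a compact piece of
space-time, which yields uniform bounds (`IsLocalFlow.exists_isParabolicAt`). Strict positivity
comes from comparison with the subsolution ε e^{−Kt}(r² − |y − y₀|²)² in a single chart
(`pos_of_isParabolicAt`); it is needed only at the original point, so no chaining of balls occurs.
-/

theorem mulVec_mem_convexHull_perm {n : ℕ} {P : Matrix (Fin n) (Fin n) ℝ}
    (hP : P ∈ doublyStochastic ℝ (Fin n)) (κ : Fin n → ℝ) :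
    P.mulVec κ ∈ convexHull ℝ (range fun π : Equiv.Perm (Fin n) => κ ∘ π) := by
  let L : Matrix (Fin n) (Fin n) ℝ →ₗ[ℝ] Fin n → ℝ :=
    { toFun := fun A => A.mulVec κ
      map_add' := fun A B => Matrix.add_mulVec A B κ
      map_smul' := fun r A => Matrix.smul_mulVec r A κ }
  have h := hP
  -- Birkhoff's theorem; the linear map `L` carries the convex hull of the permutation matrices to
  -- that of the permuted vectors.
  rw [← SetLike.mem_coe, doublyStochastic_eq_convexHull_permMatrix] at h
  have h2 : L P ∈ L '' _ := mem_image_of_mem L h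
  rw [LinearMap.image_convexHull] at h2
  refine convexHull_mono ?_ h2
  rintro _ ⟨_, ⟨π, rfl⟩, rfl⟩
  refine ⟨π, ?_⟩
  ext i
  simp [L, Matrix.permMatrix_mulVec]

/-- Schur's theorem: the diagonal of `h` in any `g`-orthonormal frame is a convex combination of
permutations of its eigenvalues. -/
theorem diag_mem_convexHull_perm {n : ℕ} {G H B B' : Matrix (Fin n) (Fin n) ℝ} {κ : Fin n → ℝ}
    (hB : B.transpose * G * B = 1) (hH : B.transpose * H * B = Matrix.diagonal κ)
    (hB' : B'.transpose * G * B' = 1) :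
    (fun i => (B'.transpose * H * B') i i) ∈
      convexHull ℝ (range fun π : Equiv.Perm (Fin n) => κ ∘ π) := by
  obtain ⟨Q, hQ⟩ : ∃ Q, B * Q = B' := by
    have h1 : B * (B.transpose * G) = 1 := mul_eq_one_comm.1 hB
    exact ⟨B.transpose * G * B', by rw [← mul_assoc, h1, one_mul]⟩
  subst hQ
  have hQ1 : Q.transpose * Q = 1 := by
    have : (B * Q).transpose * G * (B * Q) = Q.transpose * (B.transpose * G * B) * Q := by
      rw [Matrix.transpose_mul]; simp only [mul_assoc]
    rw [this, hB, mul_one] at hB'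
    exact hB'
  have hQ2 : Q * Q.transpose = 1 := mul_eq_one_comm.1 hQ1
  have hH' : (B * Q).transpose * H * (B * Q) = Q.transpose * Matrix.diagonal κ * Q := by
    rw [← hH, Matrix.transpose_mul]; simp only [mul_assoc]
  -- The two frames differ by an orthogonal matrix `Q`, whose squared entries form a doubly
  -- stochastic matrix. That matrix maps the eigenvalues to the diagonal.
  have key := mulVec_mem_convexHull_perm (P := Matrix.of fun i k => Q k i ^ 2) (κ := κ) (by
    rw [mem_doublyStochastic_iff_sum]
    refine ⟨fun i j => sq_nonneg _, fun i => ?_, fun j => ?_⟩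
    · have := congrFun (congrFun hQ1 i) i
      simpa [Matrix.mul_apply, sq] using this
    · have := congrFun (congrFun hQ2 j) j
      simpa [Matrix.mul_apply, sq] using this)
  convert key using 1
  ext i
  rw [hH']
  simp only [Matrix.mul_apply (N := Q), Matrix.mul_diagonal, Matrix.transpose_apply, Matrix.mulVec,
    dotProduct, Matrix.of_apply]
  exact Finset.sum_congr rfl fun k _ => by ring

/-- Inverse function theorem for squaring at 1, where the derivative is multiplication by 2. Both
one-sided inverse relations are kept: the second one gives local uniqueness of the root. -/
theorem exists_differentiableAt_sqrt (A : Type*) [NormedRing A] [NormedAlgebra ℝ A]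
    [CompleteSpace A] :
    ∃ r : A → A, r 1 = 1 ∧ DifferentiableAt ℝ r 1 ∧ (∀ᶠ a in 𝓝 (1 : A), r a * r a = a) ∧
      ∀ᶠ a in 𝓝 (1 : A), r (a * a) = a := by
  let e : A ≃L[ℝ] A := ContinuousLinearEquiv.smulLeft (Units.mk0 (2 : ℝ) two_ne_zero)
  have hs : HasStrictFDerivAt (fun X : A => X * X) (e : A →L[ℝ] A) 1 := by
    have h := (hasStrictFDerivAt_id (𝕜 := ℝ) (1 : A)).mul' (hasStrictFDerivAt_id (1 : A))
    refine h.congr_fderiv ?_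
    ext1 X
    have h2 : e X = (2 : ℝ) • X := rfl
    simp [h2, two_smul]
  refine ⟨hs.localInverse, by simpa using hs.localInverse_apply_image, ?_, ?_,
    hs.eventually_left_inverse⟩
  · have := hs.to_localInverse.differentiableAt
    rwa [mul_one] at this
  · have := hs.eventually_right_inverse
    rwa [mul_one] at this

section MatrixNorm

open scoped Matrix.Norms.Operator

/-- Near the identity there is a differentiable inverse square root of symmetric matrices. -/
theorem exists_orthonormalizing_map (n : ℕ) :
    ∃ s : Matrix (Fin n) (Fin n) ℝ → Matrix (Fin n) (Fin n) ℝ, s 1 = 1 ∧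
      DifferentiableAt ℝ s 1 ∧
      ∀ᶠ G in 𝓝 (1 : Matrix (Fin n) (Fin n) ℝ), G.transpose = G →
        (s G).transpose * G * s G = 1 := by
  obtain ⟨r, hr1, hrd, hright, hleft⟩ :=
    exists_differentiableAt_sqrt (Matrix (Fin n) (Fin n) ℝ)
  have hid := differentiableAt_inverse (𝕜 := ℝ) (isUnit_one (M := Matrix (Fin n) (Fin n) ℝ))
  have hrc := hrd.continuousAt.tendsto
  rw [hr1] at hrc
  have htr : Filter.Tendsto (fun X : Matrix (Fin n) (Fin n) ℝ => X.transpose) (𝓝 1) (𝓝 1) := by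
    have : Continuous fun X : Matrix (Fin n) (Fin n) ℝ => X.transpose :=
      Continuous.matrix_transpose continuous_id
    simpa using this.tendsto 1
  have hinv := hid.continuousAt.tendsto
  rw [Ring.inverse_one] at hinv
  have hu : ∀ᶠ X in 𝓝 (1 : Matrix (Fin n) (Fin n) ℝ), IsUnit X :=
    Units.nhds (1 : (Matrix (Fin n) (Fin n) ℝ)ˣ)
  refine ⟨fun G => r (Ring.inverse G), by simp [hr1], ?_, ?_⟩
  · refine DifferentiableAt.comp (1 : Matrix (Fin n) (Fin n) ℝ) ?_ hid
    rwa [Ring.inverse_one]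
  · filter_upwards [hu, hinv.eventually hright, (htr.comp (hrc.comp hinv)).eventually hleft]
      with G hG h1 h2 hsymm
    have hGi : (Ring.inverse G).transpose = Ring.inverse G := by
      rw [← Matrix.nonsing_inv_eq_ringInverse, Matrix.transpose_nonsing_inv, hsymm]
    -- The transposed root is again a root of the symmetric matrix `G⁻¹` near 1, so local uniqueness
    -- makes the root symmetric.
    have h3 : (r (Ring.inverse G)).transpose = r (Ring.inverse G) := by
      simp only [comp_apply] at h2
      rw [← Matrix.transpose_mul, h1, hGi] at h2
      exact h2.symm
    have h4 : G * r (Ring.inverse G) * r (Ring.inverse G) = 1 := by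
      rw [mul_assoc, h1, Ring.mul_inverse_cancel _ hG]
    rw [h3, mul_assoc]
    exact mul_eq_one_comm.1 h4

theorem exists_orthonormal_path {n : ℕ} {G : ℝ → Matrix (Fin n) (Fin n) ℝ} {t₀ : ℝ}
    (h1 : G t₀ = 1) (hsymm : ∀ᶠ t in 𝓝 t₀, (G t).transpose = G t)
    (hd : ∀ i j, DifferentiableAt ℝ (fun t => G t i j) t₀) :
    ∃ B : ℝ → Matrix (Fin n) (Fin n) ℝ, B t₀ = 1 ∧
      (∀ᶠ t in 𝓝 t₀, (B t).transpose * G t * B t = 1) ∧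
      ∀ i j, DifferentiableAt ℝ (fun t => B t i j) t₀ := by
  obtain ⟨s, hs1, hsd, hs⟩ := exists_orthonormalizing_map n
  have hGd : DifferentiableAt ℝ G t₀ := by
    have : G = fun t => ∑ i, ∑ j, G t i j • Matrix.single i j (1 : ℝ) := by
      ext1 t
      conv_lhs => rw [Matrix.matrix_eq_sum_single (G t)]
      simp
    rw [this]
    exact DifferentiableAt.fun_sum fun i _ => DifferentiableAt.fun_sum fun j _ =>
      (hd i j).smul_const _
  refine ⟨fun t => s (G t), by simp [h1, hs1], ?_, fun i j => ?_⟩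
  · have := hGd.continuousAt.tendsto
    rw [h1] at this
    filter_upwards [this.eventually hs, hsymm] with t ht h2 using ht h2
  · have h2 : DifferentiableAt ℝ (fun t => s (G t)) t₀ :=
      DifferentiableAt.comp t₀ (by rwa [h1]) hGd
    let L : Matrix (Fin n) (Fin n) ℝ →ₗ[ℝ] ℝ :=
      { toFun := fun A => A i j, map_add' := fun _ _ => rfl, map_smul' := fun _ _ => rfl }
    exact (LinearMap.toContinuousLinearMap L).differentiableAt.comp t₀ h2

end MatrixNorm

/-- First variation of the eigenvalues from above: along differentiable families of metrics and
symmetric forms there is a differentiable family of vectors in the convex hull of the permutations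
of the eigenvalues, which starts at the eigenvalues and has the expected derivative. -/
theorem exists_diag_path {n : ℕ} {G H : ℝ → Matrix (Fin n) (Fin n) ℝ} {κ : ℝ → Fin n → ℝ}
    {t₀ : ℝ} (hsymm : ∀ᶠ t in 𝓝 t₀, (G t).transpose = G t)
    (h1 : G t₀ = 1) (h2 : H t₀ = Matrix.diagonal (κ t₀))
    (hκ : ∀ᶠ t in 𝓝 t₀, ∃ B : Matrix (Fin n) (Fin n) ℝ,
      B.transpose * G t * B = 1 ∧ B.transpose * H t * B = Matrix.diagonal (κ t))
    (hG : ∀ i j, DifferentiableAt ℝ (fun t => G t i j) t₀)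
    (hH : ∀ i j, DifferentiableAt ℝ (fun t => H t i j) t₀) :
    ∃ d : ℝ → Fin n → ℝ, d t₀ = κ t₀ ∧
      (∀ᶠ t in 𝓝 t₀, d t ∈ convexHull ℝ (range fun π : Equiv.Perm (Fin n) => κ t ∘ π)) ∧
      ∀ i, HasDerivAt (fun t => d t i)
        (deriv (fun t => H t i i) t₀ - κ t₀ i * deriv (fun t => G t i i) t₀) t₀ := by
  obtain ⟨B, hB1, hB, hBd⟩ := exists_orthonormal_path h1 hsymm hG
  refine ⟨fun t i => ((B t).transpose * H t * B t) i i, ?_, ?_, fun i => ?_⟩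
  · ext i
    simp [hB1, h2]
  · filter_upwards [hB, hκ] with t ht ⟨B', h3, h4⟩
    exact diag_mem_convexHull_perm h3 h4 ht
  have expand : ∀ (A : ℝ → Matrix (Fin n) (Fin n) ℝ),
      (∀ i j, DifferentiableAt ℝ (fun t => A t i j) t₀) →
      HasDerivAt (fun t => ((B t).transpose * A t * B t) i i)
        (deriv (fun t => A t i i) t₀ + ∑ k, (A t₀ k i + A t₀ i k) * deriv (fun t => B t k i) t₀)
        t₀ := by
    intro A hA
    have h3 : ∀ t, ((B t).transpose * A t * B t) i i
        = ∑ k, ∑ l, B t l i * A t l k * B t k i := by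
      intro t
      simp [Matrix.mul_apply, Finset.sum_mul]
    simp only [h3]
    have h4 : HasDerivAt (fun t => ∑ k, ∑ l, B t l i * A t l k * B t k i) _ t₀ :=
      HasDerivAt.fun_sum fun k _ => HasDerivAt.fun_sum fun l _ =>
        (((hBd l i).hasDerivAt.mul (hA l k).hasDerivAt).mul (hBd k i).hasDerivAt)
    convert h4 using 1
    have hB0 : ∀ k l, B t₀ k l = if k = l then 1 else 0 := by
      intro k l; rw [hB1, Matrix.one_apply]
    have e1 : ∀ k l, (deriv (fun t => B t l i) t₀ * A t₀ l k
          + B t₀ l i * deriv (fun t => A t l k) t₀) * B t₀ k i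
          + B t₀ l i * A t₀ l k * deriv (fun t => B t k i) t₀ =
        (if k = i then deriv (fun t => B t l i) t₀ * A t₀ l i else 0)
        + (if k = i then if l = i then deriv (fun t => A t i i) t₀ else 0 else 0)
        + (if l = i then A t₀ i k * deriv (fun t => B t k i) t₀ else 0) := by
      intro k l
      rw [hB0, hB0]
      by_cases hk : k = i <;> by_cases hl : l = i <;> simp [hk, hl]
    simp only [Pi.mul_apply, e1, Finset.sum_add_distrib, Finset.sum_ite_eq', Finset.mem_univ,
      if_true, Finset.sum_ite_irrel, Finset.sum_const_zero]
    rw [add_comm (deriv _ _), add_right_comm, ← Finset.sum_add_distrib, add_left_inj]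
    exact Finset.sum_congr rfl fun k _ => by ring
  have h5 := expand H hH
  -- Differentiating the constant `Bᵀ G B = 1` shows that 2B'ᵢᵢ = −G'ᵢᵢ. As `H t₀` is diagonal, this
  -- entry of B' is the only one that enters the derivative of the diagonal of `Bᵀ H B`.
  have h6 : deriv (fun t => G t i i) t₀ + ∑ k, (G t₀ k i + G t₀ i k) * deriv (fun t => B t k i) t₀
      = 0 := by
    refine (expand G hG).unique ?_
    refine (hasDerivAt_const t₀ (1 : ℝ)).congr_of_eventuallyEq ?_
    filter_upwards [hB] with t ht
    rw [ht, Matrix.one_apply_eq]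
  have hs1 : ∑ k, (G t₀ k i + G t₀ i k) * deriv (fun t => B t k i) t₀
      = 2 * deriv (fun t => B t i i) t₀ := by
    simp [h1, Matrix.one_apply, add_mul, Finset.sum_add_distrib]; ring
  have hs2 : ∑ k, (H t₀ k i + H t₀ i k) * deriv (fun t => B t k i) t₀
      = κ t₀ i * (2 * deriv (fun t => B t i i) t₀) := by
    simp [h2, Matrix.diagonal_apply, add_mul, Finset.sum_add_distrib]; ring
  rw [hs2] at h5
  rw [hs1] at h6
  refine h5.congr_deriv ?_
  linear_combination κ t₀ i * h6

/-! ### Maximum principles for linear parabolic equations -/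

/-- If the second derivative were negative, the point would also be a local maximum, so the function
would be locally constant and its second derivative zero. -/
theorem deriv_deriv_nonneg_of_isLocalMin {f : ℝ → ℝ} {s : ℝ} (h : IsLocalMin f s)
    (hc : ContinuousAt f s) : 0 ≤ deriv (deriv f) s := by
  by_contra! hneg
  have h2 : IsLocalMin (-f) s := by
    refine isLocalMin_of_deriv_deriv_pos ?_ ?_ hc.neg
    · have e1 : deriv (-f) = -deriv f := by ext; simp
      rw [e1, deriv.neg']
      simpa using hneg
    · simp [h.deriv_eq_zero]
  have h3 : f =ᶠ[𝓝 s] fun _ => f s := by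
    filter_upwards [h, h2] with y h4 h5
    simp only [Pi.neg_apply, neg_le_neg_iff] at h5
    exact le_antisymm h5 h4
  have h4 : deriv f =ᶠ[𝓝 s] fun _ => 0 := by
    have := h3.deriv
    simpa using this
  rw [h4.deriv_eq] at hneg
  simp at hneg

theorem hessian_nonneg_of_isLocalMin {E : Type*} [NormedAddCommGroup E] [NormedSpace ℝ E]
    {f : E → ℝ} {y : E} (h : IsLocalMin f y) (hf : ContDiffAt ℝ 2 f y) (b : E) :
    0 ≤ fderiv ℝ (fderiv ℝ f) y b b := by
  have hl : ∀ s : ℝ, HasDerivAt (fun s : ℝ => y + s • b) b s := fun s => by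
    simpa using ((hasDerivAt_id s).smul_const b).const_add y
  have hl0 : y + (0 : ℝ) • b = y := by simp
  have hlc : Filter.Tendsto (fun s : ℝ => y + s • b) (𝓝 0) (𝓝 y) := by
    have := (hl 0).continuousAt.tendsto
    rwa [hl0] at this
  have h1 : IsLocalMin (fun s : ℝ => f (y + s • b)) 0 := by
    have := hlc.eventually h
    simpa [IsLocalMin, IsMinFilter] using this
  have h2 := deriv_deriv_nonneg_of_isLocalMin h1
    (ContinuousAt.comp (by simpa using hf.continuousAt) (hl 0).continuousAt)
  have h3 : deriv (fun s : ℝ => f (y + s • b)) =ᶠ[𝓝 0] fun s => fderiv ℝ f (y + s • b) b := by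
    have h4 : ∀ᶠ z in 𝓝 y, DifferentiableAt ℝ f z :=
      (hf.eventually (by simp)).mono fun z hz => hz.differentiableAt (by norm_num)
    filter_upwards [hlc.eventually h4] with s hs
    exact (hs.hasFDerivAt.comp_hasDerivAt s (hl s)).deriv
  rw [h3.deriv_eq] at h2
  have h5 : DifferentiableAt ℝ (fderiv ℝ f) y :=
    (hf.fderiv_right (m := 1) (by norm_num)).differentiableAt (by norm_num)
  have h6 : HasDerivAt (fun s : ℝ => fderiv ℝ f (y + s • b)) (fderiv ℝ (fderiv ℝ f) y b) 0 := by
    refine HasFDerivAt.comp_hasDerivAt (0 : ℝ) ?_ (hl 0)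
    rw [hl0]
    exact h5.hasFDerivAt
  have h7 := (h6.clm_apply (hasDerivAt_const (0 : ℝ) b)).deriv
  rw [h7] at h2
  simpa using h2

/-- A function whose rescaling attains its minimum over `[0, t]` at the end point has a bounded
derivative there. -/
theorem deriv_le_mul_of_isMinOn {f : ℝ → ℝ} {t d K : ℝ} (ht : 0 < t) (hf : HasDerivAt f d t)
    (hmin : ∀ s ∈ Icc 0 t, Real.exp (-K * t) * f t ≤ Real.exp (-K * s) * f s) :
    d ≤ K * f t := by
  have h1 : HasDerivAt (fun s => Real.exp (-K * s) * f s)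
      (Real.exp (-K * t) * (-K) * f t + Real.exp (-K * t) * d) t := by
    have h2 : HasDerivAt (fun s => Real.exp (-K * s)) (Real.exp (-K * t) * (-K)) t := by
      have := ((hasDerivAt_id t).const_mul (-K)).exp
      simpa using this
    exact h2.mul hf
  have h3 : Real.exp (-K * t) * (-K) * f t + Real.exp (-K * t) * d ≤ 0 := by
    -- The minimum is taken over times up to `t`, so only difference quotients from the left have a
    -- known sign.
    have h4 := (hasDerivWithinAt_iff_tendsto_slope' (s := Iio t) (by simp)).1 h1.hasDerivWithinAt
    refine le_of_tendsto h4 ?_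
    filter_upwards [Ioo_mem_nhdsLT ht] with s hs
    rw [slope_def_field]
    exact div_nonpos_of_nonneg_of_nonpos (sub_nonneg.2 (hmin s ⟨hs.1.le, hs.2.le⟩))
      (sub_nonpos.2 hs.2.le)
  have h5 : Real.exp (-K * t) * (d - K * f t) ≤ 0 := by linarith
  have := Real.exp_pos (-K * t)
  nlinarith [nonpos_of_mul_nonpos_right h5 this]

/-- Multiplying by e^{−(C+1)t} forces the time derivative at a negative space-time minimum to be at
most (C+1)u, which is strictly less than Cu because u < 0. This contradicts the differential
inequality, which is needed only at negative spatial minima. -/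
theorem weak_maximum_principle {M : Type*} [TopologicalSpace M] [CompactSpace M] {u : ℝ → M → ℝ}
    {T C : ℝ} (hcont : ContinuousOn (uncurry u) (Icc 0 T ×ˢ univ))
    (h : ∀ t ∈ Ioc 0 T, ∀ ξ, IsLocalMin (u t) ξ → u t ξ < 0 →
      ∃ d, HasDerivAt (fun s => u s ξ) d t ∧ C * u t ξ ≤ d)
    (h0 : ∀ ξ, 0 ≤ u 0 ξ) : ∀ t ∈ Icc 0 T, ∀ ξ, 0 ≤ u t ξ := by
  by_contra! hcon
  obtain ⟨t₁, ht₁, ξ₁, hneg⟩ := hcon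
  have hwc : ContinuousOn (fun p : ℝ × M => Real.exp (-(C + 1) * p.1) * uncurry u p)
      (Icc 0 T ×ˢ univ) := by
    refine ContinuousOn.mul ?_ hcont
    fun_prop
  obtain ⟨⟨t, ξ⟩, ⟨ht, -⟩, hmin⟩ := (isCompact_Icc.prod isCompact_univ).exists_isMinOn
    ⟨(t₁, ξ₁), ht₁, mem_univ _⟩ hwc
  have hmin' : ∀ s ∈ Icc 0 T, ∀ ζ,
      Real.exp (-(C + 1) * t) * u t ξ ≤ Real.exp (-(C + 1) * s) * u s ζ :=
    fun s hs ζ => hmin (a := (s, ζ)) ⟨hs, mem_univ _⟩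
  have hut : u t ξ < 0 := by
    have h1 := hmin' t₁ ht₁ ξ₁
    have h2 := mul_neg_of_pos_of_neg (Real.exp_pos (-(C + 1) * t₁)) hneg
    exact neg_of_mul_neg_right (h1.trans_lt h2) (Real.exp_pos _).le
  have ht0 : 0 < t := by
    rcases ht.1.eq_or_lt with h1 | h1
    · subst h1; exact absurd (h0 ξ) (not_le.2 hut)
    · exact h1
  obtain ⟨d, hd, hCd⟩ := h t ⟨ht0, ht.2⟩ ξ
    (Filter.Eventually.of_forall fun ζ =>
      le_of_mul_le_mul_left (hmin' t ht ζ) (Real.exp_pos _)) hut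
  have := deriv_le_mul_of_isMinOn ht0 hd fun s hs => hmin' s ⟨hs.1, hs.2.trans ht.2⟩ ξ
  linarith

variable {n : ℕ}

/-- At `(t, y)` the function `v` solves a linear parabolic equation
`v' = ∑ aᵢ D²v(bᵢ, bᵢ) + Dv(β) + γ v`, with lower ellipticity bound `lam` and coefficients bounded
by `C`. -/
def IsParabolicAt (lam C : ℝ) (v : ℝ × EuclideanSpace ℝ (Fin n) → ℝ) (t : ℝ)
    (y : EuclideanSpace ℝ (Fin n)) : Prop :=
  ContDiffAt ℝ 2 v (t, y) ∧
  ∃ (a : Fin n → ℝ) (b : Fin n → EuclideanSpace ℝ (Fin n)) (β : EuclideanSpace ℝ (Fin n)) (γ : ℝ),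
    (∀ i, 0 ≤ a i) ∧ (∑ i, a i * ‖b i‖ ^ 2 ≤ C) ∧ ‖β‖ ≤ C ∧ |γ| ≤ C ∧
    (∀ w, lam * ‖w‖ ^ 2 ≤ ∑ i, a i * inner ℝ w (b i) ^ 2) ∧
    deriv (fun s => v (s, y)) t =
      ∑ i, a i * fderiv ℝ (fderiv ℝ fun z => v (t, z)) y (b i) (b i)
        + fderiv ℝ (fun z => v (t, z)) y β + γ * v (t, y)

theorem IsParabolicAt.mono {lam lam' C C' t : ℝ} {v : ℝ × EuclideanSpace ℝ (Fin n) → ℝ}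
    {y : EuclideanSpace ℝ (Fin n)} (h : IsParabolicAt lam C v t y) (hl : lam' ≤ lam)
    (hC : C ≤ C') : IsParabolicAt lam' C' v t y := by
  obtain ⟨h1, a, b, β, γ, h2, h3, h4, h5, h6, h7⟩ := h
  exact ⟨h1, a, b, β, γ, h2, h3.trans hC, h4.trans hC, h5.trans hC,
    fun w => (mul_le_mul_of_nonneg_right hl (sq_nonneg _)).trans (h6 w), h7⟩

theorem IsParabolicAt.neg {lam C t : ℝ} {v : ℝ × EuclideanSpace ℝ (Fin n) → ℝ}
    {y : EuclideanSpace ℝ (Fin n)} (h : IsParabolicAt lam C v t y) :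
    IsParabolicAt lam C (fun p => -v p) t y := by
  obtain ⟨h1, a, b, β, γ, h2, h3, h4, h5, h6, h7⟩ := h
  refine ⟨h1.neg, a, b, β, γ, h2, h3, h4, h5, h6, ?_⟩
  have e1 : (fderiv ℝ fun z => -v (t, z)) = fun z => -fderiv ℝ (fun z => v (t, z)) z := by
    ext1 z; exact fderiv_fun_neg
  rw [deriv.fun_neg, h7, e1, fderiv_fun_neg]
  simp [Finset.sum_neg_distrib]
  ring

theorem contDiffAt_slice {E : Type*} [NormedAddCommGroup E] [NormedSpace ℝ E] {v : ℝ × E → ℝ}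
    {m : WithTop ℕ∞} {t : ℝ} {y : E} (h : ContDiffAt ℝ m v (t, y)) :
    ContDiffAt ℝ m (fun z => v (t, z)) y :=
  ContDiffAt.comp y h (contDiffAt_const.prodMk contDiffAt_id)

theorem hasDerivAt_slice {E : Type*} [NormedAddCommGroup E] [NormedSpace ℝ E] {v : ℝ × E → ℝ}
    {t : ℝ} {y : E} (h : ContDiffAt ℝ 2 v (t, y)) :
    HasDerivAt (fun s => v (s, y)) (deriv (fun s => v (s, y)) t) t := by
  have h1 : ContDiffAt ℝ 2 (fun s => v (s, y)) t :=
    ContDiffAt.comp t h (contDiffAt_id.prodMk contDiffAt_const)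
  exact (h1.differentiableAt (by norm_num)).hasDerivAt

/-- At a spatial minimum the gradient term vanishes and the second order term is nonnegative; since
v < 0, the bound γ ≤ C gives γv ≥ Cv. -/
theorem IsParabolicAt.mul_le_deriv {lam C t : ℝ} {v : ℝ × EuclideanSpace ℝ (Fin n) → ℝ}
    {y : EuclideanSpace ℝ (Fin n)} (h : IsParabolicAt lam C v t y)
    (hmin : IsLocalMin (fun z => v (t, z)) y) (hneg : v (t, y) < 0) :
    C * v (t, y) ≤ deriv (fun s => v (s, y)) t := by
  obtain ⟨h1, a, b, β, γ, h2, h3, h4, h5, h6, h7⟩ := h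
  rw [h7, hmin.fderiv_eq_zero]
  have h8 : 0 ≤ ∑ i, a i * fderiv ℝ (fderiv ℝ fun z => v (t, z)) y (b i) (b i) :=
    Finset.sum_nonneg fun i _ => mul_nonneg (h2 i)
      (hessian_nonneg_of_isLocalMin hmin (contDiffAt_slice h1) _)
  have h9 := mul_le_mul_of_nonpos_right ((le_abs_self γ).trans h5) hneg.le
  simp
  linarith

/-- The derivatives of the barrier `(r² - |z - y₀|²)²`. -/
theorem hasFDerivAt_barrier (y₀ : EuclideanSpace ℝ (Fin n)) (c r : ℝ)
    (y : EuclideanSpace ℝ (Fin n)) :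
    HasFDerivAt (fun z => c * (r ^ 2 - ‖z - y₀‖ ^ 2) ^ 2)
      ((-4 * c * (r ^ 2 - ‖y - y₀‖ ^ 2)) • innerSL ℝ (y - y₀)) y := by
  have h1 : HasFDerivAt (fun z => r ^ 2 - ‖z - y₀‖ ^ 2) (-(2 • innerSL ℝ (y - y₀))) y := by
    have := ((hasFDerivAt_id y).sub_const y₀).norm_sq.const_sub (r ^ 2)
    simpa using this
  refine ((h1.pow 2).const_mul c).congr_fderiv ?_
  ext w
  simp
  ring

theorem fderiv_fderiv_barrier (y₀ : EuclideanSpace ℝ (Fin n)) (c r : ℝ)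
    (y w : EuclideanSpace ℝ (Fin n)) :
    fderiv ℝ (fderiv ℝ fun z => c * (r ^ 2 - ‖z - y₀‖ ^ 2) ^ 2) y w w =
      c * (8 * inner ℝ (y - y₀) w ^ 2 - 4 * (r ^ 2 - ‖y - y₀‖ ^ 2) * ‖w‖ ^ 2) := by
  have e1 : (fderiv ℝ fun z => c * (r ^ 2 - ‖z - y₀‖ ^ 2) ^ 2) =
      fun y => (-4 * c * (r ^ 2 - ‖y - y₀‖ ^ 2)) • innerSL ℝ (y - y₀) := by
    ext1 z; exact (hasFDerivAt_barrier y₀ c r z).fderiv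
  rw [e1]
  have h1 : HasFDerivAt (fun z => -4 * c * (r ^ 2 - ‖z - y₀‖ ^ 2))
      ((-4 * c) • -((2 : ℝ) • innerSL ℝ (y - y₀))) y := by
    have := (((hasFDerivAt_id y).sub_const y₀).norm_sq.const_sub (r ^ 2)).const_mul (-4 * c)
    simpa [two_smul] using this
  have h2 : HasFDerivAt (fun z => innerSL ℝ (z - y₀)) (innerSL ℝ) y :=
    (innerSL ℝ).hasFDerivAt.comp y ((hasFDerivAt_id y).sub_const y₀)
  have e2 : (innerSL ℝ w) w = ‖w‖ ^ 2 := real_inner_self_eq_norm_sq w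
  have e3 : inner ℝ (y - y₀) w = inner ℝ y w - inner ℝ y₀ w := inner_sub_left _ _ _
  rw [(h1.fun_smul h2).fderiv]
  simp [e2, e3]
  ring

/-- This is the subsolution inequality for the barrier, divided by ε e^{−Kt}. Here `s` is the
distance to the centre, φ = r² − s², and `A`, `B`, `D` stand for Σ aᵢ⟨y − y₀, bᵢ⟩², Σ aᵢ|bᵢ|² and ⟨y
− y₀, β⟩. Near the lateral boundary φ is small and ellipticity makes `8 * A` dominant; elsewhere the
φ² term dominates. -/
theorem barrier_algebra {lam C r s φ A B D γ : ℝ} (hlam : 0 < lam) (hr : 0 < r)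
    (hφ0 : 0 ≤ φ) (hs : s ^ 2 = r ^ 2 - φ) (hA : lam * s ^ 2 ≤ A) (hB : B ≤ C)
    (hD : |D| ≤ s * C) (hC : 0 ≤ C) (hγ : |γ| ≤ C) :
    0 ≤ 8 * A - 4 * φ * B - 4 * φ * D
      + (γ + (C + (8 * lam + 4 * C + 4 * C * r) ^ 2 / (32 * lam * r ^ 2))) * φ ^ 2 := by
  have hsr : s ≤ r := by
    refine abs_le_of_sq_le_sq' (by linarith) hr.le |>.2
  set b := 8 * lam + 4 * C + 4 * C * r with hb
  -- The constant b²/(32 λ r²) is exactly the one that completes the square.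
  have h1 : 0 ≤ 8 * lam * r ^ 2 - b * φ + b ^ 2 / (32 * lam * r ^ 2) * φ ^ 2 := by
    have e : 8 * lam * r ^ 2 - b * φ + b ^ 2 / (32 * lam * r ^ 2) * φ ^ 2
        = (16 * lam * r ^ 2 - b * φ) ^ 2 / (32 * lam * r ^ 2) := by
      field_simp; ring
    rw [e]; positivity
  have h2 : φ * B ≤ φ * C := mul_le_mul_of_nonneg_left hB hφ0
  have h3 : φ * D ≤ φ * (r * C) := mul_le_mul_of_nonneg_left
    ((le_abs_self D).trans (hD.trans (mul_le_mul_of_nonneg_right hsr hC))) hφ0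
  have h4 : 0 ≤ (γ + C) * φ ^ 2 := mul_nonneg (by linarith [neg_abs_le γ]) (sq_nonneg _)
  have h5 : lam * s ^ 2 = lam * r ^ 2 - lam * φ := by rw [hs]; ring
  have e : b * φ = 8 * lam * φ + 4 * (φ * C) + 4 * (φ * (r * C)) := by rw [hb]; ring
  have e2 : (γ + (C + b ^ 2 / (32 * lam * r ^ 2))) * φ ^ 2
    = (γ + C) * φ ^ 2 + b ^ 2 / (32 * lam * r ^ 2) * φ ^ 2 := by ring
  rw [e2]
  linarith

/-- The barrier ψ is a subsolution that vanishes on the lateral boundary and lies below v initially.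
Comparison gives v ≥ ψ, and ψ is positive at the centre for all times. -/
theorem pos_of_isParabolicAt {v : ℝ × EuclideanSpace ℝ (Fin n) → ℝ} {T R lam C : ℝ}
    {y₀ : EuclideanSpace ℝ (Fin n)} (hR : 0 < R) (hlam : 0 < lam) (hC : 0 ≤ C)
    (hcont : ContinuousOn v (Icc 0 T ×ˢ Metric.closedBall y₀ R))
    (hnonneg : ∀ t ∈ Icc 0 T, ∀ y ∈ Metric.closedBall y₀ R, 0 ≤ v (t, y))
    (hv : ∀ t ∈ Ioc 0 T, ∀ y ∈ Metric.closedBall y₀ R, IsParabolicAt lam C v t y)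
    (h0 : 0 < v (0, y₀)) : ∀ t ∈ Icc 0 T, 0 < v (t, y₀) := by
  intro t₁ ht₁
  have hT : 0 ≤ T := ht₁.1.trans ht₁.2
  obtain ⟨r, hr, hrR, hr0⟩ : ∃ r, 0 < r ∧ r ≤ R ∧
      ∀ y ∈ Metric.closedBall y₀ r, v (0, y₀) / 2 < v (0, y) := by
    have h1 : ContinuousWithinAt (fun y => v (0, y)) (Metric.closedBall y₀ R) y₀ := by
      have : ContinuousOn (fun y => v (0, y)) (Metric.closedBall y₀ R) :=
        hcont.comp (by fun_prop) fun y hy => ⟨⟨le_rfl, hT⟩, hy⟩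
      exact this y₀ (Metric.mem_closedBall_self hR.le)
    have h2 := (h1.continuousAt (Metric.closedBall_mem_nhds y₀ hR)).eventually
      (lt_mem_nhds (half_lt_self h0))
    obtain ⟨r, hr, h3⟩ := Metric.nhds_basis_closedBall.eventually_iff.1 h2
    exact ⟨min r R, lt_min hr hR, min_le_right _ _, fun y hy =>
      h3 (Metric.closedBall_subset_closedBall (min_le_left _ _) hy)⟩
  -- Chosen so that ψ(0, ·) has maximum v(0, y₀)/2, which is below v(0, ·) on the ball of radius r.
  set ε := v (0, y₀) / 2 / r ^ 4 with hε
  have hε0 : 0 < ε := by positivity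
  set K := C + (8 * lam + 4 * C + 4 * C * r) ^ 2 / (32 * lam * r ^ 2) with hK
  set ψ : ℝ × EuclideanSpace ℝ (Fin n) → ℝ :=
    fun p => ε * Real.exp (-K * p.1) * (r ^ 2 - ‖p.2 - y₀‖ ^ 2) ^ 2 with hψ
  have hψc : Continuous ψ := by fun_prop
  have hsub : Metric.closedBall y₀ r ⊆ Metric.closedBall y₀ R :=
    Metric.closedBall_subset_closedBall hrR
  suffices hle : ∀ t ∈ Icc 0 T, ∀ y ∈ Metric.closedBall y₀ r, ψ (t, y) ≤ v (t, y) by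
    refine lt_of_lt_of_le ?_ (hle t₁ ht₁ y₀ (Metric.mem_closedBall_self hr.le))
    simp only [hψ, sub_self, norm_zero]
    have := Real.exp_pos (-K * t₁)
    have h2 : r ^ 2 - 0 ^ 2 ≠ 0 := by simp [hr.ne']
    exact mul_pos (mul_pos hε0 this) (by positivity)
  by_contra! hcon
  obtain ⟨t₂, ht₂, y₂, hy₂, hneg₂⟩ := hcon
  -- The exponential weight with rate C + 1 again makes the inequality strict at a negative minimum
  -- of v − ψ.
  have hwc : ContinuousOn (fun p : ℝ × EuclideanSpace ℝ (Fin n) =>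
      Real.exp (-(C + 1) * p.1) * (v p - ψ p)) (Icc 0 T ×ˢ Metric.closedBall y₀ r) := by
    refine ContinuousOn.mul (by fun_prop) ((hcont.mono (prod_mono_right hsub)).sub hψc.continuousOn)
  obtain ⟨⟨t, y⟩, ⟨ht, hy⟩, hmin⟩ := (isCompact_Icc.prod (isCompact_closedBall y₀ r)).exists_isMinOn
    ⟨(t₂, y₂), ht₂, hy₂⟩ hwc
  simp only at ht hy
  have hmin' : ∀ s ∈ Icc 0 T, ∀ z ∈ Metric.closedBall y₀ r,
      Real.exp (-(C + 1) * t) * (v (t, y) - ψ (t, y))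
        ≤ Real.exp (-(C + 1) * s) * (v (s, z) - ψ (s, z)) :=
    fun s hs z hz => hmin (a := (s, z)) ⟨hs, hz⟩
  have hneg : v (t, y) - ψ (t, y) < 0 := by
    have h1 := hmin' t₂ ht₂ y₂ hy₂
    have h2 := mul_neg_of_pos_of_neg (Real.exp_pos (-(C + 1) * t₂)) (sub_neg.2 hneg₂)
    exact neg_of_mul_neg_right (h1.trans_lt h2) (Real.exp_pos _).le
  have hyn : ‖y - y₀‖ ≤ r := by rwa [← dist_eq_norm]
  have hφ0 : 0 ≤ r ^ 2 - ‖y - y₀‖ ^ 2 := by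
    have := pow_le_pow_left₀ (norm_nonneg _) hyn 2
    linarith
  have ht0 : 0 < t := by
    rcases ht.1.eq_or_lt with h1 | h1
    · subst h1
      exfalso
      have h2 := hr0 y hy
      have h3 : ψ (0, y) ≤ v (0, y₀) / 2 := by
        have e : v (0, y₀) / 2 = ε * (r ^ 2) ^ 2 := by rw [hε]; field_simp
        rw [e]
        simp only [hψ, mul_zero, Real.exp_zero, mul_one]
        refine mul_le_mul_of_nonneg_left (pow_le_pow_left₀ hφ0 ?_ 2) hε0.le
        linarith [sq_nonneg ‖y - y₀‖]
      linarith
    · exact h1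
  have hy1 : ‖y - y₀‖ < r := by
    refine lt_of_le_of_ne hyn fun h1 => ?_
    have h2 : ψ (t, y) = 0 := by simp [hψ, h1]
    have := hnonneg t ht y (hsub hy)
    linarith
  obtain ⟨hv2, a, b, β, γ, ha, hb, hβ, hγ, hell, heq⟩ := hv t ⟨ht0, ht.2⟩ y (hsub hy)
  have hψ2 : ContDiffAt ℝ 2 (fun z => ψ (t, z)) y := by
    have : ContDiff ℝ 2 (fun z => ψ (t, z)) := by
      simp only [hψ]
      exact contDiff_const.mul ((contDiff_const.sub
        ((contDiff_id.sub contDiff_const).norm_sq ℝ)).pow 2)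
    exact this.contDiffAt
  have hloc : IsLocalMin (fun z => v (t, z) - ψ (t, z)) y := by
    have : Metric.closedBall y₀ r ∈ 𝓝 y :=
      Metric.closedBall_mem_nhds_of_mem (by rwa [Metric.mem_ball, dist_eq_norm])
    filter_upwards [this] with z hz
    exact le_of_mul_le_mul_left (hmin' t ht z hz) (Real.exp_pos _)
  have hvs : ContDiffAt ℝ 2 (fun z => v (t, z)) y := contDiffAt_slice hv2
  have hd1 : fderiv ℝ (fun z => v (t, z)) y = fderiv ℝ (fun z => ψ (t, z)) y := by
    have := hloc.fderiv_eq_zero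
    rw [fderiv_fun_sub (hvs.differentiableAt (by norm_num))
      (hψ2.differentiableAt (by norm_num))] at this
    exact sub_eq_zero.1 this
  have hd2 : ∀ w, fderiv ℝ (fderiv ℝ fun z => ψ (t, z)) y w w
      ≤ fderiv ℝ (fderiv ℝ fun z => v (t, z)) y w w := by
    intro w
    have h1 := hessian_nonneg_of_isLocalMin hloc (hvs.sub hψ2) w
    have h2 : (fderiv ℝ fun z => v (t, z) - ψ (t, z)) =ᶠ[𝓝 y]
        fun z => fderiv ℝ (fun z => v (t, z)) z - fderiv ℝ (fun z => ψ (t, z)) z := by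
      filter_upwards [hvs.eventually (by simp), hψ2.eventually (by simp)] with z h3 h4
      exact fderiv_fun_sub (h3.differentiableAt (by norm_num)) (h4.differentiableAt (by norm_num))
    rw [h2.fderiv_eq, fderiv_fun_sub
      ((hvs.fderiv_right (m := 1) (by norm_num)).differentiableAt (by norm_num))
      ((hψ2.fderiv_right (m := 1) (by norm_num)).differentiableAt (by norm_num))] at h1
    simpa using h1
  have hψt : HasDerivAt (fun s => ψ (s, y)) (-K * ψ (t, y)) t := by
    have h1 : HasDerivAt (fun s => Real.exp (-K * s)) (Real.exp (-K * t) * (-K)) t := by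
      have := ((hasDerivAt_id t).const_mul (-K)).exp
      simpa using this
    refine ((h1.const_mul ε).mul_const ((r ^ 2 - ‖y - y₀‖ ^ 2) ^ 2)).congr_deriv ?_
    simp only [hψ]
    ring
  have hle := deriv_le_mul_of_isMinOn (K := C + 1) ht0 ((hasDerivAt_slice hv2).sub hψt)
    fun s hs => hmin' s ⟨hs.1, hs.2.trans ht.2⟩ y hy
  simp only [Pi.sub_apply] at hle
  have hsum : ∑ i, a i * fderiv ℝ (fderiv ℝ fun z => ψ (t, z)) y (b i) (b i)
      ≤ ∑ i, a i * fderiv ℝ (fderiv ℝ fun z => v (t, z)) y (b i) (b i) :=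
    Finset.sum_le_sum fun i _ => mul_le_mul_of_nonneg_left (hd2 _) (ha i)
  have hsum2 : ∑ i, a i * fderiv ℝ (fderiv ℝ fun z => ψ (t, z)) y (b i) (b i)
      = ε * Real.exp (-K * t) * (8 * ∑ i, a i * inner ℝ (y - y₀) (b i) ^ 2
        - 4 * (r ^ 2 - ‖y - y₀‖ ^ 2) * ∑ i, a i * ‖b i‖ ^ 2) := by
    simp only [hψ, fderiv_fderiv_barrier, Finset.mul_sum, ← Finset.sum_sub_distrib]
    exact Finset.sum_congr rfl fun i _ => by ring
  have hgrad : fderiv ℝ (fun z => ψ (t, z)) y β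
      = -4 * (ε * Real.exp (-K * t)) * (r ^ 2 - ‖y - y₀‖ ^ 2) * inner ℝ (y - y₀) β := by
    simp only [hψ]
    rw [(hasFDerivAt_barrier y₀ _ r y).fderiv]
    simp only [smul_apply, innerSL_apply_apply, smul_eq_mul]
  have halg := barrier_algebra hlam hr hφ0 (by ring : ‖y - y₀‖ ^ 2 = _)
    (hell (y - y₀)) hb ((abs_real_inner_le_norm (y - y₀) β).trans
      (mul_le_mul_of_nonneg_left hβ (norm_nonneg _))) hC hγ
  rw [← hK] at halg
  have halg2 := mul_nonneg (mul_pos hε0 (Real.exp_pos (-K * t))).le halg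
  have hγ2 := mul_le_mul_of_nonpos_right ((le_abs_self γ).trans hγ) hneg.le
  have hψv : ψ (t, y) = ε * Real.exp (-K * t) * (r ^ 2 - ‖y - y₀‖ ^ 2) ^ 2 := rfl
  rw [heq, hd1, hgrad] at hle
  rw [hsum2] at hsum
  -- With equal gradients and ordered Hessians, the equation for v and the subsolution inequality
  -- give ∂ₜ(v − ψ) ≥ γ(v − ψ) ≥ C(v − ψ), whereas minimality gives ∂ₜ(v − ψ) ≤ (C+1)(v − ψ) < C(v −
  -- ψ).
  nlinarith [hle, hsum, halg2, hγ2, hneg, hψv]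

/-! ### Partial derivatives on space-time -/

section Spatial

variable {E V : Type*} [NormedAddCommGroup E] [NormedSpace ℝ E] [NormedAddCommGroup V]
  [NormedSpace ℝ V]

/-- The derivative of a function on space-time in the spatial directions. -/
noncomputable def spatialDeriv (f : ℝ × E → V) (p : ℝ × E) : E →L[ℝ] V :=
  fderiv ℝ (fun y => f (p.1, y)) p.2

theorem spatialDeriv_eq {f : ℝ × E → V} {p : ℝ × E} (hf : DifferentiableAt ℝ f p) :
    spatialDeriv f p = (fderiv ℝ f p).comp (ContinuousLinearMap.inr ℝ ℝ E) := by
  have h1 : HasFDerivAt (fun y : E => (p.1, y)) (ContinuousLinearMap.inr ℝ ℝ E) p.2 :=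
    hasFDerivAt_prodMk_right p.1 p.2
  have h2 : HasFDerivAt f (fderiv ℝ f p) (p.1, p.2) := hf.hasFDerivAt
  exact (h2.comp p.2 h1).fderiv

theorem hasFDerivAt_spatialDeriv {f : ℝ × E → V} {p : ℝ × E} (hf : DifferentiableAt ℝ f p) :
    HasFDerivAt (fun y => f (p.1, y)) (spatialDeriv f p) p.2 := by
  have h1 : DifferentiableAt ℝ (fun y : E => (p.1, y)) p.2 :=
    (hasFDerivAt_prodMk_right p.1 p.2).differentiableAt
  have h2 : DifferentiableAt ℝ f (p.1, p.2) := hf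
  exact (h2.comp p.2 h1).hasFDerivAt

theorem spatialDeriv_eq_within {f : ℝ × E → V} {A : Set ℝ} {U : Set E} (hU : IsOpen U)
    {p : ℝ × E} (hp : p ∈ A ×ˢ U) (hf : DifferentiableWithinAt ℝ f (A ×ˢ U) p) :
    spatialDeriv f p =
      (fderivWithin ℝ f (A ×ˢ U) p).comp (ContinuousLinearMap.inr ℝ ℝ E) := by
  have h1 : HasFDerivWithinAt (fun y : E => (p.1, y)) (ContinuousLinearMap.inr ℝ ℝ E) U p.2 :=
    (hasFDerivAt_prodMk_right p.1 p.2).hasFDerivWithinAt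
  have h2 : HasFDerivWithinAt f (fderivWithin ℝ f (A ×ˢ U) p) (A ×ˢ U) (p.1, p.2) :=
    hf.hasFDerivWithinAt
  have h3 := h2.comp p.2 h1 fun y hy => ⟨hp.1, hy⟩
  exact (h3.hasFDerivAt (hU.mem_nhds hp.2)).fderiv

/-- Regularity up to the initial time: `A` may contain its left end point, while the spatial domain
is open, so that the unrestricted spatial derivative agrees with the within-derivative. -/
theorem contDiffOn_spatialDeriv {f : ℝ × E → V} {A : Set ℝ} {U : Set E} {m m' : WithTop ℕ∞}
    (hA : UniqueDiffOn ℝ A) (hU : IsOpen U) (hm : m + 1 ≤ m')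
    (hf : ContDiffOn ℝ m' f (A ×ˢ U)) : ContDiffOn ℝ m (spatialDeriv f) (A ×ˢ U) := by
  have h1 := hf.fderivWithin (hA.prod hU.uniqueDiffOn) hm
  refine (h1.clm_comp (contDiffOn_const (c := ContinuousLinearMap.inr ℝ ℝ E))).congr fun p hp => ?_
  refine spatialDeriv_eq_within hU hp (hf.differentiableOn (fun h => ?_) p hp)
  simp [h] at hm

theorem contDiffAt_spatialDeriv {f : ℝ × E → V} {m m' : WithTop ℕ∞} {p : ℝ × E}
    (hm : m + 1 ≤ m') (hm' : m' ≠ ∞) (hf : ContDiffAt ℝ m' f p) :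
    ContDiffAt ℝ m (spatialDeriv f) p := by
  have h1 := hf.fderiv_right hm
  refine (h1.clm_comp (contDiffAt_const (c := ContinuousLinearMap.inr ℝ ℝ
      E))).congr_of_eventuallyEq ?_
  filter_upwards [hf.eventually hm'] with q hq
  refine spatialDeriv_eq (hq.differentiableAt (fun h => ?_))
  simp [h] at hm

/-- Time and space derivatives commute by symmetry of the second derivative. The time derivative `k`
is prescribed near the point, so the lemma can be iterated. -/
theorem hasDerivAt_spatialDeriv {f k : ℝ × E → V} {t : ℝ} {y : E} (hf : ContDiffAt ℝ 2 f (t, y))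
    (hk : ∀ᶠ p in 𝓝 (t, y), HasDerivAt (fun s => f (s, p.2)) (k p) p.1) :
    HasDerivAt (fun s => spatialDeriv f (s, y)) (spatialDeriv k (t, y)) t := by
  have hev : ∀ᶠ p in 𝓝 (t, y), DifferentiableAt ℝ f p :=
    (hf.eventually (by simp)).mono fun p hp => hp.differentiableAt (by norm_num)
  have hD : HasFDerivAt (fderiv ℝ f) (fderiv ℝ (fderiv ℝ f) (t, y)) (t, y) :=
    ((hf.fderiv_right (m := 1) (by norm_num)).differentiableAt (by norm_num)).hasFDerivAt
  have hsymm : IsSymmSndFDerivAt ℝ f (t, y) := hf.isSymmSndFDerivAt (by simp)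
  have hkf : k =ᶠ[𝓝 (t, y)] fun p => fderiv ℝ f p (1, 0) := by
    filter_upwards [hev, hk] with p h1 h2
    have h3 : HasDerivAt (fun s : ℝ => (s, p.2)) ((1 : ℝ), (0 : E)) p.1 :=
      (hasDerivAt_id p.1).prodMk (hasDerivAt_const _ _)
    have h4 : HasFDerivAt f (fderiv ℝ f p) (p.1, p.2) := h1.hasFDerivAt
    exact h2.unique (h4.comp_hasDerivAt p.1 h3)
  have hkd : HasFDerivAt k
      ((ContinuousLinearMap.apply ℝ V ((1 : ℝ), (0 : E))).comp (fderiv ℝ (fderiv ℝ f) (t, y)))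
      (t, y) :=
    HasFDerivAt.congr_of_eventuallyEq
      ((ContinuousLinearMap.apply ℝ V ((1 : ℝ), (0 : E))).hasFDerivAt.comp _ hD) hkf
  have hl : HasDerivAt (fun s : ℝ => (s, y)) ((1 : ℝ), (0 : E)) t :=
    (hasDerivAt_id t).prodMk (hasDerivAt_const _ _)
  have h5 : HasDerivAt (fun s => fderiv ℝ f (s, y))
      (fderiv ℝ (fderiv ℝ f) (t, y) (1, 0)) t := hD.comp_hasDerivAt t hl
  have h6 : (fun s => spatialDeriv f (s, y)) =ᶠ[𝓝 t]
      fun s => (fderiv ℝ f (s, y)).comp (ContinuousLinearMap.inr ℝ ℝ E) := by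
    filter_upwards [hl.continuousAt.eventually hev] with s hs using spatialDeriv_eq hs
  refine HasDerivAt.congr_of_eventuallyEq ?_ h6
  refine (h5.clm_comp (hasDerivAt_const t (ContinuousLinearMap.inr ℝ ℝ E))).congr_deriv ?_
  rw [spatialDeriv_eq hkd.differentiableAt, hkd.fderiv]
  ext v
  simpa using (hsymm (1, 0) (0, v))

theorem spatialDeriv_smul {w : ℝ × E → ℝ} {ν : ℝ × E → V} {p : ℝ × E}
    (hw : DifferentiableAt ℝ w p) (hν : DifferentiableAt ℝ ν p) :
    spatialDeriv (fun q => w q • ν q) p =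
      w p • spatialDeriv ν p + (spatialDeriv w p).smulRight (ν p) :=
  ((hasFDerivAt_spatialDeriv hw).fun_smul (hasFDerivAt_spatialDeriv hν)).fderiv

theorem spatialDeriv_spatialDeriv_smul {w : ℝ × E → ℝ} {ν : ℝ × E → V} {p : ℝ × E}
    (hw : ContDiffAt ℝ 2 w p) (hν : ContDiffAt ℝ 2 ν p) (v v' : E) :
    spatialDeriv (spatialDeriv fun q => w q • ν q) p v v' =
      w p • spatialDeriv (spatialDeriv ν) p v v' + spatialDeriv w p v • spatialDeriv ν p v'
        + spatialDeriv w p v' • spatialDeriv ν p v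
        + spatialDeriv (spatialDeriv w) p v v' • ν p := by
  have h1 : HasFDerivAt (fun y : E => (p.1, y)) (ContinuousLinearMap.inr ℝ ℝ E) p.2 :=
    hasFDerivAt_prodMk_right p.1 p.2
  have hev : ∀ᶠ y in 𝓝 p.2, spatialDeriv (fun q => w q • ν q) (p.1, y) =
      w (p.1, y) • spatialDeriv ν (p.1, y)
        + (spatialDeriv w (p.1, y)).smulRight (ν (p.1, y)) := by
    have h2 := h1.continuousAt.eventually (hw.eventually (by simp))
    have h3 := h1.continuousAt.eventually (hν.eventually (by simp))
    filter_upwards [h2, h3] with y h4 h5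
    exact spatialDeriv_smul (h4.differentiableAt (by norm_num)) (h5.differentiableAt (by norm_num))
  have hw1 := hasFDerivAt_spatialDeriv (hw.differentiableAt (by norm_num))
  have hν1 := hasFDerivAt_spatialDeriv (hν.differentiableAt (by norm_num))
  have hw2 := hasFDerivAt_spatialDeriv ((contDiffAt_spatialDeriv (m := 1) (by norm_num) (by simp)
    hw).differentiableAt (by norm_num))
  have hν2 := hasFDerivAt_spatialDeriv ((contDiffAt_spatialDeriv (m := 1) (by norm_num) (by simp)
    hν).differentiableAt (by norm_num))
  have key : HasFDerivAt (fun y => w (p.1, y) • spatialDeriv ν (p.1, y) v'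
      + spatialDeriv w (p.1, y) v' • ν (p.1, y)) _ p.2 :=
    (hw1.fun_smul (hν2.clm_apply (hasFDerivAt_const v' p.2))).add
      ((hw2.clm_apply (hasFDerivAt_const v' p.2)).fun_smul hν1)
  have hsm : ContDiffAt ℝ 2 (fun q => w q • ν q) p := hw.smul hν
  have hL := hasFDerivAt_spatialDeriv ((contDiffAt_spatialDeriv (m := 1) (by norm_num) (by simp)
    hsm).differentiableAt (by norm_num))
  have key2 := (hL.clm_apply (hasFDerivAt_const v' p.2)).congr_of_eventuallyEq
    (f₁ := fun y => w (p.1, y) • spatialDeriv ν (p.1, y) v'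
      + spatialDeriv w (p.1, y) v' • ν (p.1, y)) (by
    filter_upwards [hev] with y hy
    rw [hy]; simp)
  have h := congrArg (fun L => L v) (key2.unique key)
  simp at h
  rw [h]
  abel

end Spatial

/-! ### Evolution of the second fundamental form in coordinates -/

section Pointwise

variable {E V : Type*} [NormedAddCommGroup E] [NormedSpace ℝ E] [NormedAddCommGroup V]
  [NormedSpace ℝ V]

/-- The Christoffel symbols of the first kind in terms of the derivative of the metric. -/
noncomputable def christoffelOf (G1 : V →L[ℝ] V →L[ℝ] V →L[ℝ] ℝ) (a b c : V) : ℝ :=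
  (G1 a b c + G1 b a c - G1 c a b) / 2

/-- The second fundamental form in terms of the metric, its derivative, the first and second
derivatives of the immersion, and the normal. -/
noncomputable def jetSff (G0 : V →L[ℝ] V →L[ℝ] ℝ) (G1 : V →L[ℝ] V →L[ℝ] V →L[ℝ] ℝ)
    (X1 : E →L[ℝ] V) (X2 : E →L[ℝ] E →L[ℝ] V) (ν : V) (v w : E) : ℝ :=
  -(G0 (X2 v w) ν + christoffelOf G1 (X1 v) (X1 w) ν)

theorem hasDerivAt_inducedMetric {G : V → V →L[ℝ] V →L[ℝ] ℝ} {X : ℝ → V} {X1 : ℝ → E →L[ℝ] V}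
    {X' : V} {X1' : E →L[ℝ] V} {t : ℝ} (hG : DifferentiableAt ℝ G (X t)) (hX : HasDerivAt X X' t)
    (hX1 : HasDerivAt X1 X1' t) (v w : E) :
    HasDerivAt (fun s => G (X s) (X1 s v) (X1 s w))
      (fderiv ℝ G (X t) X' (X1 t v) (X1 t w) + G (X t) (X1' v) (X1 t w)
        + G (X t) (X1 t v) (X1' w)) t := by
  have h0 : HasDerivAt (fun s => G (X s)) (fderiv ℝ G (X t) X') t :=
    hG.hasFDerivAt.comp_hasDerivAt t hX
  have h1 : ∀ v, HasDerivAt (fun s => X1 s v) (X1' v) t := fun v => by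
    simpa using hX1.clm_apply (hasDerivAt_const t v)
  refine ((h0.clm_apply (h1 v)).clm_apply (h1 w)).congr_deriv ?_
  simp

theorem hasDerivAt_jetSff {G : V → V →L[ℝ] V →L[ℝ] ℝ} {X ν : ℝ → V} {X1 : ℝ → E →L[ℝ] V}
    {X2 : ℝ → E →L[ℝ] E →L[ℝ] V} {X' ν' : V} {X1' : E →L[ℝ] V} {X2' : E →L[ℝ] E →L[ℝ] V} {t : ℝ}
    (hG : DifferentiableAt ℝ G (X t)) (hG1 : DifferentiableAt ℝ (fderiv ℝ G) (X t))
    (hX : HasDerivAt X X' t) (hX1 : HasDerivAt X1 X1' t) (hX2 : HasDerivAt X2 X2' t)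
    (hν : HasDerivAt ν ν' t) (v w : E) :
    HasDerivAt (fun s => jetSff (G (X s)) (fderiv ℝ G (X s)) (X1 s) (X2 s) (ν s) v w)
      (-(fderiv ℝ G (X t) X' (X2 t v w) (ν t) + G (X t) (X2' v w) (ν t) + G (X t) (X2 t v w) ν'
        + (christoffelOf (fderiv ℝ (fderiv ℝ G) (X t) X') (X1 t v) (X1 t w) (ν t)
        + christoffelOf (fderiv ℝ G (X t)) (X1' v) (X1 t w) (ν t)
        + christoffelOf (fderiv ℝ G (X t)) (X1 t v) (X1' w) (ν t)
        + christoffelOf (fderiv ℝ G (X t)) (X1 t v) (X1 t w) ν'))) t := by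
  have h0 : HasDerivAt (fun s => G (X s)) (fderiv ℝ G (X t) X') t :=
    hG.hasFDerivAt.comp_hasDerivAt t hX
  have h0' : HasDerivAt (fun s => fderiv ℝ G (X s)) (fderiv ℝ (fderiv ℝ G) (X t) X') t :=
    hG1.hasFDerivAt.comp_hasDerivAt t hX
  have h1 : ∀ v, HasDerivAt (fun s => X1 s v) (X1' v) t := fun v => by
    simpa using hX1.clm_apply (hasDerivAt_const t v)
  have h2 : HasDerivAt (fun s => X2 s v w) (X2' v w) t := by
    simpa using (hX2.clm_apply (hasDerivAt_const t v)).clm_apply (hasDerivAt_const t w)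
  have h3 := (((((h0'.clm_apply (h1 v)).clm_apply (h1 w)).clm_apply hν).add
    (((h0'.clm_apply (h1 w)).clm_apply (h1 v)).clm_apply hν)).sub
    (((h0'.clm_apply hν).clm_apply (h1 v)).clm_apply (h1 w))).div_const 2
  refine (((h0.clm_apply h2).clm_apply hν).add h3).neg.congr_deriv ?_
  simp only [christoffelOf, add_apply]
  ring

variable {n : ℕ}

/-- The zeroth order coefficient in the evolution equation of the induced metric. -/
noncomputable def metricCoeff (G0 : V →L[ℝ] V →L[ℝ] ℝ) (G1 : V →L[ℝ] V →L[ℝ] V →L[ℝ] ℝ)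
    (X1 : E →L[ℝ] V) (ν : V) (ν1 : E →L[ℝ] V) (v : E) : ℝ :=
  G1 ν (X1 v) (X1 v) + G0 (ν1 v) (X1 v) + G0 (X1 v) (ν1 v)

/-- The first order coefficient in the evolution equation of the second fundamental form. -/
noncomputable def sffGradCoeff (σ : ℝ) (G0 : V →L[ℝ] V →L[ℝ] ℝ)
    (G1 : V →L[ℝ] V →L[ℝ] V →L[ℝ] ℝ) (X1 : E →L[ℝ] V) (X2 : E →L[ℝ] E →L[ℝ] V) (ν : V)
    (ν1 : E →L[ℝ] V) (b : Fin n → E) (v : E) : E :=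
  (2 * G0 (ν1 v) ν + christoffelOf G1 ν (X1 v) ν + christoffelOf G1 (X1 v) ν ν) • v
    - ∑ i, (σ * (G0 (X2 v v) (X1 (b i)) + christoffelOf G1 (X1 v) (X1 v) (X1 (b i)))) • b i

/-- The zeroth order coefficient in the evolution equation of the second fundamental form. -/
noncomputable def sffCoeff (σ : ℝ) (G0 : V →L[ℝ] V →L[ℝ] ℝ)
    (G1 : V →L[ℝ] V →L[ℝ] V →L[ℝ] ℝ) (G2 : V →L[ℝ] V →L[ℝ] V →L[ℝ] V →L[ℝ] ℝ)
    (X1 : E →L[ℝ] V) (X2 : E →L[ℝ] E →L[ℝ] V) (ν : V)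
    (ν1 : E →L[ℝ] V) (ν2 : E →L[ℝ] E →L[ℝ] V) (b : Fin n → E) (v : E) : ℝ :=
  G1 ν (X2 v v) ν + G0 (ν2 v v) ν + christoffelOf (G2 ν) (X1 v) (X1 v) ν
    + christoffelOf G1 (ν1 v) (X1 v) ν + christoffelOf G1 (X1 v) (ν1 v) ν
    - σ * G1 ν ν ν / 2 * (G0 (X2 v v) ν + christoffelOf G1 (X1 v) (X1 v) ν)
    - ∑ i, (G0 (ν1 (b i)) ν + G1 ν (X1 (b i)) ν)
        * (G0 (X2 v v) (X1 (b i)) + christoffelOf G1 (X1 v) (X1 v) (X1 (b i)))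

theorem christoffelOf_add_right (G1 : V →L[ℝ] V →L[ℝ] V →L[ℝ] ℝ) (a b c c' : V) :
    christoffelOf G1 a b (c + c') = christoffelOf G1 a b c + christoffelOf G1 a b c' := by
  simp only [christoffelOf, map_add, add_apply]; ring

theorem christoffelOf_smul_right (G1 : V →L[ℝ] V →L[ℝ] V →L[ℝ] ℝ) (a b c : V) (r : ℝ) :
    christoffelOf G1 a b (r • c) = r * christoffelOf G1 a b c := by
  simp only [christoffelOf, map_smul, smul_apply, smul_eq_mul]; ring

theorem christoffelOf_smul_form (G1 : V →L[ℝ] V →L[ℝ] V →L[ℝ] ℝ) (a b c : V) (r : ℝ) :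
    christoffelOf (r • G1) a b c = r * christoffelOf G1 a b c := by
  simp only [christoffelOf, smul_apply, smul_eq_mul]; ring

theorem christoffelOf_lincomb_left (G1 : V →L[ℝ] V →L[ℝ] V →L[ℝ] ℝ) (a a' b c : V) (r s : ℝ) :
    christoffelOf G1 (r • a + s • a') b c
      = r * christoffelOf G1 a b c + s * christoffelOf G1 a' b c := by
  simp only [christoffelOf, map_smul, map_add, smul_apply,
    add_apply, smul_eq_mul]; ring

theorem christoffelOf_lincomb_middle (G1 : V →L[ℝ] V →L[ℝ] V →L[ℝ] ℝ) (a b b' c : V) (r s : ℝ) :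
    christoffelOf G1 a (r • b + s • b') c
      = r * christoffelOf G1 a b c + s * christoffelOf G1 a b' c := by
  simp only [christoffelOf, map_smul, map_add, smul_apply,
    add_apply, smul_eq_mul]; ring

/-- Expansion of a vector in the orthonormal frame consisting of a hypersurface frame and the unit
normal. -/
theorem eq_sum_frame [FiniteDimensional ℝ V] (hV : Module.finrank ℝ V = n + 1) {σ : ℝ}
    (hσ : σ * σ = 1) {G0 : V →L[ℝ] V →L[ℝ] ℝ} {ν : V} {e : Fin n → V}
    (hν : G0 ν ν = σ) (hνe : ∀ i, G0 (e i) ν = 0)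
    (he : ∀ i j, G0 (e i) (e j) = if i = j then 1 else 0) (η : V) :
    η = (σ * G0 η ν) • ν + ∑ i, G0 (e i) η • e i := by
  let F : Fin (n + 1) → V := Fin.cons ν e
  have hli : LinearIndependent ℝ F := by
    rw [Fintype.linearIndependent_iff]
    intro c hc
    rw [Fin.sum_univ_succ] at hc
    simp only [F, Fin.cons_zero, Fin.cons_succ] at hc
    have h0 : c 0 = 0 := by
      have := congrArg (fun z => G0 z ν) hc
      simp [hν, hνe] at this
      rcases this with h | h
      · exact h
      · simp [h] at hσ
    have hs : ∀ i : Fin n, c i.succ = 0 := by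
      intro i
      have := congrArg (fun z => G0 z (e i)) hc
      simpa [h0, he] using this
    intro i
    induction i using Fin.cases with
    | zero => exact h0
    | succ i => exact hs i
  have hspan : Submodule.span ℝ (range F) = ⊤ := by
    refine hli.span_eq_top_of_card_eq_finrank' ?_
    simp [hV]
  have hη : η ∈ Submodule.span ℝ (range F) := hspan ▸ Submodule.mem_top
  obtain ⟨c, rfl⟩ := (Submodule.mem_span_range_iff_exists_fun ℝ).1 hη
  rw [Fin.sum_univ_succ]
  simp only [F, Fin.cons_zero, Fin.cons_succ]
  have e1 : G0 (c 0 • ν + ∑ i, c (Fin.succ i) • e i) ν = c 0 * σ := by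
    simp [hν, hνe]
  have e2 : ∀ i, G0 (e i) (c 0 • ν + ∑ i, c (Fin.succ i) • e i) = c i.succ := by
    intro i
    simp [hνe, he]
  simp only [e1, e2]
  congr 2
  linear_combination -(c 0) * hσ

/-- The derivative of the speed enters ẋᵢ only in the normal direction, which is orthogonal to
tangent vectors; hence the evolution of the metric contains no derivative of `u`. -/
theorem deriv_metric_eq {σ u : ℝ} {G0 : V →L[ℝ] V →L[ℝ] ℝ} {G1 : V →L[ℝ] V →L[ℝ] V →L[ℝ] ℝ}
    {X1 X1' : E →L[ℝ] V} {ν : V} {ν1 : E →L[ℝ] V} {w1 : E →L[ℝ] ℝ}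
    (hsymm : ∀ a b, G0 a b = G0 b a) (hνt : ∀ v, G0 (X1 v) ν = 0)
    (hX1' : ∀ v, X1' v = (-σ * u) • ν1 v + w1 v • ν) (v : E) :
    G1 ((-σ * u) • ν) (X1 v) (X1 v) + G0 (X1' v) (X1 v) + G0 (X1 v) (X1' v)
      = -σ * u * metricCoeff G0 G1 X1 ν ν1 v := by
  have h : G0 ν (X1 v) = 0 := by rw [hsymm]; exact hνt v
  simp only [hX1', metricCoeff, map_smul, map_add, smul_apply,
    add_apply, smul_eq_mul, hνt, h]
  ring

/-- The evolution equation of the second fundamental form. -/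
theorem deriv_sff_eq [FiniteDimensional ℝ V] (hV : Module.finrank ℝ V = n + 1) {σ u : ℝ}
    (hσ : σ * σ = 1) {G0 : V →L[ℝ] V →L[ℝ] ℝ} {G1 : V →L[ℝ] V →L[ℝ] V →L[ℝ] ℝ}
    {G2 : V →L[ℝ] V →L[ℝ] V →L[ℝ] V →L[ℝ] ℝ} {X1 X1' : E →L[ℝ] V} {X2 X2' : E →L[ℝ] E →L[ℝ] V}
    {ν ν' : V} {ν1 : E →L[ℝ] V} {ν2 : E →L[ℝ] E →L[ℝ] V} {u1 : E →L[ℝ] ℝ}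
    {u2 : E →L[ℝ] E →L[ℝ] ℝ} {b : Fin n → E}
    (hsymm : ∀ a b, G0 a b = G0 b a) (hν : G0 ν ν = σ) (hνt : ∀ v, G0 (X1 v) ν = 0)
    (hb : ∀ i j, G0 (X1 (b i)) (X1 (b j)) = if i = j then 1 else 0)
    (hX1' : ∀ v, X1' v = (-σ * u) • ν1 v + (-σ * u1 v) • ν)
    (hX2' : ∀ v, X2' v v = (-σ * u) • ν2 v v + (-σ * u1 v) • ν1 v + (-σ * u1 v) • ν1 v
      + (-σ * u2 v v) • ν)
    (hν'1 : G1 ((-σ * u) • ν) ν ν + G0 ν' ν + G0 ν ν' = 0)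
    (hν'2 : ∀ v, G1 ((-σ * u) • ν) (X1 v) ν + G0 (X1' v) ν + G0 (X1 v) ν' = 0) (v : E) :
    -(G1 ((-σ * u) • ν) (X2 v v) ν + G0 (X2' v v) ν + G0 (X2 v v) ν'
        + (christoffelOf (G2 ((-σ * u) • ν)) (X1 v) (X1 v) ν
        + christoffelOf G1 (X1' v) (X1 v) ν + christoffelOf G1 (X1 v) (X1' v) ν
        + christoffelOf G1 (X1 v) (X1 v) ν'))
      = u2 v v + σ * u1 (sffGradCoeff σ G0 G1 X1 X2 ν ν1 b v)
        + σ * sffCoeff σ G0 G1 G2 X1 X2 ν ν1 ν2 b v * u := by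
  have hsum : ∀ (c : Fin n → ℝ), G0 (X2 v v) (∑ i, c i • X1 (b i))
      + christoffelOf G1 (X1 v) (X1 v) (∑ i, c i • X1 (b i))
      = ∑ i, c i * (G0 (X2 v v) (X1 (b i)) + christoffelOf G1 (X1 v) (X1 v) (X1 (b i))) := by
    intro c
    simp only [christoffelOf, map_sum, map_smul, sum_apply,
      smul_apply, smul_eq_mul]
    rw [← Finset.sum_add_distrib, ← Finset.sum_sub_distrib, Finset.sum_div,
      ← Finset.sum_add_distrib]
    exact Finset.sum_congr rfl fun i _ => by ring
  -- Tangential components of the time derivative of the normal, from differentiating ⟨xᵢ, ν⟩ = 0.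
  -- They are the source of one of the gradient terms.
  have hτ : ∀ i, G0 (X1 (b i)) ν'
      = u1 (b i) + u * σ * (G0 (ν1 (b i)) ν + G1 ν (X1 (b i)) ν) := by
    intro i
    have := hν'2 (b i)
    simp only [hX1', map_smul, map_add, smul_apply,
      add_apply, smul_eq_mul, hν] at this
    linear_combination this + u1 (b i) * hσ
  -- Normal component, from differentiating ⟨ν, ν⟩ = σ. It need not vanish, because coordinate
  -- rather than covariant derivatives are used.
  have hα : G0 ν' ν = σ * u * G1 ν ν ν / 2 := by
    rw [hsymm ν ν'] at hν'1
    simp only [map_smul, smul_apply, smul_eq_mul] at hν'1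
    linear_combination hν'1 / 2
  have hdec := eq_sum_frame hV hσ hν (fun i => hνt (b i)) hb ν'
  have hZ : G0 (X2 v v) ν' + christoffelOf G1 (X1 v) (X1 v) ν'
      = u * G1 ν ν ν / 2 * (G0 (X2 v v) ν + christoffelOf G1 (X1 v) (X1 v) ν)
        + ∑ i, (u1 (b i) + u * σ * (G0 (ν1 (b i)) ν + G1 ν (X1 (b i)) ν))
          * (G0 (X2 v v) (X1 (b i)) + christoffelOf G1 (X1 v) (X1 v) (X1 (b i))) := by
    conv_lhs => rw [hdec]
    rw [christoffelOf_add_right, map_add, christoffelOf_smul_right, map_smul]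
    have := hsum fun i => G0 (X1 (b i)) ν'
    simp only [hτ] at this ⊢
    rw [hα]
    simp only [smul_eq_mul]
    linear_combination this + (u * G1 ν ν ν / 2 * (G0 (X2 v v) ν
      + christoffelOf G1 (X1 v) (X1 v) ν)) * hσ
  have hS : ∑ i, (u1 (b i) + u * σ * (G0 (ν1 (b i)) ν + G1 ν (X1 (b i)) ν))
          * (G0 (X2 v v) (X1 (b i)) + christoffelOf G1 (X1 v) (X1 v) (X1 (b i)))
      = ∑ i, (G0 (X2 v v) (X1 (b i)) + christoffelOf G1 (X1 v) (X1 v) (X1 (b i))) * u1 (b i)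
        + u * σ * ∑ i, (G0 (ν1 (b i)) ν + G1 ν (X1 (b i)) ν)
        * (G0 (X2 v v) (X1 (b i)) + christoffelOf G1 (X1 v) (X1 v) (X1 (b i))) := by
    rw [Finset.mul_sum, ← Finset.sum_add_distrib]
    exact Finset.sum_congr rfl fun i _ => by ring
  rw [hS] at hZ
  have hu1 : u1 (sffGradCoeff σ G0 G1 X1 X2 ν ν1 b v)
      = (2 * G0 (ν1 v) ν + christoffelOf G1 ν (X1 v) ν + christoffelOf G1 (X1 v) ν ν) * u1 v
        - σ * ∑ i, (G0 (X2 v v) (X1 (b i)) + christoffelOf G1 (X1 v) (X1 v) (X1 (b i)))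
          * u1 (b i) := by
    simp only [sffGradCoeff, map_sub, map_smul, map_sum, smul_eq_mul, Finset.mul_sum, mul_assoc]
  rw [hu1, sffCoeff, hX1', hX2', map_smul G2, christoffelOf_smul_form,
    christoffelOf_lincomb_left, christoffelOf_lincomb_middle]
  simp only [map_smul, map_add, smul_apply,
      add_apply, smul_eq_mul, hν]
  set S1 := ∑ i, (G0 (X2 v v) (X1 (b i)) + christoffelOf G1 (X1 v) (X1 v) (X1 (b i))) * u1 (b i)
  set S2 := ∑ i, (G0 (ν1 (b i)) ν + G1 ν (X1 (b i)) ν)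
        * (G0 (X2 v v) (X1 (b i)) + christoffelOf G1 (X1 v) (X1 v) (X1 (b i)))
  linear_combination -hZ + (u2 v v + S1 + u * G1 ν ν ν / 2 * (G0 (X2 v v) ν
      + christoffelOf G1 (X1 v) (X1 v) ν)) * hσ

end Pointwise

/-! ### The flow in coordinates -/

section Frames

variable {n : ℕ}

theorem spatialDeriv_const_mul (c : ℝ) (u : ℝ × EuclideanSpace ℝ (Fin n) → ℝ) :
    spatialDeriv (fun q => c * u q) = fun q => c • spatialDeriv u q := by
  ext1 q
  exact congrFun (fderiv_const_smul_field (𝕜 := ℝ) (f := fun y => u (q.1, y)) c) q.2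

theorem spatialDeriv_const_smul (c : ℝ) (u : ℝ × EuclideanSpace ℝ (Fin n) →
    EuclideanSpace ℝ (Fin n) →L[ℝ] ℝ) :
    spatialDeriv (fun q => c • u q) = fun q => c • spatialDeriv u q := by
  ext1 q
  exact congrFun (fderiv_const_smul_field (𝕜 := ℝ) (f := fun y => u (q.1, y)) c) q.2

/-- `jetSff` as a bilinear map. -/
noncomputable def jetSffBilin (G0 : EuclideanSpace ℝ (Fin (n + 1)) →L[ℝ]
    EuclideanSpace ℝ (Fin (n + 1)) →L[ℝ] ℝ) (G1 : EuclideanSpace ℝ (Fin (n + 1)) →L[ℝ] EuclideanSpace ℝ (Fin (n + 1)) →L[ℝ]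
        EuclideanSpace ℝ (Fin (n + 1)) →L[ℝ] ℝ)
    (X1 : EuclideanSpace ℝ (Fin n) →L[ℝ] EuclideanSpace ℝ (Fin (n + 1)))
    (X2 : EuclideanSpace ℝ (Fin n) →L[ℝ] EuclideanSpace ℝ (Fin n) →L[ℝ]
    EuclideanSpace ℝ (Fin (n + 1))) (ν : EuclideanSpace ℝ (Fin (n + 1))) : EuclideanSpace ℝ (Fin n) →ₗ[ℝ]
    EuclideanSpace ℝ (Fin n) →ₗ[ℝ] ℝ :=
  LinearMap.mk₂ ℝ (jetSff G0 G1 X1 X2 ν)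
    (fun a b c => by simp only [jetSff, christoffelOf, map_add, add_apply]; ring)
    (fun r a b => by
      simp only [jetSff, christoffelOf, map_smul, smul_apply, smul_eq_mul]; ring)
    (fun a b c => by simp only [jetSff, christoffelOf, map_add, add_apply]; ring)
    (fun r a b => by
      simp only [jetSff, christoffelOf, map_smul, smul_apply, smul_eq_mul]; ring)

theorem transpose_mul_mul_apply_bilin {L : EuclideanSpace ℝ (Fin n) →ₗ[ℝ] EuclideanSpace ℝ (Fin n)
    →ₗ[ℝ] ℝ} {b b' : Fin n → EuclideanSpace ℝ (Fin n)}
    {B : Matrix (Fin n) (Fin n) ℝ} (hB : ∀ j, b' j = ∑ i, B i j • b i) :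
    B.transpose * (Matrix.of fun i j => L (b i) (b j)) * B =
      Matrix.of fun i j => L (b' i) (b' j) := by
  ext i j
  simp only [Matrix.mul_apply, Matrix.transpose_apply, Matrix.of_apply, hB, map_sum, map_smul,
    LinearMap.sum_apply, LinearMap.smul_apply, smul_eq_mul, Finset.sum_mul, Finset.mul_sum]
  exact Finset.sum_congr rfl fun k _ => Finset.sum_congr rfl fun l _ => by ring

theorem linearIndependent_of_orthonormal {L : EuclideanSpace ℝ (Fin n) →ₗ[ℝ]
    EuclideanSpace ℝ (Fin n) →ₗ[ℝ] ℝ} {b : Fin n → EuclideanSpace ℝ (Fin n)}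
    (hb : ∀ i j, L (b i) (b j) = if i = j then 1 else 0) : LinearIndependent ℝ b := by
  rw [Fintype.linearIndependent_iff]
  intro c hc i
  have := congrArg (fun z => L z (b i)) hc
  simpa [hb] using this

theorem exists_eq_sum_of_orthonormal {L : EuclideanSpace ℝ (Fin n) →ₗ[ℝ] EuclideanSpace ℝ (Fin n)
    →ₗ[ℝ] ℝ} {b : Fin n → EuclideanSpace ℝ (Fin n)}
    (hb : ∀ i j, L (b i) (b j) = if i = j then 1 else 0) (v : EuclideanSpace ℝ (Fin n)) :
    ∃ c : Fin n → ℝ, v = ∑ i, c i • b i := by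
  have hspan : Submodule.span ℝ (range b) = ⊤ :=
    (linearIndependent_of_orthonormal hb).span_eq_top_of_card_eq_finrank' (by simp)
  have hv : v ∈ Submodule.span ℝ (range b) := hspan ▸ Submodule.mem_top
  obtain ⟨c, hc⟩ := (Submodule.mem_span_range_iff_exists_fun ℝ).1 hv
  exact ⟨c, hc.symm⟩

/-- The form `L` only guarantees that `b₀` is a basis. In the application `b₀` is orthonormal at a
fixed time, whereas `g`, `h` and their eigenframe belong to a nearby time. -/
theorem exists_frame_matrix {g h : EuclideanSpace ℝ (Fin n) →ₗ[ℝ] EuclideanSpace ℝ (Fin n) →ₗ[ℝ] ℝ}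
    {b₀ g₀ : Fin n → EuclideanSpace ℝ (Fin n)} {L : EuclideanSpace ℝ (Fin n) →ₗ[ℝ]
    EuclideanSpace ℝ (Fin n) →ₗ[ℝ] ℝ}
    (hb₀ : ∀ i j, L (b₀ i) (b₀ j) = if i = j then 1 else 0) {κ : Fin n → ℝ}
    (hg : ∀ i j, g (g₀ i) (g₀ j) = if i = j then 1 else 0)
    (hh : ∀ i j, h (g₀ i) (g₀ j) = if i = j then κ i else 0) :
    ∃ B : Matrix (Fin n) (Fin n) ℝ,
      B.transpose * (Matrix.of fun i j => g (b₀ i) (b₀ j)) * B = 1 ∧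
      B.transpose * (Matrix.of fun i j => h (b₀ i) (b₀ j)) * B = Matrix.diagonal κ := by
  choose c hc using fun j => exists_eq_sum_of_orthonormal hb₀ (g₀ j)
  refine ⟨Matrix.of fun i j => c j i, ?_, ?_⟩
  · rw [transpose_mul_mul_apply_bilin (b' := g₀) (B := Matrix.of fun i j => c j i) hc]
    ext i j
    simp [hg, Matrix.one_apply]
  · rw [transpose_mul_mul_apply_bilin (b' := g₀) (B := Matrix.of fun i j => c j i) hc]
    ext i j
    simp [hh, Matrix.diagonal_apply]

/-- The diagonal values of `h` in an orthonormal frame lie in the convex hull of the permutations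
of the eigenvalues. -/
theorem diag_mem_convexHull_perm_of_frame {g h : EuclideanSpace ℝ (Fin n) →ₗ[ℝ]
    EuclideanSpace ℝ (Fin n) →ₗ[ℝ] ℝ} {b b' : Fin n → EuclideanSpace ℝ (Fin n)}
    {κ : Fin n → ℝ} (hb : ∀ i j, g (b i) (b j) = if i = j then 1 else 0)
    (hb' : ∀ i j, g (b' i) (b' j) = if i = j then 1 else 0)
    (hh : ∀ i j, h (b' i) (b' j) = if i = j then κ i else 0) :
    (fun i => h (b i) (b i)) ∈ convexHull ℝ (range fun π : Equiv.Perm (Fin n) => κ ∘ π) := by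
  obtain ⟨B, hB1, hB2⟩ := exists_frame_matrix hb hb' hh
  have := diag_mem_convexHull_perm (B' := 1) hB1 hB2 (by
    ext i j
    simp [hb, Matrix.one_apply])
  simpa using this

/-- A superlevel set of a concave function is convex, and by symmetry {F ≥ F(κ)} contains all
permutations of κ. -/
theorem mem_and_le_of_mem_convexHull_perm {Γ : Set (Fin n → ℝ)} {F : (Fin n → ℝ) → ℝ}
    (hΓ : IsCurvatureCone Γ) (hF : IsCurvatureFunction Γ F) {κ d : Fin n → ℝ} (hκ : κ ∈ Γ)
    (hd : d ∈ convexHull ℝ (range fun π : Equiv.Perm (Fin n) => κ ∘ π)) : d ∈ Γ ∧ F κ ≤ F d := by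
  refine convexHull_min ?_ (hF.concave.convex_ge (F κ)) hd
  rintro _ ⟨π, rfl⟩
  exact ⟨hΓ.symmetric κ hκ π, (hF.symmetric κ hκ π).ge⟩

end Frames

section LocalFlow

variable {n : ℕ}

/-- The coordinate expression of a curvature flow: `X`, `ν`, `u`, `κ` are the immersions, the
normals, the speed and the principal curvatures on `A × U`, `G` and `f` are the ambient metric and
the prescribed function on `W`. -/
structure IsLocalFlow (σ : ℝ) (Γ : Set (Fin n → ℝ)) (F : (Fin n → ℝ) → ℝ) (J : Set ℝ) (Φ : ℝ → ℝ)
    (W : Set (EuclideanSpace ℝ (Fin (n + 1)))) (G : EuclideanSpace ℝ (Fin (n + 1)) → EuclideanSpace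
    ℝ (Fin (n + 1)) →L[ℝ] EuclideanSpace ℝ (Fin (n + 1)) →L[ℝ] ℝ) (f : EuclideanSpace ℝ
        (Fin (n + 1)) → ℝ) (A : Set ℝ) (U : Set (EuclideanSpace ℝ (Fin n)))
    (X ν : ℝ × EuclideanSpace ℝ (Fin n) → EuclideanSpace ℝ (Fin (n + 1)))
    (u : ℝ × EuclideanSpace ℝ (Fin n) → ℝ) (κ : ℝ × EuclideanSpace ℝ (Fin n) → Fin n → ℝ) : Prop
    where
  isOpen_target : IsOpen W
  contDiffOn_metric : ContDiffOn ℝ 5 G W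
  symm : ∀ z ∈ W, ∀ a b, G z a b = G z b a
  contDiffOn_fun : ContDiffOn ℝ 4 f W
  fun_mem : ∀ z ∈ W, f z ∈ J
  uniqueDiffOn : UniqueDiffOn ℝ A
  isOpen : IsOpen U
  contDiffOn : ContDiffOn ℝ 3 X (A ×ˢ U)
  contDiffOn_normal : ContDiffOn ℝ 2 ν (A ×ˢ U)
  mapsTo : ∀ p ∈ A ×ˢ U, X p ∈ W
  evolution : ∀ p ∈ A ×ˢ U,
    HasDerivWithinAt (fun s => X (s, p.2)) ((-σ * u p) • ν p) A p.1
  sq_eq_one : σ * σ = 1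
  unit : ∀ p ∈ A ×ˢ U, G (X p) (ν p) (ν p) = σ
  normal : ∀ p ∈ A ×ˢ U, ∀ v, G (X p) (spatialDeriv X p v) (ν p) = 0
  pos : ∀ p ∈ A ×ˢ U, ∀ v, v ≠ 0 → 0 < G (X p) (spatialDeriv X p v) (spatialDeriv X p v)
  admissible : ∀ p ∈ A ×ˢ U, κ p ∈ Γ
  principal : ∀ p ∈ A ×ˢ U, ∃ b : Fin n → EuclideanSpace ℝ (Fin n), ∀ i j,
    G (X p) (spatialDeriv X p (b i)) (spatialDeriv X p (b j)) = (if i = j then 1 else 0) ∧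
    jetSff (G (X p)) (fderiv ℝ G (X p)) (spatialDeriv X p) (spatialDeriv (spatialDeriv X) p) (ν p)
      (b i) (b j) = (if i = j then κ p i else 0)
  speed_eq : ∀ p ∈ A ×ˢ U, u p = Φ (F (κ p)) - Φ (f (X p))

variable {σ : ℝ} {Γ : Set (Fin n → ℝ)} {F : (Fin n → ℝ) → ℝ} {J : Set ℝ} {Φ : ℝ → ℝ}
  {W : Set (EuclideanSpace ℝ (Fin (n + 1)))} {G : EuclideanSpace ℝ (Fin (n + 1)) → EuclideanSpace ℝ
  (Fin (n + 1)) →L[ℝ] EuclideanSpace ℝ (Fin (n + 1)) →L[ℝ] ℝ} {f : EuclideanSpace ℝ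
  (Fin (n + 1)) → ℝ} {A : Set ℝ} {U : Set (EuclideanSpace ℝ (Fin n))}
  {X ν : ℝ × EuclideanSpace ℝ (Fin n) → EuclideanSpace ℝ (Fin (n + 1))}
  {u : ℝ × EuclideanSpace ℝ (Fin n) → ℝ} {κ : ℝ × EuclideanSpace ℝ (Fin n) → Fin n → ℝ}

/-- Pairing the flow equation with ν gives u = −⟨ẋ, ν⟩, since σ² = 1. This has two derivatives,
whereas the definition through the second derivatives of X would give only one. -/
theorem IsLocalFlow.contDiffOn_speed (h : IsLocalFlow σ Γ F J Φ W G f A U X ν u κ) :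
    ContDiffOn ℝ 2 u (A ×ˢ U) := by
  have h1 : ContDiffOn ℝ 2 (fun p => fderivWithin ℝ X (A ×ˢ U) p) (A ×ˢ U) :=
    h.contDiffOn.fderivWithin (h.uniqueDiffOn.prod h.isOpen.uniqueDiffOn) (by norm_num)
  have h2 : ContDiffOn ℝ 2 (fun p => fderivWithin ℝ X (A ×ˢ U) p (1, 0)) (A ×ˢ U) :=
    h1.clm_apply contDiffOn_const
  have h3 : ContDiffOn ℝ 2 (fun p => G (X p)) (A ×ˢ U) :=
    (h.contDiffOn_metric.of_le (by norm_num)).comp (h.contDiffOn.of_le (by norm_num)) h.mapsTo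
  refine ((h3.clm_apply h2).clm_apply h.contDiffOn_normal).neg.congr fun p hp => ?_
  have h4 : HasFDerivWithinAt X (fderivWithin ℝ X (A ×ˢ U) p) (A ×ˢ U) (p.1, p.2) :=
    (h.contDiffOn.differentiableOn (by norm_num) p hp).hasFDerivWithinAt
  have h5 : HasDerivWithinAt (fun s : ℝ => (s, p.2))
      ((1 : ℝ), (0 : EuclideanSpace ℝ (Fin n))) A p.1 :=
    (hasDerivWithinAt_id p.1 A).prodMk (hasDerivWithinAt_const _ _ _)
  have h6 := h4.comp_hasDerivWithinAt p.1 h5 fun s hs => mk_mem_prod hs hp.2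
  have h7 := (h.uniqueDiffOn p.1 hp.1).eq_deriv _ h6 (h.evolution p hp)
  rw [h7]
  simp only [map_smul, smul_apply, h.unit p hp, smul_eq_mul]
  linear_combination (-u p) * h.sq_eq_one

end LocalFlow

section LocalFlow

variable {n : ℕ} {σ : ℝ} {Γ : Set (Fin n → ℝ)} {F : (Fin n → ℝ) → ℝ} {J : Set ℝ} {Φ : ℝ → ℝ}
  {W : Set (EuclideanSpace ℝ (Fin (n + 1)))}
  {G : EuclideanSpace ℝ (Fin (n + 1)) →
    EuclideanSpace ℝ (Fin (n + 1)) →L[ℝ] EuclideanSpace ℝ (Fin (n + 1)) →L[ℝ] ℝ}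
  {f : EuclideanSpace ℝ (Fin (n + 1)) → ℝ} {A : Set ℝ} {U : Set (EuclideanSpace ℝ (Fin n))}
  {X ν : ℝ × EuclideanSpace ℝ (Fin n) → EuclideanSpace ℝ (Fin (n + 1))}
  {u : ℝ × EuclideanSpace ℝ (Fin n) → ℝ} {κ : ℝ × EuclideanSpace ℝ (Fin n) → Fin n → ℝ}

/-- The first variation of the curvature function: only concavity and symmetry of `F` as a function
of the eigenvalues are needed. -/
theorem hasDerivAt_eq_of_eigenvalues (hΓ : IsCurvatureCone Γ) (hF : IsCurvatureFunction Γ F)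
    (hΦ : IsSpeedFunction J Φ) (hFJ : ∀ κ ∈ Γ, F κ ∈ J) {g H : ℝ → Matrix (Fin n) (Fin n) ℝ}
    {k : ℝ → Fin n → ℝ} {t u' v' : ℝ} {v φ : ℝ → ℝ}
    (hsymm : ∀ᶠ s in 𝓝 t, (g s).transpose = g s) (h1 : g t = 1)
    (h2 : H t = Matrix.diagonal (k t))
    (hk : ∀ᶠ s in 𝓝 t, ∃ B : Matrix (Fin n) (Fin n) ℝ,
      B.transpose * g s * B = 1 ∧ B.transpose * H s * B = Matrix.diagonal (k s))
    (hg : ∀ i j, DifferentiableAt ℝ (fun s => g s i j) t)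
    (hH : ∀ i j, DifferentiableAt ℝ (fun s => H s i j) t)
    (hkΓ : ∀ᶠ s in 𝓝 t, k s ∈ Γ) (hv : HasDerivAt v u' t) (hφ : HasDerivAt φ v' t)
    (hvφ : ∀ᶠ s in 𝓝 t, v s = Φ (F (k s)) - φ s) :
    u' = ∑ i, deriv Φ (F (k t)) * fderiv ℝ F (k t) (Pi.single i 1) *
      (deriv (fun s => H s i i) t - k t i * deriv (fun s => g s i i) t) - v' := by
  obtain ⟨d, hd0, hd, hd'⟩ := exists_diag_path hsymm h1 h2 hk hg hH
  have hkt : k t ∈ Γ := hkΓ.self_of_nhds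
  have hFd : HasFDerivAt F (fderiv ℝ F (k t)) (d t) := by
    rw [hd0]
    exact ((hF.contDiffOn.contDiffAt (hΓ.isOpen.mem_nhds hkt)).differentiableAt
      (by norm_num)).hasFDerivAt
  have hΦd : HasDerivAt Φ (deriv Φ (F (k t))) (F (d t)) := by
    rw [hd0]
    exact ((hΦ.contDiffOn.contDiffAt (hΦ.isOpen.mem_nhds (hFJ _ hkt))).differentiableAt
      (by norm_num)).hasDerivAt
  have hFd' := hFd.comp_hasDerivAt t (hasDerivAt_pi.2 hd')
  have hm := (hΦd.comp t hFd').sub hφ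
  have hmono : StrictMonoOn Φ J := by
    refine strictMonoOn_of_deriv_pos hΦ.ordConnected.convex hΦ.contDiffOn.continuousOn ?_
    intro r hr
    exact hΦ.deriv_pos r (interior_subset hr)
  -- The difference is Φ(F(d)) − Φ(F(k)), which is nonnegative and vanishes at `t`; its derivative
  -- there is therefore zero.
  have hmin : IsLocalMin (fun s => (Φ (F (d s)) - φ s) - v s) t := by
    filter_upwards [hd, hkΓ, hvφ] with s h3 h4 h5
    obtain ⟨h6, h7⟩ := mem_and_le_of_mem_convexHull_perm hΓ hF h4 h3
    have h8 := hmono.monotoneOn (hFJ _ h4) (hFJ _ h6) h7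
    rw [h5, hvφ.self_of_nhds, hd0]
    linarith
  have h9 := hmin.hasDerivAt_eq_zero (hm.sub hv)
  have h10 : fderiv ℝ F (k t) (fun i => deriv (fun s => H s i i) t
      - k t i * deriv (fun s => g s i i) t) = ∑ i, fderiv ℝ F (k t) (Pi.single i 1) *
      (deriv (fun s => H s i i) t - k t i * deriv (fun s => g s i i) t) := by
    conv_lhs => rw [pi_eq_sum_univ' (fun i => deriv (fun s => H s i i) t
      - k t i * deriv (fun s => g s i i) t)]
    rw [map_sum]
    refine Finset.sum_congr rfl fun i _ => ?_
    rw [map_smul, smul_eq_mul, mul_comm]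
  rw [h10] at h9
  simp only [mul_assoc, ← Finset.mul_sum]
  linarith

/-- The linear equation for the speed, written in an eigenframe `b`. The second order coefficients
Φ'(F) ∂F/∂κᵢ are positive, and every remaining term is linear in `u` or its gradient. Times in the
interior of `A` are required because two-sided time derivatives are used. -/
theorem IsLocalFlow.deriv_speed_eq (h : IsLocalFlow σ Γ F J Φ W G f A U X ν u κ)
    (hΓ : IsCurvatureCone Γ) (hF : IsCurvatureFunction Γ F) (hΦ : IsSpeedFunction J Φ)
    (hFJ : ∀ κ ∈ Γ, F κ ∈ J) {p : ℝ × EuclideanSpace ℝ (Fin n)} (ht : p.1 ∈ interior A)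
    (hy : p.2 ∈ U) {b : Fin n → EuclideanSpace ℝ (Fin n)}
    (hb : ∀ i j, G (X p) (spatialDeriv X p (b i)) (spatialDeriv X p (b j))
      = if i = j then 1 else 0)
    (hbκ : ∀ i j, jetSff (G (X p)) (fderiv ℝ G (X p)) (spatialDeriv X p)
      (spatialDeriv (spatialDeriv X) p) (ν p) (b i) (b j) = if i = j then κ p i else 0) :
    deriv (fun s => u (s, p.2)) p.1 =
      ∑ i, deriv Φ (F (κ p)) * fderiv ℝ F (κ p) (Pi.single i 1) *
        (spatialDeriv (spatialDeriv u) p (b i) (b i)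
        + σ * spatialDeriv u p (sffGradCoeff σ (G (X p)) (fderiv ℝ G (X p)) (spatialDeriv X p)
          (spatialDeriv (spatialDeriv X) p) (ν p) (spatialDeriv ν p) b (b i))
        + σ * sffCoeff σ (G (X p)) (fderiv ℝ G (X p)) (fderiv ℝ (fderiv ℝ G) (X p))
          (spatialDeriv X p) (spatialDeriv (spatialDeriv X) p) (ν p) (spatialDeriv ν p)
          (spatialDeriv (spatialDeriv ν) p) b (b i) * u p
        - κ p i * (-σ * u p * metricCoeff (G (X p)) (fderiv ℝ G (X p)) (spatialDeriv X p) (ν p)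
          (spatialDeriv ν p) (b i)))
      - deriv Φ (f (X p)) * fderiv ℝ f (X p) ((-σ * u p) • ν p) := by
  obtain ⟨t, y⟩ := p
  simp only at ht hy
  have hS : interior A ×ˢ U ∈ 𝓝 (t, y) := (isOpen_interior.prod h.isOpen).mem_nhds ⟨ht, hy⟩
  have hsub : interior A ×ˢ U ⊆ A ×ˢ U := prod_mono_left interior_subset
  have hp : (t, y) ∈ A ×ˢ U := hsub ⟨ht, hy⟩
  have hnt : ∀ᶠ s in 𝓝 t, (s, y) ∈ A ×ˢ U := by
    filter_upwards [isOpen_interior.mem_nhds ht] with s hs using hsub ⟨hs, hy⟩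
  have hXc : ContDiffAt ℝ 3 X (t, y) := h.contDiffOn.contDiffAt (Filter.mem_of_superset hS hsub)
  have hνc : ContDiffAt ℝ 2 ν (t, y) :=
    h.contDiffOn_normal.contDiffAt (Filter.mem_of_superset hS hsub)
  have huc : ContDiffAt ℝ 2 u (t, y) :=
    h.contDiffOn_speed.contDiffAt (Filter.mem_of_superset hS hsub)
  have hwc : ContDiffAt ℝ 2 (fun q => -σ * u q) (t, y) := contDiffAt_const.mul huc
  have hW : W ∈ 𝓝 (X (t, y)) := h.isOpen_target.mem_nhds (h.mapsTo _ hp)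
  have hGc : ContDiffAt ℝ 5 G (X (t, y)) := h.contDiffOn_metric.contDiffAt hW
  have hG1c : ContDiffAt ℝ 4 (fderiv ℝ G) (X (t, y)) := hGc.fderiv_right (by norm_num)
  have hGd := hGc.differentiableAt (by norm_num)
  have hG1d := hG1c.differentiableAt (by norm_num)
  set k : ℝ × EuclideanSpace ℝ (Fin n) → EuclideanSpace ℝ (Fin (n + 1)) :=
    fun q => (-σ * u q) • ν q with hk
  have hXt : ∀ q ∈ interior A ×ˢ U, HasDerivAt (fun s => X (s, q.2)) (k q) q.1 := fun q hq =>
    (h.evolution q (hsub hq)).hasDerivAt (mem_interior_iff_mem_nhds.1 hq.1)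
  have hXt' : ∀ᶠ q in 𝓝 (t, y), HasDerivAt (fun s => X (s, q.2)) (k q) q.1 :=
    Filter.mem_of_superset hS hXt
  -- Valid in a neighbourhood and not just at the point, so that time and space derivatives can be
  -- interchanged once more for the second derivatives of X.
  have hX1t : ∀ᶠ q in 𝓝 (t, y),
      HasDerivAt (fun s => spatialDeriv X (s, q.2)) (spatialDeriv k q) q.1 := by
    filter_upwards [hXc.eventually (by simp), eventually_eventually_nhds.2 hXt'] with q h1 h2
    exact hasDerivAt_spatialDeriv (h1.of_le (by norm_num)) h2
  have hX2t := hasDerivAt_spatialDeriv (contDiffAt_spatialDeriv (m := 2) (by norm_num) (by simp)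
    hXc) hX1t
  have hX0t := hXt'.self_of_nhds
  have hX1t := hX1t.self_of_nhds
  simp only at hX0t hX1t
  have hνt : HasDerivAt (fun s => ν (s, y)) (deriv (fun s => ν (s, y)) t) t := by
    have : ContDiffAt ℝ 2 (fun s => ν (s, y)) t :=
      ContDiffAt.comp t hνc (contDiffAt_id.prodMk contDiffAt_const)
    exact (this.differentiableAt (by norm_num)).hasDerivAt
  have hX1' : ∀ v, spatialDeriv k (t, y) v = (-σ * u (t, y)) • spatialDeriv ν (t, y) v
      + (-σ * spatialDeriv u (t, y) v) • ν (t, y) := by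
    intro v
    rw [hk, spatialDeriv_smul (hwc.differentiableAt (by norm_num))
      (hνc.differentiableAt (by norm_num)), spatialDeriv_const_mul]
    simp
  have hX2' : ∀ v, spatialDeriv (spatialDeriv k) (t, y) v v =
      (-σ * u (t, y)) • spatialDeriv (spatialDeriv ν) (t, y) v v
      + (-σ * spatialDeriv u (t, y) v) • spatialDeriv ν (t, y) v
      + (-σ * spatialDeriv u (t, y) v) • spatialDeriv ν (t, y) v
      + (-σ * spatialDeriv (spatialDeriv u) (t, y) v v) • ν (t, y) := by
    intro v
    rw [hk, spatialDeriv_spatialDeriv_smul hwc hνc, spatialDeriv_const_mul,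
      spatialDeriv_const_smul]
    simp
  have hG0t : HasDerivAt (fun s => G (X (s, y))) (fderiv ℝ G (X (t, y)) (k (t, y))) t :=
    HasFDerivAt.comp_hasDerivAt (f := fun s => X (s, y)) t hGd.hasFDerivAt hX0t
  have hX1v : ∀ v, HasDerivAt (fun s => spatialDeriv X (s, y) v) (spatialDeriv k (t, y) v) t :=
    fun v => by simpa using hX1t.clm_apply (hasDerivAt_const t v)
  have hν'1 : fderiv ℝ G (X (t, y)) (k (t, y)) (ν (t, y)) (ν (t, y))
      + G (X (t, y)) (deriv (fun s => ν (s, y)) t) (ν (t, y))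
      + G (X (t, y)) (ν (t, y)) (deriv (fun s => ν (s, y)) t) = 0 := by
    have h1 := (hG0t.clm_apply hνt).clm_apply hνt
    have h2 := h1.unique ((hasDerivAt_const t σ).congr_of_eventuallyEq (by
      filter_upwards [hnt] with s hs using h.unit _ hs))
    simpa using h2
  have hν'2 : ∀ v, fderiv ℝ G (X (t, y)) (k (t, y)) (spatialDeriv X (t, y) v) (ν (t, y))
      + G (X (t, y)) (spatialDeriv k (t, y) v) (ν (t, y))
      + G (X (t, y)) (spatialDeriv X (t, y) v) (deriv (fun s => ν (s, y)) t) = 0 := by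
    intro v
    have h1 := (hG0t.clm_apply (hX1v v)).clm_apply hνt
    have h2 := h1.unique ((hasDerivAt_const t (0 : ℝ)).congr_of_eventuallyEq (by
      filter_upwards [hnt] with s hs using h.normal _ hs v))
    simpa using h2
  have hgt := fun v w => hasDerivAt_inducedMetric (X := fun s => X (s, y))
    (X1 := fun s => spatialDeriv X (s, y)) hGd hX0t hX1t v w
  have hht := fun v w => hasDerivAt_jetSff (X := fun s => X (s, y))
    (X1 := fun s => spatialDeriv X (s, y)) (X2 := fun s => spatialDeriv (spatialDeriv X) (s, y))
    (ν := fun s => ν (s, y)) hGd hG1d hX0t hX1t hX2t hνt v w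
  let gB : ℝ → EuclideanSpace ℝ (Fin n) →ₗ[ℝ] EuclideanSpace ℝ (Fin n) →ₗ[ℝ] ℝ := fun s =>
    LinearMap.mk₂ ℝ (fun v w => G (X (s, y)) (spatialDeriv X (s, y) v) (spatialDeriv X (s, y) w))
      (by simp) (by simp) (by simp) (by simp)
  let hB : ℝ → EuclideanSpace ℝ (Fin n) →ₗ[ℝ] EuclideanSpace ℝ (Fin n) →ₗ[ℝ] ℝ := fun s =>
    jetSffBilin (G (X (s, y))) (fderiv ℝ G (X (s, y))) (spatialDeriv X (s, y))
      (spatialDeriv (spatialDeriv X) (s, y)) (ν (s, y))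
  have hft : HasDerivAt (fun s => Φ (f (X (s, y))))
      (deriv Φ (f (X (t, y))) * fderiv ℝ f (X (t, y)) (k (t, y))) t := by
    have h1 : HasFDerivAt f (fderiv ℝ f (X (t, y))) (X (t, y)) :=
      ((h.contDiffOn_fun.contDiffAt hW).differentiableAt (by norm_num)).hasFDerivAt
    have h2 : HasDerivAt Φ (deriv Φ (f (X (t, y)))) (f (X (t, y))) :=
      ((hΦ.contDiffOn.contDiffAt (hΦ.isOpen.mem_nhds
        (h.fun_mem _ (h.mapsTo _ hp)))).differentiableAt (by norm_num)).hasDerivAt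
    have h3 : HasDerivAt (fun s => f (X (s, y))) (fderiv ℝ f (X (t, y)) (k (t, y))) t :=
      HasFDerivAt.comp_hasDerivAt (f := fun s => X (s, y)) t h1 hX0t
    exact HasDerivAt.comp (h := fun s => f (X (s, y))) t h2 h3
  have key := hasDerivAt_eq_of_eigenvalues hΓ hF hΦ hFJ (t := t)
    (g := fun s => Matrix.of fun i j => gB s (b i) (b j))
    (H := fun s => Matrix.of fun i j => hB s (b i) (b j)) (k := fun s => κ (s, y))
    (v := fun s => u (s, y)) (φ := fun s => Φ (f (X (s, y))))
    (by
      filter_upwards [hnt] with s hs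
      ext i j
      exact h.symm _ (h.mapsTo _ hs) _ _)
    (by ext i j; simpa [gB, Matrix.one_apply] using hb i j)
    (by ext i j; simpa [hB, jetSffBilin, Matrix.diagonal_apply] using hbκ i j)
    (by
      filter_upwards [hnt] with s hs
      obtain ⟨b', hb'⟩ := h.principal _ hs
      -- An eigenframe at the nearby time `s`, expanded in the basis `b` that is fixed at time `t`.
      exact exists_frame_matrix (L := gB t) (fun i j => hb i j) (fun i j => (hb' i j).1)
        (fun i j => (hb' i j).2))
    (fun i j => (hgt (b i) (b j)).differentiableAt)
    (fun i j => (hht (b i) (b j)).differentiableAt)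
    (by filter_upwards [hnt] with s hs using h.admissible _ hs)
    (hasDerivAt_slice huc) hft
    (by filter_upwards [hnt] with s hs using h.speed_eq _ hs)
  rw [key]
  congr 1
  refine Finset.sum_congr rfl fun i _ => ?_
  congr 1
  have e1 : deriv (fun s => (Matrix.of fun i j => gB s (b i) (b j)) i i) t
      = -σ * u (t, y) * metricCoeff (G (X (t, y))) (fderiv ℝ G (X (t, y)))
        (spatialDeriv X (t, y)) (ν (t, y)) (spatialDeriv ν (t, y)) (b i) :=
    (hgt (b i) (b i)).deriv.trans
      (deriv_metric_eq (w1 := (-σ) • spatialDeriv u (t, y)) (h.symm _ (h.mapsTo _ hp))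
        (h.normal _ hp) hX1' (b i))
  have e2 : deriv (fun s => (Matrix.of fun i j => hB s (b i) (b j)) i i) t = _ :=
    (hht (b i) (b i)).deriv.trans
      (deriv_sff_eq (by simp) h.sq_eq_one (h.symm _ (h.mapsTo _ hp)) (h.unit _ hp)
        (h.normal _ hp) hb hX1' hX2' hν'1 hν'2 (b i))
  rw [e1, e2]

end LocalFlow

/-! ### Coefficient bounds and uniform ellipticity by compactness of the orthonormal frames. -/

theorem exists_pos_forall_le {α : Type*} [TopologicalSpace α] {s : Set α} (hs : IsCompact s)
    {φ : α → ℝ} (hφ : ContinuousOn φ s) (hpos : ∀ x ∈ s, 0 < φ x) : ∃ c > 0, ∀ x ∈ s, c ≤ φ x := by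
  rcases s.eq_empty_or_nonempty with rfl | hne
  · exact ⟨1, one_pos, by simp⟩
  · obtain ⟨x, hx, hmin⟩ := hs.exists_isMinOn hne hφ
    exact ⟨φ x, hpos x hx, fun y hy => hmin hy⟩

section Continuity

variable {Q E V : Type*} [TopologicalSpace Q] [NormedAddCommGroup E] [NormedSpace ℝ E]
  [NormedAddCommGroup V] [NormedSpace ℝ V] {n : ℕ} {s : Set Q} {σ : ℝ}
  {G0 : Q → V →L[ℝ] V →L[ℝ] ℝ} {G1 : Q → V →L[ℝ] V →L[ℝ] V →L[ℝ] ℝ}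
  {G2 : Q → V →L[ℝ] V →L[ℝ] V →L[ℝ] V →L[ℝ] ℝ} {X1 : Q → E →L[ℝ] V} {X2 : Q → E →L[ℝ] E →L[ℝ] V}
  {ν : Q → V} {ν1 : Q → E →L[ℝ] V} {ν2 : Q → E →L[ℝ] E →L[ℝ] V} {b : Q → Fin n → E} {v w : Q → E}

theorem continuousOn_christoffelOf {a b c : Q → V} (hG1 : ContinuousOn G1 s)
    (ha : ContinuousOn a s) (hb : ContinuousOn b s) (hc : ContinuousOn c s) :
    ContinuousOn (fun q => christoffelOf (G1 q) (a q) (b q) (c q)) s := by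
  unfold christoffelOf
  exact (((((hG1.clm_apply ha).clm_apply hb).clm_apply hc).add
    (((hG1.clm_apply hb).clm_apply ha).clm_apply hc)).sub
    (((hG1.clm_apply hc).clm_apply ha).clm_apply hb)).div_const 2

theorem continuousOn_jetSff (hG0 : ContinuousOn G0 s) (hG1 : ContinuousOn G1 s)
    (hX1 : ContinuousOn X1 s) (hX2 : ContinuousOn X2 s) (hν : ContinuousOn ν s)
    (hv : ContinuousOn v s) (hw : ContinuousOn w s) :
    ContinuousOn (fun q => jetSff (G0 q) (G1 q) (X1 q) (X2 q) (ν q) (v q) (w q)) s :=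
  (((hG0.clm_apply ((hX2.clm_apply hv).clm_apply hw)).clm_apply hν).add
    (continuousOn_christoffelOf hG1 (hX1.clm_apply hv) (hX1.clm_apply hw) hν)).neg

theorem continuousOn_metricCoeff (hG0 : ContinuousOn G0 s) (hG1 : ContinuousOn G1 s)
    (hX1 : ContinuousOn X1 s) (hν : ContinuousOn ν s) (hν1 : ContinuousOn ν1 s)
    (hv : ContinuousOn v s) :
    ContinuousOn (fun q => metricCoeff (G0 q) (G1 q) (X1 q) (ν q) (ν1 q) (v q)) s := by
  have h1 := hX1.clm_apply hv
  have h2 := hν1.clm_apply hv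
  exact ((((hG1.clm_apply hν).clm_apply h1).clm_apply h1).add
    ((hG0.clm_apply h2).clm_apply h1)).add ((hG0.clm_apply h1).clm_apply h2)

theorem continuousOn_sffGradCoeff (hG0 : ContinuousOn G0 s) (hG1 : ContinuousOn G1 s)
    (hX1 : ContinuousOn X1 s) (hX2 : ContinuousOn X2 s) (hν : ContinuousOn ν s)
    (hν1 : ContinuousOn ν1 s) (hb : ∀ i, ContinuousOn (fun q => b q i) s)
    (hv : ContinuousOn v s) :
    ContinuousOn (fun q => sffGradCoeff σ (G0 q) (G1 q) (X1 q) (X2 q) (ν q) (ν1 q) (b q) (v q))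
      s := by
  have h1 := hX1.clm_apply hv
  have h2 := hν1.clm_apply hv
  have h3 := (hX2.clm_apply hv).clm_apply hv
  refine ContinuousOn.sub (ContinuousOn.smul ?_ hv) (continuousOn_finsetSum _ fun i _ => ?_)
  · exact ((continuousOn_const.mul ((hG0.clm_apply h2).clm_apply hν)).add
      (continuousOn_christoffelOf hG1 hν h1 hν)).add (continuousOn_christoffelOf hG1 h1 hν hν)
  · exact (continuousOn_const.mul (((hG0.clm_apply h3).clm_apply (hX1.clm_apply (hb i))).add
      (continuousOn_christoffelOf hG1 h1 h1 (hX1.clm_apply (hb i))))).smul (hb i)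

theorem continuousOn_sffCoeff (hG0 : ContinuousOn G0 s) (hG1 : ContinuousOn G1 s)
    (hG2 : ContinuousOn G2 s) (hX1 : ContinuousOn X1 s) (hX2 : ContinuousOn X2 s)
    (hν : ContinuousOn ν s) (hν1 : ContinuousOn ν1 s) (hν2 : ContinuousOn ν2 s)
    (hb : ∀ i, ContinuousOn (fun q => b q i) s) (hv : ContinuousOn v s) :
    ContinuousOn (fun q => sffCoeff σ (G0 q) (G1 q) (G2 q) (X1 q) (X2 q) (ν q) (ν1 q) (ν2 q) (b q)
      (v q)) s := by
  have h1 := hX1.clm_apply hv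
  have h2 := hν1.clm_apply hv
  have h3 := (hX2.clm_apply hv).clm_apply hv
  have h4 := (hν2.clm_apply hv).clm_apply hv
  have h5 := hG1.clm_apply hν
  refine ContinuousOn.sub (ContinuousOn.sub (ContinuousOn.add (ContinuousOn.add
    (ContinuousOn.add (ContinuousOn.add ?_ ?_) ?_) ?_) ?_) ?_)
    (continuousOn_finsetSum _ fun i _ => ?_)
  · exact (h5.clm_apply h3).clm_apply hν
  · exact (hG0.clm_apply h4).clm_apply hν
  · exact continuousOn_christoffelOf (hG2.clm_apply hν) h1 h1 hν
  · exact continuousOn_christoffelOf hG1 h2 h1 hν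
  · exact continuousOn_christoffelOf hG1 h1 h2 hν
  · exact ((continuousOn_const.mul ((h5.clm_apply hν).clm_apply hν)).div_const 2).mul
      (((hG0.clm_apply h3).clm_apply hν).add (continuousOn_christoffelOf hG1 h1 h1 hν))
  · have h6 := hX1.clm_apply (hb i)
    exact (((hG0.clm_apply (hν1.clm_apply (hb i))).clm_apply hν).add
      ((h5.clm_apply h6).clm_apply hν)).mul
      (((hG0.clm_apply h3).clm_apply h6).add (continuousOn_christoffelOf hG1 h1 h1 h6))

end Continuity

section LocalFlow

variable {n : ℕ} {σ : ℝ} {Γ : Set (Fin n → ℝ)} {F : (Fin n → ℝ) → ℝ} {J : Set ℝ} {Φ : ℝ → ℝ}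
  {W : Set (EuclideanSpace ℝ (Fin (n + 1)))}
  {G : EuclideanSpace ℝ (Fin (n + 1)) →
    EuclideanSpace ℝ (Fin (n + 1)) →L[ℝ] EuclideanSpace ℝ (Fin (n + 1)) →L[ℝ] ℝ}
  {f : EuclideanSpace ℝ (Fin (n + 1)) → ℝ} {A : Set ℝ} {U : Set (EuclideanSpace ℝ (Fin n))}
  {X ν : ℝ × EuclideanSpace ℝ (Fin n) → EuclideanSpace ℝ (Fin (n + 1))}
  {u : ℝ × EuclideanSpace ℝ (Fin n) → ℝ} {κ : ℝ × EuclideanSpace ℝ (Fin n) → Fin n → ℝ}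

/-- The orthonormal frames over a compact set form a compact set. -/
theorem isCompact_frames {K : Set (ℝ × EuclideanSpace ℝ (Fin n))} (hK : IsCompact K)
    {g : ℝ × EuclideanSpace ℝ (Fin n) →
      EuclideanSpace ℝ (Fin n) →L[ℝ] EuclideanSpace ℝ (Fin n) →L[ℝ] ℝ}
    (hg : ContinuousOn g K) (hpos : ∀ p ∈ K, ∀ v, v ≠ 0 → 0 < g p v v) :
    IsCompact {q : (ℝ × EuclideanSpace ℝ (Fin n)) × (Fin n → EuclideanSpace ℝ (Fin n)) |
      q.1 ∈ K ∧ ∀ i j, g q.1 (q.2 i) (q.2 j) = if i = j then 1 else 0} := by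
  obtain ⟨c, hc, hcle⟩ := exists_pos_forall_le
    (hK.prod (isCompact_sphere (0 : EuclideanSpace ℝ (Fin n)) 1))
    (φ := fun q => g q.1 q.2 q.2)
    (((hg.comp continuousOn_fst fun q hq => hq.1).clm_apply continuousOn_snd).clm_apply
      continuousOn_snd)
    (fun q hq => hpos q.1 hq.1 q.2 (by
      rintro h
      have := hq.2
      simp [h] at this))
  have hbound : ∀ p ∈ K, ∀ v, c * ‖v‖ ^ 2 ≤ g p v v := by
    intro p hp v
    by_cases hv : v = 0
    · simp [hv]
    · have hn : ‖v‖ ≠ 0 := norm_ne_zero_iff.2 hv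
      have := hcle (p, (‖v‖⁻¹) • v) ⟨hp, by simp [norm_smul, hn]⟩
      simp only [map_smul, smul_apply, smul_eq_mul] at this
      calc c * ‖v‖ ^ 2 ≤ (‖v‖⁻¹ * (‖v‖⁻¹ * g p v v)) * ‖v‖ ^ 2 :=
            mul_le_mul_of_nonneg_right this (sq_nonneg _)
        _ = g p v v := by field_simp
  -- Unit vectors v satisfy c‖v‖² ≤ g(v, v) = 1, so this radius bounds all orthonormal frames.
  set R := Real.sqrt (1 / c)
  have hcomp : IsCompact (K ×ˢ (univ.pi fun _ : Fin n =>
      Metric.closedBall (0 : EuclideanSpace ℝ (Fin n)) R)) :=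
    hK.prod (isCompact_univ_pi fun _ => isCompact_closedBall _ _)
  have hcl : ∀ i j : Fin n, IsClosed ((K ×ˢ (univ.pi fun _ : Fin n =>
      Metric.closedBall (0 : EuclideanSpace ℝ (Fin n)) R)) ∩
      (fun q : (ℝ × EuclideanSpace ℝ (Fin n)) × (Fin n → EuclideanSpace ℝ (Fin n)) =>
        g q.1 (q.2 i) (q.2 j)) ⁻¹' {if i = j then 1 else 0}) := by
    intro i j
    refine ContinuousOn.preimage_isClosed_of_isClosed ?_ hcomp.isClosed isClosed_singleton
    exact ((hg.comp continuousOn_fst fun q hq => hq.1).clm_apply (by fun_prop)).clm_apply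
      (by fun_prop)
  refine hcomp.of_isClosed_subset (s := _) ?_ (fun q hq => ⟨hq.1, fun i _ => ?_⟩)
  · convert hcomp.isClosed.inter (isClosed_iInter fun i => isClosed_iInter fun j => hcl i j)
      using 1
    ext q
    simp only [mem_ofPred_eq, mem_inter_iff, mem_iInter, mem_preimage, mem_singleton_iff]
    refine ⟨fun hq => ?_, fun hq => ⟨hq.1.1, fun i j => (hq.2 i j).2⟩⟩
    have h1 : q ∈ K ×ˢ (univ.pi fun _ : Fin n =>
      Metric.closedBall (0 : EuclideanSpace ℝ (Fin n)) R) := by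
      refine ⟨hq.1, fun i _ => ?_⟩
      rw [mem_closedBall_zero_iff]
      refine Real.le_sqrt_of_sq_le ?_
      have := hbound q.1 hq.1 (q.2 i)
      rw [hq.2 i i, if_pos rfl] at this
      rwa [le_div_iff₀' hc]
    exact ⟨h1, fun i j => ⟨h1, hq.2 i j⟩⟩
  · rw [mem_closedBall_zero_iff]
    refine Real.le_sqrt_of_sq_le ?_
    have := hbound q.1 hq.1 (q.2 i)
    rw [hq.2 i i, if_pos rfl] at this
    rwa [le_div_iff₀' hc]

/-- All coefficients depend continuously on a point together with an orthonormal frame over it, and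
these pairs form a compact set. The bounds hold for arbitrary orthonormal frames; the equation is
used only in the eigenframe that exists at each point. -/
theorem IsLocalFlow.exists_isParabolicAt (h : IsLocalFlow σ Γ F J Φ W G f A U X ν u κ)
    (hΓ : IsCurvatureCone Γ) (hF : IsCurvatureFunction Γ F) (hΦ : IsSpeedFunction J Φ)
    (hFJ : ∀ κ ∈ Γ, F κ ∈ J) {K : Set (ℝ × EuclideanSpace ℝ (Fin n))} (hK : IsCompact K)
    (hKS : K ⊆ A ×ˢ U) :
    ∃ lam > 0, ∃ C, ∀ p ∈ K, p.1 ∈ interior A → IsParabolicAt lam C u p.1 p.2 := by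
  have hA := h.uniqueDiffOn
  have hU := h.isOpen
  have cX1 : ContDiffOn ℝ 2 (spatialDeriv X) (A ×ˢ U) :=
    contDiffOn_spatialDeriv hA hU (by norm_num) h.contDiffOn
  have cX2 : ContDiffOn ℝ 1 (spatialDeriv (spatialDeriv X)) (A ×ˢ U) :=
    contDiffOn_spatialDeriv hA hU (by norm_num) cX1
  have cν1 : ContDiffOn ℝ 1 (spatialDeriv ν) (A ×ˢ U) :=
    contDiffOn_spatialDeriv hA hU (by norm_num) h.contDiffOn_normal
  have cν2 : ContDiffOn ℝ 0 (spatialDeriv (spatialDeriv ν)) (A ×ˢ U) :=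
    contDiffOn_spatialDeriv hA hU (by norm_num) cν1
  have cG1 : ContDiffOn ℝ 4 (fderiv ℝ G) W :=
    h.contDiffOn_metric.fderiv_of_isOpen h.isOpen_target (by norm_num)
  have cG2 : ContDiffOn ℝ 3 (fderiv ℝ (fderiv ℝ G)) W :=
    cG1.fderiv_of_isOpen h.isOpen_target (by norm_num)
  have cf1 : ContDiffOn ℝ 3 (fderiv ℝ f) W :=
    h.contDiffOn_fun.fderiv_of_isOpen h.isOpen_target (by norm_num)
  have hXW : MapsTo X (A ×ˢ U) W := h.mapsTo
  let g : ℝ × EuclideanSpace ℝ (Fin n) →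
      EuclideanSpace ℝ (Fin n) →L[ℝ] EuclideanSpace ℝ (Fin n) →L[ℝ] ℝ :=
    fun p => (G (X p)).bilinearComp (spatialDeriv X p) (spatialDeriv X p)
  have hgK : ContinuousOn g K := by
    have h0 : ContinuousOn (fun p => G (X p)) (A ×ˢ U) :=
      h.contDiffOn_metric.continuousOn.comp h.contDiffOn.continuousOn hXW
    have h1 : ContinuousOn g (A ×ˢ U) := by
      have h2 : ContinuousOn (fun p => ((G (X p)).comp (spatialDeriv X p)).flip) (A ×ˢ U) :=
        (ContinuousLinearMap.flipₗᵢ ℝ _ _ _).continuous.comp_continuousOn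
          (h0.clm_comp cX1.continuousOn)
      exact (ContinuousLinearMap.flipₗᵢ ℝ _ _ _).continuous.comp_continuousOn
        (h2.clm_comp cX1.continuousOn)
    exact h1.mono hKS
  have hQ := isCompact_frames hK hgK fun p hp v hv => h.pos p (hKS hp) v hv
  set Q := {q : (ℝ × EuclideanSpace ℝ (Fin n)) × (Fin n → EuclideanSpace ℝ (Fin n)) |
      q.1 ∈ K ∧ ∀ i j, g q.1 (q.2 i) (q.2 j) = if i = j then 1 else 0} with hQdef
  have hQS : MapsTo Prod.fst Q (A ×ˢ U) := fun q hq => hKS hq.1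
  have lift : ∀ {Z : Type} [TopologicalSpace Z] {φ : ℝ × EuclideanSpace ℝ (Fin n) → Z},
      ContinuousOn φ (A ×ˢ U) → ContinuousOn (fun q : (ℝ × EuclideanSpace ℝ (Fin n)) ×
        (Fin n → EuclideanSpace ℝ (Fin n)) => φ q.1) Q :=
    fun hφ => hφ.comp continuousOn_fst hQS
  have cX := h.contDiffOn.continuousOn
  have qG0 := lift (h.contDiffOn_metric.continuousOn.comp cX hXW)
  have qG1 := lift (cG1.continuousOn.comp cX hXW)
  have qG2 := lift (cG2.continuousOn.comp cX hXW)
  have qX1 := lift cX1.continuousOn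
  have qX2 := lift cX2.continuousOn
  have qν := lift h.contDiffOn_normal.continuousOn
  have qν1 := lift cν1.continuousOn
  have qν2 := lift cν2.continuousOn
  have qf := lift (h.contDiffOn_fun.continuousOn.comp cX hXW)
  have qf1 := lift (cf1.continuousOn.comp cX hXW)
  simp only [comp_apply] at qG0 qG1 qG2 qf qf1
  have qb : ∀ i, ContinuousOn (fun q : (ℝ × EuclideanSpace ℝ (Fin n)) ×
      (Fin n → EuclideanSpace ℝ (Fin n)) => q.2 i) Q := fun i => by fun_prop
  -- the principal curvatures as functions of the frame
  let k : (ℝ × EuclideanSpace ℝ (Fin n)) × (Fin n → EuclideanSpace ℝ (Fin n)) → Fin n → ℝ :=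
    fun q i => jetSff (G (X q.1)) (fderiv ℝ G (X q.1)) (spatialDeriv X q.1)
      (spatialDeriv (spatialDeriv X) q.1) (ν q.1) (q.2 i) (q.2 i)
  have qki : ∀ i, ContinuousOn (fun q => k q i) Q := fun i =>
    continuousOn_jetSff qG0 qG1 qX1 qX2 qν (qb i) (qb i)
  have qk : ContinuousOn k Q := continuousOn_pi.2 qki
  have hkΓ : MapsTo k Q Γ := by
    intro q hq
    obtain ⟨b', hb'⟩ := h.principal q.1 (hQS hq)
    let gB : EuclideanSpace ℝ (Fin n) →ₗ[ℝ] EuclideanSpace ℝ (Fin n) →ₗ[ℝ] ℝ :=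
      LinearMap.mk₂ ℝ (fun v w => g q.1 v w) (by simp) (by simp) (by simp) (by simp)
    have := diag_mem_convexHull_perm_of_frame (g := gB)
      (h := jetSffBilin (G (X q.1)) (fderiv ℝ G (X q.1)) (spatialDeriv X q.1)
        (spatialDeriv (spatialDeriv X) q.1) (ν q.1)) (b := q.2) (b' := b') hq.2
        (fun i j => (hb' i j).1) (fun i j => (hb' i j).2)
    exact (mem_and_le_of_mem_convexHull_perm hΓ hF (h.admissible q.1 (hQS hq)) this).1
  have cΦ1 : ContinuousOn (deriv Φ) J :=
    (hΦ.contDiffOn.deriv_of_isOpen (m := 3) hΦ.isOpen (by norm_num)).continuousOn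
  have cF1 : ContinuousOn (fderiv ℝ F) Γ :=
    (hF.contDiffOn.fderiv_of_isOpen (m := 3) hΓ.isOpen (by norm_num)).continuousOn
  let a : (ℝ × EuclideanSpace ℝ (Fin n)) × (Fin n → EuclideanSpace ℝ (Fin n)) → Fin n → ℝ :=
    fun q i => deriv Φ (F (k q)) * fderiv ℝ F (k q) (Pi.single i 1)
  have qa : ∀ i, ContinuousOn (fun q => a q i) Q := fun i =>
    (cΦ1.comp (hF.contDiffOn.continuousOn.comp qk hkΓ) fun q hq => hFJ _ (hkΓ hq)).mul
      ((cF1.comp qk hkΓ).clm_apply continuousOn_const)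
  have ha : ∀ q ∈ Q, ∀ i, 0 < a q i := fun q hq i =>
    mul_pos (hΦ.deriv_pos _ (hFJ _ (hkΓ hq))) (hF.strictMono _ (hkΓ hq) i)
  let β : (ℝ × EuclideanSpace ℝ (Fin n)) × (Fin n → EuclideanSpace ℝ (Fin n)) →
      EuclideanSpace ℝ (Fin n) := fun q => ∑ i, (a q i * σ) •
    sffGradCoeff σ (G (X q.1)) (fderiv ℝ G (X q.1)) (spatialDeriv X q.1)
      (spatialDeriv (spatialDeriv X) q.1) (ν q.1) (spatialDeriv ν q.1) q.2 (q.2 i)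
  have qβ : ContinuousOn β Q := continuousOn_finsetSum _ fun i _ =>
    ((qa i).mul continuousOn_const).smul
      (continuousOn_sffGradCoeff qG0 qG1 qX1 qX2 qν qν1 qb (qb i))
  let γ : (ℝ × EuclideanSpace ℝ (Fin n)) × (Fin n → EuclideanSpace ℝ (Fin n)) → ℝ := fun q =>
    (∑ i, a q i * (σ * sffCoeff σ (G (X q.1)) (fderiv ℝ G (X q.1)) (fderiv ℝ (fderiv ℝ G) (X q.1))
      (spatialDeriv X q.1) (spatialDeriv (spatialDeriv X) q.1) (ν q.1) (spatialDeriv ν q.1)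
      (spatialDeriv (spatialDeriv ν) q.1) q.2 (q.2 i) + k q i * (σ * metricCoeff (G (X q.1))
      (fderiv ℝ G (X q.1)) (spatialDeriv X q.1) (ν q.1) (spatialDeriv ν q.1) (q.2 i))))
    + deriv Φ (f (X q.1)) * (σ * fderiv ℝ f (X q.1) (ν q.1))
  have qγ : ContinuousOn γ Q := by
    refine ContinuousOn.add (continuousOn_finsetSum _ fun i _ => (qa i).mul
      ((continuousOn_const.mul
        (continuousOn_sffCoeff qG0 qG1 qG2 qX1 qX2 qν qν1 qν2 qb (qb i))).add
      ((qki i).mul (continuousOn_const.mul (continuousOn_metricCoeff qG0 qG1 qX1 qν qν1 (qb i))))))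
      ((cΦ1.comp qf fun q hq => h.fun_mem _ (hXW (hQS hq))).mul
        (continuousOn_const.mul (qf1.clm_apply qν)))
  obtain ⟨C1, hC1⟩ := hQ.exists_bound_of_continuousOn (f := fun q => ∑ i, a q i * ‖q.2 i‖ ^ 2)
    (continuousOn_finsetSum _ fun i _ => (qa i).mul ((qb i).norm.pow 2))
  obtain ⟨C2, hC2⟩ := hQ.exists_bound_of_continuousOn qβ
  obtain ⟨C3, hC3⟩ := hQ.exists_bound_of_continuousOn qγ
  obtain ⟨lam, hlam, hell⟩ := exists_pos_forall_le
    (hQ.prod (isCompact_sphere (0 : EuclideanSpace ℝ (Fin n)) 1))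
    (φ := fun z => ∑ i, a z.1 i * inner ℝ z.2 (z.1.2 i) ^ 2)
    (continuousOn_finsetSum _ fun i _ =>
      ((qa i).comp continuousOn_fst fun z hz => hz.1).mul (by fun_prop))
    (by
      rintro ⟨q, w⟩ ⟨hq, hw⟩
      have hnn : ∀ i, 0 ≤ a q i * inner ℝ w (q.2 i) ^ 2 := fun i =>
        mul_nonneg (ha q hq i).le (sq_nonneg _)
      refine (Finset.sum_nonneg fun i _ => hnn i).lt_of_ne' fun h0 => ?_
      have h1 := (Finset.sum_eq_zero_iff_of_nonneg fun i _ => hnn i).1 h0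
      -- A vanishing sum would make w Euclidean-orthogonal to every frame vector. These span, hence
      -- w = 0, contrary to |w| = 1.
      have h2 : ∀ i, inner ℝ w (q.2 i) = 0 := fun i => by
        have := h1 i (Finset.mem_univ i)
        rcases mul_eq_zero.1 this with h3 | h3
        · exact absurd h3 (ha q hq i).ne'
        · exact pow_eq_zero_iff two_ne_zero |>.1 h3
      let gB : EuclideanSpace ℝ (Fin n) →ₗ[ℝ] EuclideanSpace ℝ (Fin n) →ₗ[ℝ] ℝ :=
        LinearMap.mk₂ ℝ (fun v w => g q.1 v w) (by simp) (by simp) (by simp) (by simp)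
      obtain ⟨c, hc⟩ := exists_eq_sum_of_orthonormal (L := gB) (b := q.2) hq.2 w
      have h3 : inner ℝ w w = (0 : ℝ) := by
        conv_lhs => rw [hc, inner_sum]
        rw [← hc]
        simp [inner_smul_right, h2]
      rw [inner_self_eq_zero] at h3
      simp [h3] at hw)
  refine ⟨lam, hlam, max C1 (max C2 C3), fun p hp hpA => ⟨?_, ?_⟩⟩
  · refine h.contDiffOn_speed.contDiffAt (Filter.mem_of_superset
      ((isOpen_interior.prod hU).mem_nhds ⟨hpA, (hKS hp).2⟩) (prod_mono_left interior_subset))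
  obtain ⟨b, hb⟩ := h.principal p (hKS hp)
  have hq : (p, b) ∈ Q := ⟨hp, fun i j => (hb i j).1⟩
  have hkp : k (p, b) = κ p := by
    ext i
    exact ((hb i i).2).trans (if_pos rfl)
  refine ⟨a (p, b), b, β (p, b), γ (p, b), fun i => (ha _ hq i).le, ?_, ?_, ?_, ?_, ?_⟩
  · exact ((le_abs_self _).trans (hC1 _ hq)).trans (le_max_left _ _)
  · exact (hC2 _ hq).trans ((le_max_left _ _).trans (le_max_right _ _))
  · exact (hC3 _ hq).trans ((le_max_right _ _).trans (le_max_right _ _))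
  · intro w
    by_cases hw : w = 0
    · simp [hw]
    · have hn : ‖w‖ ≠ 0 := norm_ne_zero_iff.2 hw
      have := hell ((p, b), (‖w‖⁻¹) • w) ⟨hq, by simp [norm_smul, hn]⟩
      simp only [inner_smul_left, RCLike.conj_to_real] at this
      calc lam * ‖w‖ ^ 2
          ≤ (∑ i, a (p, b) i * (‖w‖⁻¹ * inner ℝ w (b i)) ^ 2) * ‖w‖ ^ 2 :=
            mul_le_mul_of_nonneg_right this (sq_nonneg _)
        _ = ∑ i, a (p, b) i * inner ℝ w (b i) ^ 2 := by
            rw [Finset.sum_mul]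
            refine Finset.sum_congr rfl fun i _ => ?_
            field_simp
  · have := h.deriv_speed_eq hΓ hF hΦ hFJ (p := p) hpA (hKS hp).2 (fun i j => (hb i j).1)
      (fun i j => (hb i j).2)
    rw [this]
    have e1 : fderiv ℝ (fun z => u (p.1, z)) p.2 (β (p, b)) = ∑ i, a (p, b) i * (σ *
        spatialDeriv u p (sffGradCoeff σ (G (X p)) (fderiv ℝ G (X p)) (spatialDeriv X p)
          (spatialDeriv (spatialDeriv X) p) (ν p) (spatialDeriv ν p) b (b i))) := by
      simp only [β, map_sum, map_smul, smul_eq_mul, mul_assoc]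
      rfl
    have e2 : ∀ i, fderiv ℝ (fderiv ℝ fun z => u (p.1, z)) p.2 (b i) (b i)
        = spatialDeriv (spatialDeriv u) p (b i) (b i) := fun i => rfl
    rw [e1]
    simp only [e2, γ, add_mul, Finset.sum_mul, ← hkp]
    rw [← add_assoc, ← Finset.sum_add_distrib, ← Finset.sum_add_distrib, map_smul, smul_eq_mul,
      sub_eq_add_neg]
    congr 1
    · refine Finset.sum_congr rfl fun i _ => ?_
      simp only [a]
      ring
    · ring

end LocalFlow

/-! ### Change of coordinates -/

section JetChange

variable {E V : Type*} [NormedAddCommGroup E] [NormedSpace ℝ E] [NormedAddCommGroup V]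
  [NormedSpace ℝ V]

theorem fderiv_fderiv_comp {E' : Type*} [NormedAddCommGroup E'] [NormedSpace ℝ E'] {f : E → V}
    {g : E' → E} {y : E'} (hf : ContDiffAt ℝ 2 f (g y)) (hg : ContDiffAt ℝ 2 g y) (v w : E') :
    fderiv ℝ (fderiv ℝ (f ∘ g)) y v w =
      fderiv ℝ (fderiv ℝ f) (g y) (fderiv ℝ g y v) (fderiv ℝ g y w)
        + fderiv ℝ f (g y) (fderiv ℝ (fderiv ℝ g) y v w) := by
  have h1 : fderiv ℝ (f ∘ g) =ᶠ[𝓝 y] fun z => (fderiv ℝ f (g z)).comp (fderiv ℝ g z) := by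
    filter_upwards [hg.eventually (by simp),
      hg.continuousAt.eventually (hf.eventually (by simp))] with z h2 h3
    exact fderiv_comp z (h3.differentiableAt (by norm_num)) (h2.differentiableAt (by norm_num))
  rw [h1.fderiv_eq]
  have h2 : HasFDerivAt (fun z => fderiv ℝ f (g z))
      ((fderiv ℝ (fderiv ℝ f) (g y)).comp (fderiv ℝ g y)) y :=
    HasFDerivAt.comp y ((hf.fderiv_right (m := 1) (by norm_num)).differentiableAt
      (by norm_num)).hasFDerivAt (hg.differentiableAt (by norm_num)).hasFDerivAt
  have h3 : HasFDerivAt (fderiv ℝ g) (fderiv ℝ (fderiv ℝ g) y) y :=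
    ((hg.fderiv_right (m := 1) (by norm_num)).differentiableAt (by norm_num)).hasFDerivAt
  rw [(h2.clm_comp h3).fderiv]
  simp
  abel

/-- The transformation law of the Christoffel symbols of the first kind. -/
theorem christoffelOf_change {G G' : V → V →L[ℝ] V →L[ℝ] ℝ} {φ : V → V} {z : V}
    (hφ : ContDiffAt ℝ 2 φ z) (hG : DifferentiableAt ℝ G z) (hG' : DifferentiableAt ℝ G' (φ z))
    (hsymm : ∀ a b, G' (φ z) a b = G' (φ z) b a)
    (hGG' : ∀ᶠ x in 𝓝 z, ∀ a b, G' (φ x) (fderiv ℝ φ x a) (fderiv ℝ φ x b) = G x a b)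
    (a b c : V) :
    christoffelOf (fderiv ℝ G' (φ z)) (fderiv ℝ φ z a) (fderiv ℝ φ z b) (fderiv ℝ φ z c)
      + G' (φ z) (fderiv ℝ (fderiv ℝ φ) z a b) (fderiv ℝ φ z c)
      = christoffelOf (fderiv ℝ G z) a b c := by
  have hφ1 : HasFDerivAt φ (fderiv ℝ φ z) z := (hφ.differentiableAt (by norm_num)).hasFDerivAt
  have hφ2 : HasFDerivAt (fderiv ℝ φ) (fderiv ℝ (fderiv ℝ φ) z) z :=
    ((hφ.fderiv_right (m := 1) (by norm_num)).differentiableAt (by norm_num)).hasFDerivAt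
  have key : ∀ a b c, fderiv ℝ G z c a b =
      fderiv ℝ G' (φ z) (fderiv ℝ φ z c) (fderiv ℝ φ z a) (fderiv ℝ φ z b)
      + G' (φ z) (fderiv ℝ (fderiv ℝ φ) z c a) (fderiv ℝ φ z b)
      + G' (φ z) (fderiv ℝ φ z a) (fderiv ℝ (fderiv ℝ φ) z c b) := by
    intro a b c
    have h1 : HasFDerivAt (fun x => G' (φ x)) ((fderiv ℝ G' (φ z)).comp (fderiv ℝ φ z)) z :=
      HasFDerivAt.comp z hG'.hasFDerivAt hφ1
    have h2 := (h1.clm_apply (hφ2.clm_apply (hasFDerivAt_const a z))).clm_apply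
      (hφ2.clm_apply (hasFDerivAt_const b z))
    have h3 := ((hG.hasFDerivAt.clm_apply (hasFDerivAt_const a z)).clm_apply
      (hasFDerivAt_const b z)).congr_of_eventuallyEq (by
        filter_upwards [hGG'] with x hx using hx a b)
    have h4 := congrArg (fun L => L c) (h3.unique h2)
    simp at h4
    linarith
  have hs : ∀ a b, fderiv ℝ (fderiv ℝ φ) z a b = fderiv ℝ (fderiv ℝ φ) z b a :=
    fun a b => hφ.isSymmSndFDerivAt (by simp) a b
  simp only [christoffelOf, key]
  rw [hs b a, hs c a, hs c b, hsymm (fderiv ℝ φ z b) (fderiv ℝ (fderiv ℝ φ) z a c),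
    hsymm (fderiv ℝ φ z a) (fderiv ℝ (fderiv ℝ φ) z b c)]
  ring

/-- The second fundamental form does not depend on the coordinates. -/
theorem jetSff_change {G G' : V → V →L[ℝ] V →L[ℝ] ℝ} {φ : V → V} {X : E → V} {ψ : E → E} {y : E}
    (hψ : ContDiffAt ℝ 2 ψ y) (hX : ContDiffAt ℝ 2 X (ψ y)) (hφ : ContDiffAt ℝ 2 φ (X (ψ y)))
    (hG : DifferentiableAt ℝ G (X (ψ y))) (hG' : DifferentiableAt ℝ G' (φ (X (ψ y))))
    (hsymm : ∀ a b, G' (φ (X (ψ y))) a b = G' (φ (X (ψ y))) b a)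
    (hGG' : ∀ᶠ x in 𝓝 (X (ψ y)), ∀ a b,
      G' (φ x) (fderiv ℝ φ x a) (fderiv ℝ φ x b) = G x a b)
    {ν : V} (hν : ∀ v, G (X (ψ y)) (fderiv ℝ X (ψ y) v) ν = 0) (v w : E) :
    jetSff (G' (φ (X (ψ y)))) (fderiv ℝ G' (φ (X (ψ y)))) (fderiv ℝ (φ ∘ X ∘ ψ) y)
      (fderiv ℝ (fderiv ℝ (φ ∘ X ∘ ψ)) y) (fderiv ℝ φ (X (ψ y)) ν) v w =
    jetSff (G (X (ψ y))) (fderiv ℝ G (X (ψ y))) (fderiv ℝ X (ψ y)) (fderiv ℝ (fderiv ℝ X) (ψ y)) ν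
      (fderiv ℝ ψ y v) (fderiv ℝ ψ y w) := by
  have h1 : ∀ v, fderiv ℝ (X ∘ ψ) y v = fderiv ℝ X (ψ y) (fderiv ℝ ψ y v) := fun v => by
    rw [fderiv_comp y (hX.differentiableAt (by norm_num)) (hψ.differentiableAt (by norm_num))]
    rfl
  have hXψ : ContDiffAt ℝ 2 (X ∘ ψ) y := hX.comp y hψ
  have h2 : ∀ v, fderiv ℝ (φ ∘ X ∘ ψ) y v
      = fderiv ℝ φ (X (ψ y)) (fderiv ℝ X (ψ y) (fderiv ℝ ψ y v)) := fun v => by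
    rw [fderiv_comp y (g := φ) (f := X ∘ ψ) (hφ.differentiableAt (by norm_num))
      (hXψ.differentiableAt (by norm_num)), ContinuousLinearMap.comp_apply, h1]
    rfl
  have h3 := fderiv_fderiv_comp (f := φ) (g := X ∘ ψ) hφ hXψ v w
  rw [fderiv_fderiv_comp hX hψ, h1, h1] at h3
  simp only [comp_apply] at h3
  have h4 := christoffelOf_change hφ hG hG' hsymm hGG' (fderiv ℝ X (ψ y) (fderiv ℝ ψ y v))
    (fderiv ℝ X (ψ y) (fderiv ℝ ψ y w)) ν
  have h5 := hGG'.self_of_nhds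
  simp only [jetSff]
  rw [h2, h2, h3, ← h4]
  -- The second derivative of ψ contributes only a tangential vector, which is killed by `hν`; the
  -- second derivative of φ has been absorbed into the change of the Christoffel symbols.
  simp only [map_add, add_apply, h5, hν]
  ring

end JetChange

section Charts

variable {d : ℕ} {N : Type*} [TopologicalSpace N] [ChartedSpace (EuclideanSpace ℝ (Fin d)) N]

theorem metricInChart_eq
    (g : ∀ p : N, TangentSpace (𝓡 d) p →L[ℝ] TangentSpace (𝓡 d) p →L[ℝ] ℝ) {q r : N}
    {y : EuclideanSpace ℝ (Fin d)} (hr : (extChartAt (𝓡 d) q).symm y = r)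
    (v w : EuclideanSpace ℝ (Fin d)) :
    metricInChart g q y v w =
      g r (fderiv ℝ (extChartAt (𝓡 d) r ∘ (extChartAt (𝓡 d) q).symm) y v)
        (fderiv ℝ (extChartAt (𝓡 d) r ∘ (extChartAt (𝓡 d) q).symm) y w) := by
  subst hr
  rfl

variable [IsManifold (𝓡 d) 6 N]

theorem contDiffAt_chartChange {p q r : N} (hp : r ∈ (extChartAt (𝓡 d) p).source)
    (hq : r ∈ (extChartAt (𝓡 d) q).source) :
    ContDiffAt ℝ 6 (extChartAt (𝓡 d) q ∘ (extChartAt (𝓡 d) p).symm) (extChartAt (𝓡 d) p r) := by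
  have h := contDiffWithinAt_ext_coord_change (I := 𝓡 d) (n := 6) q p
    (y := extChartAt (𝓡 d) p r) (by
      rw [PartialEquiv.trans_source'', PartialEquiv.symm_symm, PartialEquiv.symm_target]
      exact mem_image_of_mem _ ⟨hp, hq⟩)
  simpa [contDiffWithinAt_univ] using h

theorem tangentCoordChange_eq_fderiv (p q r : N) :
    tangentCoordChange (𝓡 d) p q r =
      fderiv ℝ (extChartAt (𝓡 d) q ∘ (extChartAt (𝓡 d) p).symm) (extChartAt (𝓡 d) p r) := by
  rw [tangentCoordChange_def, ModelWithCorners.range_eq_univ, fderivWithin_univ]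

theorem fderiv_chartChange_comp {p q s r : N} (hp : r ∈ (extChartAt (𝓡 d) p).source)
    (hq : r ∈ (extChartAt (𝓡 d) q).source) (hs : r ∈ (extChartAt (𝓡 d) s).source)
    (v : EuclideanSpace ℝ (Fin d)) :
    fderiv ℝ (extChartAt (𝓡 d) s ∘ (extChartAt (𝓡 d) q).symm) (extChartAt (𝓡 d) q r)
      (fderiv ℝ (extChartAt (𝓡 d) q ∘ (extChartAt (𝓡 d) p).symm) (extChartAt (𝓡 d) p r) v) =
    fderiv ℝ (extChartAt (𝓡 d) s ∘ (extChartAt (𝓡 d) p).symm) (extChartAt (𝓡 d) p r) v := by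
  have h := tangentCoordChange_comp (I := 𝓡 d) (w := p) (x := q) (y := s) (z := r) (v := v)
    ⟨⟨hp, hq⟩, hs⟩
  simpa only [tangentCoordChange_eq_fderiv] using h

theorem fderiv_chartChange_self {p r : N} (hp : r ∈ (extChartAt (𝓡 d) p).source)
    (v : EuclideanSpace ℝ (Fin d)) :
    fderiv ℝ (extChartAt (𝓡 d) p ∘ (extChartAt (𝓡 d) p).symm) (extChartAt (𝓡 d) p r) v = v := by
  have h := tangentCoordChange_self (I := 𝓡 d) (x := p) (z := r) (v := v) hp
  simpa only [tangentCoordChange_eq_fderiv] using h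

theorem metricInChart_self
    (g : ∀ p : N, TangentSpace (𝓡 d) p →L[ℝ] TangentSpace (𝓡 d) p →L[ℝ] ℝ) (r : N)
    (v w : EuclideanSpace ℝ (Fin d)) :
    metricInChart g r (extChartAt (𝓡 d) r r) v w = g r v w := by
  rw [metricInChart_eq g (extChartAt_to_inv (I := 𝓡 d) r),
    fderiv_chartChange_self (mem_extChartAt_source r),
    fderiv_chartChange_self (mem_extChartAt_source r)]

/-- The transformation law of the metric. -/
theorem metricInChart_chartChange
    (g : ∀ p : N, TangentSpace (𝓡 d) p →L[ℝ] TangentSpace (𝓡 d) p →L[ℝ] ℝ) {p q r : N}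
    (hp : r ∈ (extChartAt (𝓡 d) p).source) (hq : r ∈ (extChartAt (𝓡 d) q).source)
    (v w : EuclideanSpace ℝ (Fin d)) :
    metricInChart g q (extChartAt (𝓡 d) q r)
      (fderiv ℝ (extChartAt (𝓡 d) q ∘ (extChartAt (𝓡 d) p).symm) (extChartAt (𝓡 d) p r) v)
      (fderiv ℝ (extChartAt (𝓡 d) q ∘ (extChartAt (𝓡 d) p).symm) (extChartAt (𝓡 d) p r) w) =
    metricInChart g p (extChartAt (𝓡 d) p r) v w := by
  rw [metricInChart_eq g ((extChartAt (𝓡 d) q).left_inv hq),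
    metricInChart_eq g ((extChartAt (𝓡 d) p).left_inv hp),
    fderiv_chartChange_comp hp hq (mem_extChartAt_source r),
    fderiv_chartChange_comp hp hq (mem_extChartAt_source r)]

/-- The neighbourhood version is needed because the transformation law of the Christoffel symbols
differentiates this identity. -/
theorem eventually_metricInChart_chartChange
    (g : ∀ p : N, TangentSpace (𝓡 d) p →L[ℝ] TangentSpace (𝓡 d) p →L[ℝ] ℝ) {p q r : N}
    (hp : r ∈ (extChartAt (𝓡 d) p).source) (hq : r ∈ (extChartAt (𝓡 d) q).source) :
    ∀ᶠ z in 𝓝 (extChartAt (𝓡 d) p r), ∀ v w,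
    metricInChart g q ((extChartAt (𝓡 d) q ∘ (extChartAt (𝓡 d) p).symm) z)
      (fderiv ℝ (extChartAt (𝓡 d) q ∘ (extChartAt (𝓡 d) p).symm) z v)
      (fderiv ℝ (extChartAt (𝓡 d) q ∘ (extChartAt (𝓡 d) p).symm) z w) =
    metricInChart g p z v w := by
  have h1 : (extChartAt (𝓡 d) p).target ∈ 𝓝 (extChartAt (𝓡 d) p r) :=
    extChartAt_target_mem_nhds' ((extChartAt (𝓡 d) p).map_source hp)
  have h2 : ∀ᶠ z in 𝓝 (extChartAt (𝓡 d) p r),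
      (extChartAt (𝓡 d) p).symm z ∈ (extChartAt (𝓡 d) q).source := by
    have hc : ContinuousAt (extChartAt (𝓡 d) p).symm (extChartAt (𝓡 d) p r) :=
      continuousAt_extChartAt_symm' hp
    refine hc.eventually ?_
    rw [(extChartAt (𝓡 d) p).left_inv hp]
    exact (isOpen_extChartAt_source q).mem_nhds hq
  filter_upwards [h1, h2] with z h3 h4 v w
  have := metricInChart_chartChange g ((extChartAt (𝓡 d) p).map_target h3) h4 v w
  rwa [(extChartAt (𝓡 d) p).right_inv h3] at this

end Charts

section Slice

variable {n : ℕ} {M N : Type*}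
  [TopologicalSpace M] [ChartedSpace (EuclideanSpace ℝ (Fin n)) M] [IsManifold (𝓡 n) 6 M]
  [TopologicalSpace N] [ChartedSpace (EuclideanSpace ℝ (Fin (n + 1))) N]
  [IsManifold (𝓡 (n + 1)) 6 N]
  {g : ∀ p : N, TangentSpace (𝓡 (n + 1)) p →L[ℝ] TangentSpace (𝓡 (n + 1)) p →L[ℝ] ℝ}
  {x : M → N} {c ξ : M} {q : N}

theorem eventuallyEq_writtenInCharts (hx : ContinuousAt x ξ)
    (hc : ξ ∈ (extChartAt (𝓡 n) c).source) :
    (fun y => extChartAt (𝓡 (n + 1)) q (x ((extChartAt (𝓡 n) c).symm y)))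
      =ᶠ[𝓝 (extChartAt (𝓡 n) c ξ)]
    (extChartAt (𝓡 (n + 1)) q ∘ (extChartAt (𝓡 (n + 1)) (x ξ)).symm) ∘
      writtenInExtChartAt (𝓡 n) (𝓡 (n + 1)) ξ x ∘
      (extChartAt (𝓡 n) ξ ∘ (extChartAt (𝓡 n) c).symm) := by
  have hs : ContinuousAt (extChartAt (𝓡 n) c).symm (extChartAt (𝓡 n) c ξ) :=
    continuousAt_extChartAt_symm' hc
  have h1 : ∀ᶠ ζ in 𝓝 ξ, ζ ∈ (extChartAt (𝓡 n) ξ).source :=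
    extChartAt_source_mem_nhds ξ
  have h2 : ∀ᶠ ζ in 𝓝 ξ, x ζ ∈ (extChartAt (𝓡 (n + 1)) (x ξ)).source :=
    hx.eventually (extChartAt_source_mem_nhds (x ξ))
  have hs' := hs.tendsto
  rw [(extChartAt (𝓡 n) c).left_inv hc] at hs'
  filter_upwards [hs'.eventually h1, hs'.eventually h2] with y h3 h4
  simp only [writtenInExtChartAt, comp_apply, (extChartAt (𝓡 n) ξ).left_inv h3,
    (extChartAt (𝓡 (n + 1)) (x ξ)).left_inv h4]

theorem contDiffAt_writtenInExtChartAt (hx : ContMDiffAt (𝓡 n) (𝓡 (n + 1)) 3 x ξ) :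
    ContDiffAt ℝ 3 (writtenInExtChartAt (𝓡 n) (𝓡 (n + 1)) ξ x) (extChartAt (𝓡 n) ξ ξ) := by
  have h := (contMDiffAt_iff.1 hx).2
  simpa [contDiffWithinAt_univ] using h

theorem mfderiv_eq_fderiv_written (hx : ContMDiffAt (𝓡 n) (𝓡 (n + 1)) 3 x ξ) :
    mfderiv (𝓡 n) (𝓡 (n + 1)) x ξ =
      fderiv ℝ (writtenInExtChartAt (𝓡 n) (𝓡 (n + 1)) ξ x) (extChartAt (𝓡 n) ξ ξ) := by
  rw [(hx.mdifferentiableAt (by norm_num)).mfderiv, ModelWithCorners.range_eq_univ,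
    fderivWithin_univ]

theorem fderiv_inCharts (hx : ContMDiffAt (𝓡 n) (𝓡 (n + 1)) 3 x ξ)
    (hc : ξ ∈ (extChartAt (𝓡 n) c).source) (hq : x ξ ∈ (extChartAt (𝓡 (n + 1)) q).source)
    (v : EuclideanSpace ℝ (Fin n)) :
    fderiv ℝ (fun y => extChartAt (𝓡 (n + 1)) q (x ((extChartAt (𝓡 n) c).symm y)))
      (extChartAt (𝓡 n) c ξ) v =
    fderiv ℝ (extChartAt (𝓡 (n + 1)) q ∘ (extChartAt (𝓡 (n + 1)) (x ξ)).symm)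
      (extChartAt (𝓡 (n + 1)) (x ξ) (x ξ)) (mfderiv (𝓡 n) (𝓡 (n + 1)) x ξ
      (fderiv ℝ (extChartAt (𝓡 n) ξ ∘ (extChartAt (𝓡 n) c).symm) (extChartAt (𝓡 n) c ξ) v)) := by
  have hψ := contDiffAt_chartChange hc (mem_extChartAt_source (I := 𝓡 n) ξ)
  have hφ := contDiffAt_chartChange (mem_extChartAt_source (I := 𝓡 (n + 1)) (x ξ)) hq
  have hX := contDiffAt_writtenInExtChartAt hx
  have e1 : (extChartAt (𝓡 n) ξ ∘ (extChartAt (𝓡 n) c).symm) (extChartAt (𝓡 n) c ξ)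
      = extChartAt (𝓡 n) ξ ξ := by
    rw [comp_apply, (extChartAt (𝓡 n) c).left_inv hc]
  have e2 : writtenInExtChartAt (𝓡 n) (𝓡 (n + 1)) ξ x (extChartAt (𝓡 n) ξ ξ)
      = extChartAt (𝓡 (n + 1)) (x ξ) (x ξ) := by simp [writtenInExtChartAt]
  rw [(eventuallyEq_writtenInCharts hx.continuousAt hc).fderiv_eq, mfderiv_eq_fderiv_written hx]
  rw [← e1] at hX e2
  have h1 := (hφ.differentiableAt (by norm_num)).hasFDerivAt
  rw [← e2] at h1
  have h2 := h1.comp (f := writtenInExtChartAt (𝓡 n) (𝓡 (n + 1)) ξ x ∘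
    (extChartAt (𝓡 n) ξ ∘ (extChartAt (𝓡 n) c).symm)) _ ((hX.differentiableAt (by
    norm_num)).hasFDerivAt.comp _
    (hψ.differentiableAt (by norm_num)).hasFDerivAt)
  rw [h2.fderiv, e2, ← e1]
  rfl

theorem metricInChart_tangent (hx : ContMDiffAt (𝓡 n) (𝓡 (n + 1)) 3 x ξ)
    (hc : ξ ∈ (extChartAt (𝓡 n) c).source) (hq : x ξ ∈ (extChartAt (𝓡 (n + 1)) q).source)
    (v : EuclideanSpace ℝ (Fin n)) (η : TangentSpace (𝓡 (n + 1)) (x ξ)) :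
    metricInChart g q (extChartAt (𝓡 (n + 1)) q (x ξ))
      (fderiv ℝ (fun y => extChartAt (𝓡 (n + 1)) q (x ((extChartAt (𝓡 n) c).symm y)))
        (extChartAt (𝓡 n) c ξ) v)
      (fderiv ℝ (extChartAt (𝓡 (n + 1)) q ∘ (extChartAt (𝓡 (n + 1)) (x ξ)).symm)
        (extChartAt (𝓡 (n + 1)) (x ξ) (x ξ)) η) =
    g (x ξ) (mfderiv (𝓡 n) (𝓡 (n + 1)) x ξ
      (fderiv ℝ (extChartAt (𝓡 n) ξ ∘ (extChartAt (𝓡 n) c).symm) (extChartAt (𝓡 n) c ξ) v)) η := by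
  rw [fderiv_inCharts hx hc hq]
  exact (metricInChart_chartChange g (mem_extChartAt_source (I := 𝓡 (n + 1)) (x ξ)) hq _ _).trans
    (metricInChart_self g _ _ _)

theorem metricInChart_normal (hq : x ξ ∈ (extChartAt (𝓡 (n + 1)) q).source)
    (η η' : TangentSpace (𝓡 (n + 1)) (x ξ)) :
    metricInChart g q (extChartAt (𝓡 (n + 1)) q (x ξ))
      (fderiv ℝ (extChartAt (𝓡 (n + 1)) q ∘ (extChartAt (𝓡 (n + 1)) (x ξ)).symm)
        (extChartAt (𝓡 (n + 1)) (x ξ) (x ξ)) η)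
      (fderiv ℝ (extChartAt (𝓡 (n + 1)) q ∘ (extChartAt (𝓡 (n + 1)) (x ξ)).symm)
        (extChartAt (𝓡 (n + 1)) (x ξ) (x ξ)) η') = g (x ξ) η η' :=
  (metricInChart_chartChange g (mem_extChartAt_source (I := 𝓡 (n + 1)) (x ξ)) hq _ _).trans
    (metricInChart_self g _ _ _)

theorem inducedMetric_inCharts (hx : ContMDiffAt (𝓡 n) (𝓡 (n + 1)) 3 x ξ)
    (hc : ξ ∈ (extChartAt (𝓡 n) c).source) (hq : x ξ ∈ (extChartAt (𝓡 (n + 1)) q).source)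
    (v w : EuclideanSpace ℝ (Fin n)) :
    metricInChart g q (extChartAt (𝓡 (n + 1)) q (x ξ))
      (fderiv ℝ (fun y => extChartAt (𝓡 (n + 1)) q (x ((extChartAt (𝓡 n) c).symm y)))
        (extChartAt (𝓡 n) c ξ) v)
      (fderiv ℝ (fun y => extChartAt (𝓡 (n + 1)) q (x ((extChartAt (𝓡 n) c).symm y)))
        (extChartAt (𝓡 n) c ξ) w) =
    inducedMetric g x ξ
      (fderiv ℝ (extChartAt (𝓡 n) ξ ∘ (extChartAt (𝓡 n) c).symm) (extChartAt (𝓡 n) c ξ) v)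
      (fderiv ℝ (extChartAt (𝓡 n) ξ ∘ (extChartAt (𝓡 n) c).symm) (extChartAt (𝓡 n) c ξ) w) := by
  rw [fderiv_inCharts hx hc hq w]
  exact metricInChart_tangent hx hc hq v _

/-- The definition uses the preferred charts at ξ and x ξ, which vary with the point. This passes to
two fixed charts, in which the flow can be differentiated. -/
theorem secondFundamentalForm_inCharts {σ : ℝ} (hg : IsAmbientMetric σ g)
    (hx : ContMDiffAt (𝓡 n) (𝓡 (n + 1)) 3 x ξ)
    (hc : ξ ∈ (extChartAt (𝓡 n) c).source) (hq : x ξ ∈ (extChartAt (𝓡 (n + 1)) q).source)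
    {ν : TangentSpace (𝓡 (n + 1)) (x ξ)}
    (hν : ∀ v : TangentSpace (𝓡 n) ξ, g (x ξ) (mfderiv (𝓡 n) (𝓡 (n + 1)) x ξ v) ν = 0)
    (v w : EuclideanSpace ℝ (Fin n)) :
    jetSff (metricInChart g q (extChartAt (𝓡 (n + 1)) q (x ξ)))
      (fderiv ℝ (metricInChart g q) (extChartAt (𝓡 (n + 1)) q (x ξ)))
      (fderiv ℝ (fun y => extChartAt (𝓡 (n + 1)) q (x ((extChartAt (𝓡 n) c).symm y)))
        (extChartAt (𝓡 n) c ξ))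
      (fderiv ℝ (fderiv ℝ fun y => extChartAt (𝓡 (n + 1)) q (x ((extChartAt (𝓡 n) c).symm y)))
        (extChartAt (𝓡 n) c ξ))
      (fderiv ℝ (extChartAt (𝓡 (n + 1)) q ∘ (extChartAt (𝓡 (n + 1)) (x ξ)).symm)
        (extChartAt (𝓡 (n + 1)) (x ξ) (x ξ)) ν) v w =
    secondFundamentalForm g x ξ ν
      (fderiv ℝ (extChartAt (𝓡 n) ξ ∘ (extChartAt (𝓡 n) c).symm) (extChartAt (𝓡 n) c ξ) v)
      (fderiv ℝ (extChartAt (𝓡 n) ξ ∘ (extChartAt (𝓡 n) c).symm) (extChartAt (𝓡 n) c ξ) w) := by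
  have hψ := contDiffAt_chartChange hc (mem_extChartAt_source (I := 𝓡 n) ξ)
  have hφ := contDiffAt_chartChange (mem_extChartAt_source (I := 𝓡 (n + 1)) (x ξ)) hq
  have hX := contDiffAt_writtenInExtChartAt hx
  have hGd : ∀ p : N, x ξ ∈ (extChartAt (𝓡 (n + 1)) p).source →
      DifferentiableAt ℝ (metricInChart g p) (extChartAt (𝓡 (n + 1)) p (x ξ)) := fun p hp =>
    ((hg.contDiffOn p).contDiffAt ((isOpen_extChartAt_target p).mem_nhds
      ((extChartAt (𝓡 (n + 1)) p).map_source hp))).differentiableAt (by norm_num)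
  have hG := hGd (x ξ) (mem_extChartAt_source (x ξ))
  have hGG' := eventually_metricInChart_chartChange g
    (mem_extChartAt_source (I := 𝓡 (n + 1)) (x ξ)) hq
  have e1 : (extChartAt (𝓡 n) ξ ∘ (extChartAt (𝓡 n) c).symm) (extChartAt (𝓡 n) c ξ)
      = extChartAt (𝓡 n) ξ ξ := by
    rw [comp_apply, (extChartAt (𝓡 n) c).left_inv hc]
  have e2 : writtenInExtChartAt (𝓡 n) (𝓡 (n + 1)) ξ x (extChartAt (𝓡 n) ξ ξ)
      = extChartAt (𝓡 (n + 1)) (x ξ) (x ξ) := by simp [writtenInExtChartAt]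
  have e3 : (extChartAt (𝓡 (n + 1)) q ∘ (extChartAt (𝓡 (n + 1)) (x ξ)).symm)
      (extChartAt (𝓡 (n + 1)) (x ξ) (x ξ)) = extChartAt (𝓡 (n + 1)) q (x ξ) := by simp
  have hev := eventuallyEq_writtenInCharts (q := q) hx.continuousAt hc
  have hG' := hGd q hq
  have hsymm : ∀ a b, metricInChart g q (extChartAt (𝓡 (n + 1)) q (x ξ)) a b
      = metricInChart g q (extChartAt (𝓡 (n + 1)) q (x ξ)) b a := by
    intro a b
    rw [metricInChart_eq g ((extChartAt (𝓡 (n + 1)) q).left_inv hq),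
      metricInChart_eq g ((extChartAt (𝓡 (n + 1)) q).left_inv hq)]
    exact hg.symm _ _ _
  have hν' : ∀ v, metricInChart g (x ξ) (extChartAt (𝓡 (n + 1)) (x ξ) (x ξ))
      (fderiv ℝ (writtenInExtChartAt (𝓡 n) (𝓡 (n + 1)) ξ x) (extChartAt (𝓡 n) ξ ξ) v) ν = 0 := by
    intro v
    refine (metricInChart_self g _ _ _).trans ?_
    rw [← mfderiv_eq_fderiv_written hx]
    exact hν v
  rw [hev.fderiv_eq, hev.fderiv.fderiv_eq]
  simp only [secondFundamentalForm]
  have key := jetSff_change (G := metricInChart g (x ξ)) (G' := metricInChart g q)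
    (φ := extChartAt (𝓡 (n + 1)) q ∘ (extChartAt (𝓡 (n + 1)) (x ξ)).symm)
    (X := writtenInExtChartAt (𝓡 n) (𝓡 (n + 1)) ξ x)
    (ψ := extChartAt (𝓡 n) ξ ∘ (extChartAt (𝓡 n) c).symm) (y := extChartAt (𝓡 n) c ξ) (ν := ν)
    (hψ.of_le (by norm_num)) (by rw [e1]; exact hX.of_le (by norm_num))
    (by rw [e1, e2]; exact hφ.of_le (by norm_num)) (by rwa [e1, e2])
    (by rwa [e1, e2, e3]) (by rwa [e1, e2, e3]) (by rwa [e1, e2]) (by rwa [e1, e2]) v w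
  rw [e1, e2, e3] at key
  rw [key, e2]
  rfl

end Slice

/-! ### Time intervals and the coordinate expression of the flow on the manifold. -/

theorem ordConnected_timeInterval (T : EReal) : (timeInterval T).OrdConnected :=
  ⟨fun _ ha _ hb _ hc => ⟨ha.1.trans hc.1, (EReal.coe_le_coe_iff.2 hc.2).trans_lt hb.2⟩⟩

theorem exists_gt_mem_timeInterval {T : EReal} {t : ℝ} (ht : t ∈ timeInterval T) :
    ∃ s, t < s ∧ s ∈ timeInterval T := by
  obtain ⟨s, hs1, hs2⟩ := EReal.lt_iff_exists_real_btwn.1 ht.2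
  exact ⟨s, EReal.coe_lt_coe_iff.1 hs1, ht.1.trans (EReal.coe_lt_coe_iff.1 hs1).le, hs2⟩

theorem uniqueDiffOn_timeInterval_inter {T : EReal} {t δ : ℝ} (ht : t ∈ timeInterval T)
    (hδ : 0 < δ) : UniqueDiffOn ℝ (timeInterval T ∩ Ioo (t - δ) (t + δ)) := by
  -- A convex set with nonempty interior; the interior point is taken to the right of `t`, since `t`
  -- may be the initial time.
  refine uniqueDiffOn_convex
    ((ordConnected_timeInterval T).inter ordConnected_Ioo).convex ?_
  obtain ⟨s, hs, hsT⟩ := exists_gt_mem_timeInterval ht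
  have hlt : t < min s (t + δ) := lt_min hs (by linarith)
  obtain ⟨z, hz⟩ := exists_between hlt
  refine ⟨z, mem_interior.2 ⟨Ioo t (min s (t + δ)), fun w hw => ⟨?_, ?_⟩, isOpen_Ioo, hz⟩⟩
  · exact (ordConnected_timeInterval T).out ht hsT ⟨hw.1.le, (hw.2.trans_le (min_le_left _ _)).le⟩
  · exact ⟨by linarith [hw.1], hw.2.trans_le (min_le_right _ _)⟩

theorem mem_interior_timeInterval_inter {T : EReal} {t t₀ δ : ℝ} (ht : t ∈ timeInterval T)
    (htδ : t ∈ Ioo (t₀ - δ) (t₀ + δ)) (h0 : 0 < t) :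
    t ∈ interior (timeInterval T ∩ Ioo (t₀ - δ) (t₀ + δ)) := by
  rw [interior_inter, isOpen_Ioo.interior_eq]
  refine ⟨?_, htδ⟩
  obtain ⟨s, hs, hsT⟩ := exists_gt_mem_timeInterval ht
  exact mem_interior.2 ⟨Ioo 0 s, fun w hw => ⟨hw.1.le,
    (EReal.coe_lt_coe_iff.2 hw.2).trans hsT.2⟩, isOpen_Ioo, h0, hs⟩

section Flow

variable {n : ℕ} {M N : Type*}
  [TopologicalSpace M] [ChartedSpace (EuclideanSpace ℝ (Fin n)) M] [IsManifold (𝓡 n) 6 M]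
  [TopologicalSpace N] [ChartedSpace (EuclideanSpace ℝ (Fin (n + 1))) N]
  [IsManifold (𝓡 (n + 1)) 6 N] {σ : ℝ}
  {g : ∀ p : N, TangentSpace (𝓡 (n + 1)) p →L[ℝ] TangentSpace (𝓡 (n + 1)) p →L[ℝ] ℝ}
  {Γ : Set (Fin n → ℝ)} {F : (Fin n → ℝ) → ℝ} {J : Set ℝ} {Φ : ℝ → ℝ} {Ω : Set N} {f : N → ℝ}
  {T : EReal} {x : ℝ → M → N} {ν : ∀ (t : ℝ) (ξ : M), TangentSpace (𝓡 (n + 1)) (x t ξ)}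
  {κ : ℝ → M → Fin n → ℝ}

theorem contMDiffOn_chartSymm (c : M) :
    ContMDiffOn 𝓘(ℝ, ℝ × EuclideanSpace ℝ (Fin n)) (𝓘(ℝ, ℝ).prod (𝓡 n)) 3
      (fun p : ℝ × EuclideanSpace ℝ (Fin n) => (p.1, (extChartAt (𝓡 n) c).symm p.2))
      (univ ×ˢ (extChartAt (𝓡 n) c).target) := by
  refine ContMDiffOn.prodMk contDiff_fst.contMDiff.contMDiffOn ?_
  exact (contMDiffOn_extChartAt_symm (n := 3) c).comp contDiff_snd.contMDiff.contMDiffOn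
    fun p hp => hp.2

theorem IsCurvatureFlow.contMDiffAt (hx : IsCurvatureFlow σ g Γ F Φ Ω f T x ν κ) {t : ℝ}
    (ht : t ∈ timeInterval T) (ξ : M) : ContMDiffAt (𝓡 n) (𝓡 (n + 1)) 3 (x t) ξ := by
  have h1 : ContMDiffOn (𝓡 n) (𝓘(ℝ, ℝ).prod (𝓡 n)) 3 (fun ξ : M => (t, ξ)) univ :=
    (contMDiff_const.prodMk contMDiff_id).contMDiffOn
  have h2 := hx.contMDiffOn.comp h1 fun ξ _ => ⟨ht, mem_univ ξ⟩
  exact (contMDiffOn_univ.1 h2).contMDiffAt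

/-- The normal in the coordinates around `q`. -/
noncomputable def normalInChart (ν : ∀ (t : ℝ) (ξ : M), TangentSpace (𝓡 (n + 1)) (x t ξ)) (q : N)
    (t : ℝ) (ξ : M) : EuclideanSpace ℝ (Fin (n + 1)) :=
  fderiv ℝ (extChartAt (𝓡 (n + 1)) q ∘ (extChartAt (𝓡 (n + 1)) (x t ξ)).symm)
    (extChartAt (𝓡 (n + 1)) (x t ξ) (x t ξ)) (ν t ξ)

theorem IsCurvatureFlow.contDiffOn_normalInChart (hx : IsCurvatureFlow σ g Γ F Φ Ω f T x ν κ)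
    {c : M} {q : N} {S : Set (ℝ × EuclideanSpace ℝ (Fin n))}
    (hS : S ⊆ timeInterval T ×ˢ (extChartAt (𝓡 n) c).target)
    (hq : ∀ p ∈ S, x p.1 ((extChartAt (𝓡 n) c).symm p.2) ∈ (extChartAt (𝓡 (n + 1)) q).source) :
    ContDiffOn ℝ 2 (fun p => normalInChart ν q p.1 ((extChartAt (𝓡 n) c).symm p.2)) S := by
  have : IsManifold (𝓡 (n + 1)) (2 + 1) N := IsManifold.of_le (n := 6) (by norm_num)
  have : ContMDiffVectorBundle 2 (EuclideanSpace ℝ (Fin (n + 1)))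
      (TangentSpace (𝓡 (n + 1)) : N → Type _) (𝓡 (n + 1)) :=
    TangentBundle.contMDiffVectorBundle
  have h1 := hx.contMDiffOn_normal.comp (((contMDiffOn_chartSymm c).of_le (by norm_num)).mono
    (hS.trans (prod_mono_left (subset_univ _)))) fun p hp => ⟨(hS hp).1, mem_univ _⟩
  have h2 := ((trivializationAt (EuclideanSpace ℝ (Fin (n + 1)))
    (TangentSpace (𝓡 (n + 1)) : N → Type _) q).contMDiffOn_iff (fun p hp => by
      rw [Bundle.Trivialization.mem_source, TangentBundle.trivializationAt_baseSet,
        ← extChartAt_source (𝓡 (n + 1))]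
      exact hq p hp)).1 h1
  refine (contMDiffOn_iff_contDiffOn.1 h2.2).congr fun p hp => ?_
  simp only [comp_apply, TangentBundle.trivializationAt_apply, ModelWithCorners.range_eq_univ,
    fderivWithin_univ]
  rfl

theorem IsCurvatureFlow.hasDerivWithinAt_inChart (hx : IsCurvatureFlow σ g Γ F Φ Ω f T x ν κ)
    {t : ℝ} (ht : t ∈ timeInterval T) {ξ : M} {q : N}
    (hq : x t ξ ∈ (extChartAt (𝓡 (n + 1)) q).source) :
    HasDerivWithinAt (fun s => extChartAt (𝓡 (n + 1)) q (x s ξ))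
      ((-σ * speed Φ F f x κ t ξ) • normalInChart ν q t ξ) (timeInterval T) t := by
  have h1 := hx.evolution t ht ξ
  have h2 := h1.2
  have h3 := (contDiffAt_chartChange (mem_extChartAt_source (I := 𝓡 (n + 1)) (x t ξ))
    hq).differentiableAt (by norm_num)
  simp only [writtenInExtChartAt, extChartAt_self_eq, ModelWithCorners.range_eq_univ,
    inter_univ] at h2
  have h4 := (HasFDerivAt.comp_hasFDerivWithinAt
    (f := fun s : ℝ => extChartAt (𝓡 (n + 1)) (x t ξ) (x s ξ)) (s := timeInterval T) t
    h3.hasFDerivAt h2).hasDerivWithinAt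
  have h5 : ∀ᶠ s in 𝓝[timeInterval T] t, x s ξ ∈ (extChartAt (𝓡 (n + 1)) (x t ξ)).source :=
    h1.1.eventually (extChartAt_source_mem_nhds (I := 𝓡 (n + 1)) (x t ξ))
  have h6 := h4.congr_of_eventuallyEq (f₁ := fun s => extChartAt (𝓡 (n + 1)) q (x s ξ)) (by
    filter_upwards [h5] with s hs
    simp only [comp_apply, (extChartAt (𝓡 (n + 1)) (x t ξ)).left_inv hs]) (by simp)
  refine h6.congr_deriv ?_
  refine (congrArg (fderiv ℝ (extChartAt (𝓡 (n + 1)) q ∘ (extChartAt (𝓡 (n + 1)) (x t ξ)).symm)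
    (extChartAt (𝓡 (n + 1)) (x t ξ) (x t ξ))) (one_smul ℝ _)).trans ?_
  exact map_smul _ _ _

/-- By continuity a short time interval and a small coordinate ball are mapped into one fixed chart
of N. All objects are expressed there, the normal through the trivialization of the tangent bundle.
-/
theorem IsCurvatureFlow.exists_isLocalFlow (hx : IsCurvatureFlow σ g Γ F Φ Ω f T x ν κ)
    (hg : IsAmbientMetric σ g) (hΩ : IsOpen Ω) (hf : ContMDiffOn (𝓡 (n + 1)) 𝓘(ℝ, ℝ) 4 f Ω)
    (hfJ : ∀ p ∈ Ω, f p ∈ J) {t₀ : ℝ} (ht₀ : t₀ ∈ timeInterval T) {c : M}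
    {y₀ : EuclideanSpace ℝ (Fin n)} (hy₀ : y₀ ∈ (extChartAt (𝓡 n) c).target) :
    ∃ δ > 0, ∃ r > 0, Metric.ball y₀ r ⊆ (extChartAt (𝓡 n) c).target ∧
      ∃ W G fl X ν', IsLocalFlow σ Γ F J Φ W G fl (timeInterval T ∩ Ioo (t₀ - δ) (t₀ + δ))
        (Metric.ball y₀ r) X ν'
        (fun p => speed Φ F f x κ p.1 ((extChartAt (𝓡 n) c).symm p.2))
        (fun p => κ p.1 ((extChartAt (𝓡 n) c).symm p.2)) := by
  set q : N := x t₀ ((extChartAt (𝓡 n) c).symm y₀) with hqdef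
  have hΨ : ContMDiffOn 𝓘(ℝ, ℝ × EuclideanSpace ℝ (Fin n)) (𝓡 (n + 1)) 3
      (fun p : ℝ × EuclideanSpace ℝ (Fin n) => x p.1 ((extChartAt (𝓡 n) c).symm p.2))
      (timeInterval T ×ˢ (extChartAt (𝓡 n) c).target) :=
    hx.contMDiffOn.comp ((contMDiffOn_chartSymm c).mono (prod_mono_left (subset_univ _)))
      fun p hp => ⟨hp.1, mem_univ _⟩
  obtain ⟨δ, hδ, r, hr, hrt, hsource⟩ : ∃ δ > 0, ∃ r > 0,
      Metric.ball y₀ r ⊆ (extChartAt (𝓡 n) c).target ∧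
      ∀ p ∈ (timeInterval T ∩ Ioo (t₀ - δ) (t₀ + δ)) ×ˢ Metric.ball y₀ r,
        x p.1 ((extChartAt (𝓡 n) c).symm p.2) ∈ (extChartAt (𝓡 (n + 1)) q).source := by
    have h1 := (hΨ.continuousOn (t₀, y₀) ⟨ht₀, hy₀⟩).preimage_mem_nhdsWithin
      (extChartAt_source_mem_nhds (I := 𝓡 (n + 1)) q)
    rw [nhdsWithin_prod_eq, Filter.mem_prod_iff] at h1
    obtain ⟨s₁, hs₁, s₂, hs₂, hs⟩ := h1
    rw [nhdsWithin_eq_nhds.2 (extChartAt_target_mem_nhds' hy₀)] at hs₂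
    obtain ⟨δ, hδ, h2⟩ := Metric.mem_nhdsWithin_iff.1 hs₁
    obtain ⟨r, hr, h3⟩ := Metric.mem_nhds_iff.1
      (Filter.inter_mem hs₂ (extChartAt_target_mem_nhds' hy₀))
    rw [Real.ball_eq_Ioo] at h2
    exact ⟨δ, hδ, r, hr, h3.trans inter_subset_right, fun p hp =>
      hs ⟨h2 ⟨hp.1.2, hp.1.1⟩, (h3 hp.2).1⟩⟩
  refine ⟨δ, hδ, r, hr, hrt, (extChartAt (𝓡 (n + 1)) q).target ∩
    (extChartAt (𝓡 (n + 1)) q).symm ⁻¹' Ω, metricInChart g q,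
    f ∘ (extChartAt (𝓡 (n + 1)) q).symm,
    fun p => extChartAt (𝓡 (n + 1)) q (x p.1 ((extChartAt (𝓡 n) c).symm p.2)),
    fun p => normalInChart ν q p.1 ((extChartAt (𝓡 n) c).symm p.2), ?_⟩
  set A := timeInterval T ∩ Ioo (t₀ - δ) (t₀ + δ) with hAdef
  have hAU : A ×ˢ Metric.ball y₀ r ⊆ timeInterval T ×ˢ (extChartAt (𝓡 n) c).target :=
    prod_mono inter_subset_left hrt
  -- Lets pointwise statements be proved at the coordinates of a point ξ of M, where the chart
  -- lemmas apply, and then read at arbitrary coordinates y.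
  have hpt : ∀ {P : ℝ → M → EuclideanSpace ℝ (Fin n) → Prop},
      (∀ t ∈ timeInterval T, ∀ ξ ∈ (extChartAt (𝓡 n) c).source,
        x t ξ ∈ (extChartAt (𝓡 (n + 1)) q).source → P t ξ (extChartAt (𝓡 n) c ξ)) →
      ∀ p ∈ A ×ˢ Metric.ball y₀ r, P p.1 ((extChartAt (𝓡 n) c).symm p.2) p.2 := by
    intro P hP p hp
    have h1 := hP p.1 (hAU hp).1 _ ((extChartAt (𝓡 n) c).map_target (hAU hp).2) (hsource p hp)
    rwa [(extChartAt (𝓡 n) c).right_inv (hAU hp).2] at h1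
  have hsymm : ∀ z ∈ (extChartAt (𝓡 (n + 1)) q).target, ∀ a b,
      metricInChart g q z a b = metricInChart g q z b a := by
    intro z _ a b
    rw [metricInChart_eq g rfl, metricInChart_eq g rfl]
    exact hg.symm _ _ _
  have hP1 : ∀ ξ ∈ (extChartAt (𝓡 n) c).source, ∀ v : EuclideanSpace ℝ (Fin n),
      fderiv ℝ (extChartAt (𝓡 n) ξ ∘ (extChartAt (𝓡 n) c).symm) (extChartAt (𝓡 n) c ξ)
        (fderiv ℝ (extChartAt (𝓡 n) c ∘ (extChartAt (𝓡 n) ξ).symm) (extChartAt (𝓡 n) ξ ξ) v)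
      = v := by
    intro ξ hξ v
    rw [fderiv_chartChange_comp (mem_extChartAt_source ξ) hξ (mem_extChartAt_source ξ),
      fderiv_chartChange_self (mem_extChartAt_source ξ)]
  have hP2 : ∀ ξ ∈ (extChartAt (𝓡 n) c).source, ∀ v : EuclideanSpace ℝ (Fin n),
      fderiv ℝ (extChartAt (𝓡 n) c ∘ (extChartAt (𝓡 n) ξ).symm) (extChartAt (𝓡 n) ξ ξ)
        (fderiv ℝ (extChartAt (𝓡 n) ξ ∘ (extChartAt (𝓡 n) c).symm) (extChartAt (𝓡 n) c ξ) v)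
      = v := by
    intro ξ hξ v
    rw [fderiv_chartChange_comp hξ (mem_extChartAt_source ξ) hξ,
      fderiv_chartChange_self hξ]
  constructor
  · exact (continuousOn_extChartAt_symm q).isOpen_inter_preimage (isOpen_extChartAt_target q) hΩ
  · exact (hg.contDiffOn q).mono inter_subset_left
  · exact fun z hz => hsymm z hz.1
  · exact contMDiffOn_iff_contDiffOn.1 (hf.comp
      (((contMDiffOn_extChartAt_symm (n := 6) q).of_le (by norm_num)).mono inter_subset_left)
      fun z hz => hz.2)
  · exact fun z hz => hfJ _ hz.2
  · exact uniqueDiffOn_timeInterval_inter ht₀ hδ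
  · exact Metric.isOpen_ball
  · refine contMDiffOn_iff_contDiffOn.1 ((contMDiffOn_extChartAt (n := 3) (x := q)).comp
      (hΨ.mono hAU) fun p hp => ?_)
    have := hsource p hp
    rwa [extChartAt_source] at this
  · exact hx.contDiffOn_normalInChart hAU hsource
  · intro p hp
    refine ⟨(extChartAt (𝓡 (n + 1)) q).map_source (hsource p hp), ?_⟩
    rw [mem_preimage, (extChartAt (𝓡 (n + 1)) q).left_inv (hsource p hp)]
    exact hx.mem _ (hAU hp).1 _
  · intro p hp
    exact (hx.hasDerivWithinAt_inChart (hAU hp).1 (hsource p hp)).mono inter_subset_left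
  · rcases hg.signature with h | h <;> simp [h.1]
  · intro p hp
    exact (metricInChart_normal (hsource p hp) _ _).trans (hx.normal p.1 (hAU hp).1 _).1
  · refine hpt (P := fun t ξ y => ∀ v, metricInChart g q (extChartAt (𝓡 (n + 1)) q (x t ξ))
      (fderiv ℝ (fun y => extChartAt (𝓡 (n + 1)) q (x t ((extChartAt (𝓡 n) c).symm y))) y v)
      (normalInChart ν q t ξ) = 0) fun t ht ξ hξ hq v => ?_
    exact (metricInChart_tangent (hx.contMDiffAt ht ξ) hξ hq v _).trans ((hx.normal t ht ξ).2 _)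
  · refine hpt (P := fun t ξ y => ∀ v, v ≠ 0 →
      0 < metricInChart g q (extChartAt (𝓡 (n + 1)) q (x t ξ))
      (fderiv ℝ (fun y => extChartAt (𝓡 (n + 1)) q (x t ((extChartAt (𝓡 n) c).symm y))) y v)
      (fderiv ℝ (fun y => extChartAt (𝓡 (n + 1)) q (x t ((extChartAt (𝓡 n) c).symm y))) y v))
      fun t ht ξ hξ hq v hv => ?_
    rw [inducedMetric_inCharts (hx.contMDiffAt ht ξ) hξ hq]
    refine hx.spacelike t ht ξ _ fun h0 => hv ?_
    have := hP2 ξ hξ v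
    rw [← this]
    exact (congrArg _ h0).trans (map_zero _)
  · exact fun p hp => hx.admissible p.1 (hAU hp).1 _
  · refine hpt (P := fun t ξ y => ∃ b : Fin n → EuclideanSpace ℝ (Fin n), ∀ i j,
      metricInChart g q (extChartAt (𝓡 (n + 1)) q (x t ξ))
      (fderiv ℝ (fun y => extChartAt (𝓡 (n + 1)) q (x t ((extChartAt (𝓡 n) c).symm y))) y (b i))
      (fderiv ℝ (fun y => extChartAt (𝓡 (n + 1)) q (x t ((extChartAt (𝓡 n) c).symm y))) y (b j))
      = (if i = j then 1 else 0) ∧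
      jetSff (metricInChart g q (extChartAt (𝓡 (n + 1)) q (x t ξ)))
      (fderiv ℝ (metricInChart g q) (extChartAt (𝓡 (n + 1)) q (x t ξ)))
      (fderiv ℝ (fun y => extChartAt (𝓡 (n + 1)) q (x t ((extChartAt (𝓡 n) c).symm y))) y)
      (fderiv ℝ (fderiv ℝ fun y =>
        extChartAt (𝓡 (n + 1)) q (x t ((extChartAt (𝓡 n) c).symm y))) y)
      (normalInChart ν q t ξ) (b i) (b j) = (if i = j then κ t ξ i else 0))
      fun t ht ξ hξ hq => ?_
    obtain ⟨b, hb⟩ := hx.principal t ht ξ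
    refine ⟨fun i => fderiv ℝ (extChartAt (𝓡 n) c ∘ (extChartAt (𝓡 n) ξ).symm)
      (extChartAt (𝓡 n) ξ ξ) (b i), fun i j => ⟨?_, ?_⟩⟩
    · refine (inducedMetric_inCharts (hx.contMDiffAt ht ξ) hξ hq _ _).trans ?_
      exact (congrArg₂ (inducedMetric g (x t) ξ) (hP1 ξ hξ (b i)) (hP1 ξ hξ (b j))).trans (hb i j).1
    · refine (secondFundamentalForm_inCharts hg (hx.contMDiffAt ht ξ) hξ hq
        (hx.normal t ht ξ).2 _ _).trans ?_
      exact (congrArg₂ (secondFundamentalForm g (x t) ξ (ν t ξ)) (hP1 ξ hξ (b i))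
        (hP1 ξ hξ (b j))).trans (hb i j).2
  · intro p hp
    simp only [speed, comp_apply, (extChartAt (𝓡 (n + 1)) q).left_inv (hsource p hp)]

end Flow

/-! ### Maximum principles on the compact manifold. -/

section Parabolic

variable {n : ℕ} {M : Type*} [TopologicalSpace M] [ChartedSpace (EuclideanSpace ℝ (Fin n)) M]

/-- In every chart of `M`, the function `u` on `[0, T) × M` solves, locally and for positive times,
a linear uniformly parabolic equation with bounded coefficients. -/
def IsLocallyParabolic (T : EReal) (u : ℝ → M → ℝ) : Prop :=
  ∀ t₀ ∈ timeInterval T, ∀ c : M, ∀ y₀ ∈ (extChartAt (𝓡 n) c).target,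
    ∃ δ > 0, ∃ r > 0, Metric.ball y₀ r ⊆ (extChartAt (𝓡 n) c).target ∧
      ContinuousOn (fun p : ℝ × EuclideanSpace ℝ (Fin n) => u p.1 ((extChartAt (𝓡 n) c).symm p.2))
        ((timeInterval T ∩ Ioo (t₀ - δ) (t₀ + δ)) ×ˢ Metric.ball y₀ r) ∧
      ∃ lam > 0, ∃ C ≥ 0, ∀ p ∈ (timeInterval T ∩ Ioo (t₀ - δ) (t₀ + δ)) ×ˢ Metric.ball y₀ r,
        0 < p.1 → IsParabolicAt lam C (fun p => u p.1 ((extChartAt (𝓡 n) c).symm p.2)) p.1 p.2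

theorem Icc_subset_timeInterval {T : EReal} {t : ℝ} (ht : t ∈ timeInterval T) :
    Icc 0 t ⊆ timeInterval T := fun _ hs => ⟨hs.1, (EReal.coe_le_coe_iff.2 hs.2).trans_lt ht.2⟩

namespace IsLocallyParabolic

variable {T : EReal} {u : ℝ → M → ℝ}

theorem neg (hu : IsLocallyParabolic (n := n) T u) :
    IsLocallyParabolic (n := n) T fun t ξ => -u t ξ := by
  intro t₀ ht₀ c y₀ hy₀
  obtain ⟨δ, hδ, r, hr, h1, h2, lam, hlam, C, hC, h3⟩ := hu t₀ ht₀ c y₀ hy₀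
  exact ⟨δ, hδ, r, hr, h1, h2.neg, lam, hlam, C, hC, fun p hp h0 => (h3 p hp h0).neg⟩

theorem continuousOn_chart (hu : IsLocallyParabolic (n := n) T u) (c : M) :
    ContinuousOn (fun p : ℝ × EuclideanSpace ℝ (Fin n) => u p.1 ((extChartAt (𝓡 n) c).symm p.2))
      (timeInterval T ×ˢ (extChartAt (𝓡 n) c).target) := by
  rintro ⟨t₀, y₀⟩ ⟨ht₀, hy₀⟩
  obtain ⟨δ, hδ, r, hr, h1, h2, -⟩ := hu t₀ ht₀ c y₀ hy₀
  refine (h2 (t₀, y₀) ⟨⟨ht₀, by simpa using hδ⟩, Metric.mem_ball_self hr⟩).mono_of_mem_nhdsWithin ?_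
  rw [nhdsWithin_prod_eq]
  exact Filter.prod_mem_prod (Filter.inter_mem self_mem_nhdsWithin
    (mem_nhdsWithin_of_mem_nhds (Ioo_mem_nhds (by linarith) (by linarith))))
    (mem_nhdsWithin_of_mem_nhds (Metric.ball_mem_nhds _ hr))

theorem continuousOn (hu : IsLocallyParabolic (n := n) T u) :
    ContinuousOn (uncurry u) (timeInterval T ×ˢ univ) := by
  rintro ⟨t₀, ξ₀⟩ ⟨ht₀, -⟩
  have h1 := hu.continuousOn_chart ξ₀ (t₀, extChartAt (𝓡 n) ξ₀ ξ₀)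
    ⟨ht₀, mem_extChartAt_target ξ₀⟩
  have hmem : univ ×ˢ (extChartAt (𝓡 n) ξ₀).source ∈ 𝓝 (t₀, ξ₀) :=
    prod_mem_nhds Filter.univ_mem (extChartAt_source_mem_nhds ξ₀)
  have h2 : ContinuousWithinAt (fun p : ℝ × M => (p.1, extChartAt (𝓡 n) ξ₀ p.2))
      (timeInterval T ×ˢ (extChartAt (𝓡 n) ξ₀).source) (t₀, ξ₀) :=
    (continuousAt_fst.prodMk ((continuousAt_extChartAt ξ₀).comp
      (f := Prod.snd) (x := (t₀, ξ₀)) continuousAt_snd)).continuousWithinAt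
  have h3 := ContinuousWithinAt.comp (f := fun p : ℝ × M => (p.1, extChartAt (𝓡 n) ξ₀ p.2))
    (x := (t₀, ξ₀)) h1 h2 fun p hp => ⟨hp.1, (extChartAt (𝓡 n) ξ₀).map_source hp.2⟩
  have h4 := h3.congr (g := uncurry u) (fun p hp => by
    simp only [comp_apply, (extChartAt (𝓡 n) ξ₀).left_inv hp.2, uncurry]) (by simp [uncurry])
  refine h4.mono_of_mem_nhdsWithin ?_
  filter_upwards [self_mem_nhdsWithin, mem_nhdsWithin_of_mem_nhds hmem] with p h5 h6
  exact ⟨h5.1, h6.2⟩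

/-- Compactness of [0, t'] × M turns the local constants into a single one. -/
theorem exists_mul_le_deriv [CompactSpace M] (hu : IsLocallyParabolic (n := n) T u) {t' : ℝ}
    (ht' : t' ∈ timeInterval T) :
    ∃ C, ∀ t ∈ Ioc 0 t', ∀ ξ, IsLocalMin (u t) ξ → u t ξ < 0 →
      ∃ d, HasDerivAt (fun s => u s ξ) d t ∧ C * u t ξ ≤ d := by
  suffices h : ∃ C ≥ 0, ∀ p ∈ Icc 0 t' ×ˢ (univ : Set M), 0 < p.1 → IsLocalMin (u p.1) p.2 →
      u p.1 p.2 < 0 → ∃ d, HasDerivAt (fun s => u s p.2) d p.1 ∧ C * u p.1 p.2 ≤ d by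
    obtain ⟨C, -, h⟩ := h
    exact ⟨C, fun t ht ξ => h (t, ξ) ⟨⟨ht.1.le, ht.2⟩, mem_univ _⟩ ht.1⟩
  refine (isCompact_Icc.prod isCompact_univ).induction_on (p := fun s => ∃ C ≥ 0, ∀ p ∈ s, 0 < p.1 →
    IsLocalMin (u p.1) p.2 → u p.1 p.2 < 0 →
      ∃ d, HasDerivAt (fun s => u s p.2) d p.1 ∧ C * u p.1 p.2 ≤ d)
    ⟨0, le_rfl, fun p hp => hp.elim⟩ ?_ ?_ ?_
  · rintro s s' hss' ⟨C, hC, h⟩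
    exact ⟨C, hC, fun p hp => h p (hss' hp)⟩
  · rintro s s' ⟨C, hC, h⟩ ⟨C', hC', h'⟩
    -- The inequality is used only where u < 0, so enlarging the constant weakens it.
    refine ⟨C + C', add_nonneg hC hC', ?_⟩
    rintro p (hp | hp) h0 hmin hneg
    · obtain ⟨d, hd, hd'⟩ := h p hp h0 hmin hneg
      exact ⟨d, hd, by nlinarith⟩
    · obtain ⟨d, hd, hd'⟩ := h' p hp h0 hmin hneg
      exact ⟨d, hd, by nlinarith⟩
  · rintro ⟨t₀, ξ₀⟩ ⟨ht₀, -⟩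
    obtain ⟨δ, hδ, r, hr, h1, -, lam, hlam, C, hC, h3⟩ := hu t₀ (Icc_subset_timeInterval ht' ht₀)
      ξ₀ _ (mem_extChartAt_target ξ₀)
    have hmem : (extChartAt (𝓡 n) ξ₀).source ∩
        extChartAt (𝓡 n) ξ₀ ⁻¹' Metric.ball (extChartAt (𝓡 n) ξ₀ ξ₀) r ∈ 𝓝 ξ₀ :=
      Filter.inter_mem (extChartAt_source_mem_nhds ξ₀)
        ((continuousAt_extChartAt ξ₀).preimage_mem_nhds (Metric.ball_mem_nhds _ hr))
    refine ⟨(timeInterval T ∩ Ioo (t₀ - δ) (t₀ + δ)) ×ˢ ((extChartAt (𝓡 n) ξ₀).source ∩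
        extChartAt (𝓡 n) ξ₀ ⁻¹' Metric.ball (extChartAt (𝓡 n) ξ₀ ξ₀) r), ?_, C, hC, ?_⟩
    · rw [nhdsWithin_prod_eq]
      refine Filter.prod_mem_prod ?_ (mem_nhdsWithin_of_mem_nhds hmem)
      exact Filter.inter_mem
        (Filter.mem_of_superset self_mem_nhdsWithin (Icc_subset_timeInterval ht'))
        (mem_nhdsWithin_of_mem_nhds (Ioo_mem_nhds (by linarith) (by linarith)))
    · rintro ⟨t, ξ⟩ ⟨hp1, hp2, hp3⟩ h0 hmin hneg
      have h4 := h3 (t, extChartAt (𝓡 n) ξ₀ ξ) ⟨hp1, hp3⟩ h0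
      have e : (extChartAt (𝓡 n) ξ₀).symm (extChartAt (𝓡 n) ξ₀ ξ) = ξ :=
        (extChartAt (𝓡 n) ξ₀).left_inv hp2
      have h5 := hasDerivAt_slice h4.1
      have hmin' : IsLocalMin (fun z => u t ((extChartAt (𝓡 n) ξ₀).symm z))
          (extChartAt (𝓡 n) ξ₀ ξ) := by
        have hc : ContinuousAt (extChartAt (𝓡 n) ξ₀).symm (extChartAt (𝓡 n) ξ₀ ξ) :=
          continuousAt_extChartAt_symm' hp2
        refine IsLocalMin.comp_continuous (g := (extChartAt (𝓡 n) ξ₀).symm) ?_ hc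
        rwa [e]
      have h6 := h4.mul_le_deriv hmin' (by simpa only [e] using hneg)
      simp only [e] at h5 h6
      exact ⟨_, h5, h6⟩

theorem nonneg [CompactSpace M] (hu : IsLocallyParabolic (n := n) T u) (h0 : ∀ ξ, 0 ≤ u 0 ξ)
    {t : ℝ} (ht : t ∈ timeInterval T) (ξ : M) : 0 ≤ u t ξ := by
  obtain ⟨C, hC⟩ := hu.exists_mul_le_deriv ht
  exact weak_maximum_principle (hu.continuousOn.mono (prod_mono_left (Icc_subset_timeInterval ht)))
    hC h0 t ⟨ht.1, le_rfl⟩ ξ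

theorem exists_isParabolicAt (hu : IsLocallyParabolic (n := n) T u) {t' : ℝ}
    (ht' : t' ∈ timeInterval T) {c : M} {K : Set (EuclideanSpace ℝ (Fin n))} (hK : IsCompact K)
    (hKc : K ⊆ (extChartAt (𝓡 n) c).target) :
    ∃ lam > 0, ∃ C ≥ 0, ∀ p ∈ Icc 0 t' ×ˢ K, 0 < p.1 →
      IsParabolicAt lam C (fun p => u p.1 ((extChartAt (𝓡 n) c).symm p.2)) p.1 p.2 := by
  refine (isCompact_Icc.prod hK).induction_on (p := fun s => ∃ lam > 0, ∃ C ≥ 0, ∀ p ∈ s, 0 < p.1 →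
      IsParabolicAt lam C (fun p => u p.1 ((extChartAt (𝓡 n) c).symm p.2)) p.1 p.2)
    ⟨1, one_pos, 0, le_rfl, fun p hp => hp.elim⟩ ?_ ?_ ?_
  · rintro s s' hss' ⟨lam, hlam, C, hC, h⟩
    exact ⟨lam, hlam, C, hC, fun p hp => h p (hss' hp)⟩
  · rintro s s' ⟨lam, hlam, C, hC, h⟩ ⟨lam', hlam', C', hC', h'⟩
    refine ⟨min lam lam', lt_min hlam hlam', C + C', add_nonneg hC hC', ?_⟩
    rintro p (hp | hp) h0
    · exact (h p hp h0).mono (min_le_left _ _) (by linarith)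
    · exact (h' p hp h0).mono (min_le_right _ _) (by linarith)
  · rintro ⟨t₀, y₀⟩ ⟨ht₀, hy₀⟩
    obtain ⟨δ, hδ, r, hr, h1, -, lam, hlam, C, hC, h3⟩ := hu t₀ (Icc_subset_timeInterval ht' ht₀)
      c y₀ (hKc hy₀)
    refine ⟨_, ?_, lam, hlam, C, hC, h3⟩
    rw [nhdsWithin_prod_eq]
    refine Filter.prod_mem_prod ?_ (mem_nhdsWithin_of_mem_nhds (Metric.ball_mem_nhds _ hr))
    exact Filter.inter_mem
      (Filter.mem_of_superset self_mem_nhdsWithin (Icc_subset_timeInterval ht'))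
      (mem_nhdsWithin_of_mem_nhds (Ioo_mem_nhds (by linarith) (by linarith)))

/-- The barrier needs v ≥ 0 on the whole coordinate ball, including its lateral boundary; this is
what the weak maximum principle on M supplies. -/
theorem pos [CompactSpace M] (hu : IsLocallyParabolic (n := n) T u) (h0 : ∀ ξ, 0 ≤ u 0 ξ)
    {ξ₀ : M} (hξ₀ : 0 < u 0 ξ₀) {t : ℝ} (ht : t ∈ timeInterval T) : 0 < u t ξ₀ := by
  obtain ⟨R, hR, hRt⟩ := Metric.nhds_basis_closedBall.mem_iff.1
      (extChartAt_target_mem_nhds (I := 𝓡 n) ξ₀)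
  obtain ⟨lam, hlam, C, hC, h⟩ := hu.exists_isParabolicAt ht
    (isCompact_closedBall (extChartAt (𝓡 n) ξ₀ ξ₀) R) hRt
  have hsub := Icc_subset_timeInterval ht
  have := pos_of_isParabolicAt hR hlam hC
    ((hu.continuousOn_chart ξ₀).mono (prod_mono hsub hRt))
    (fun s hs y _ => hu.nonneg h0 (hsub hs) _)
    (fun s hs y hy => h (s, y) ⟨⟨hs.1.le, hs.2⟩, hy⟩ hs.1) (by simpa using hξ₀) t ⟨ht.1, le_rfl⟩
  simpa using this

end IsLocallyParabolic

variable [IsManifold (𝓡 n) 6 M] {N : Type*}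
  [TopologicalSpace N] [ChartedSpace (EuclideanSpace ℝ (Fin (n + 1))) N]
  [IsManifold (𝓡 (n + 1)) 6 N] {σ : ℝ}
  {g : ∀ p : N, TangentSpace (𝓡 (n + 1)) p →L[ℝ] TangentSpace (𝓡 (n + 1)) p →L[ℝ] ℝ}
  {Γ : Set (Fin n → ℝ)} {F : (Fin n → ℝ) → ℝ} {J : Set ℝ} {Φ : ℝ → ℝ} {Ω : Set N} {f : N → ℝ}
  {T : EReal} {x : ℝ → M → N} {ν : ∀ (t : ℝ) (ξ : M), TangentSpace (𝓡 (n + 1)) (x t ξ)}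
  {κ : ℝ → M → Fin n → ℝ}

theorem IsCurvatureFlow.isLocallyParabolic_speed
    (hx : IsCurvatureFlow σ g Γ F Φ Ω f T x ν κ)
    (hg : IsAmbientMetric σ g) (hΓ : IsCurvatureCone Γ) (hF : IsCurvatureFunction Γ F)
    (hΦ : IsSpeedFunction J Φ) (hΩ : IsOpen Ω) (hf : ContMDiffOn (𝓡 (n + 1)) 𝓘(ℝ, ℝ) 4 f Ω)
    (hFJ : ∀ κ ∈ Γ, F κ ∈ J) (hfJ : ∀ p ∈ Ω, f p ∈ J) :
    IsLocallyParabolic (n := n) T (speed Φ F f x κ) := by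
  intro t₀ ht₀ c y₀ hy₀
  obtain ⟨δ, hδ, r, hr, hrt, W, G, fl, X, ν', h⟩ := hx.exists_isLocalFlow hg hΩ hf hfJ ht₀ hy₀
  obtain ⟨s, hs, hsT⟩ := exists_gt_mem_timeInterval ht₀
  -- Small enough that the closed time interval up to t₀ + δ' stays below the final time and inside
  -- the coordinate domain, so the coefficient bounds hold on a compact set.
  set δ' := min (δ / 2) (s - t₀)
  have hδ' : 0 < δ' := lt_min (by linarith) (by linarith)
  have hδ1 : δ' ≤ δ / 2 := min_le_left _ _
  have hδ2 : δ' ≤ s - t₀ := min_le_right _ _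
  have hrb : Metric.closedBall y₀ (r / 2) ⊆ Metric.ball y₀ r :=
    Metric.closedBall_subset_ball (by linarith)
  have hsub : timeInterval T ∩ Ioo (t₀ - δ') (t₀ + δ') ⊆ Icc (max 0 (t₀ - δ')) (t₀ + δ') :=
    fun t ht => ⟨max_le ht.1.1 ht.2.1.le, ht.2.2.le⟩
  have hsub' : Icc (max 0 (t₀ - δ')) (t₀ + δ') ⊆ timeInterval T ∩ Ioo (t₀ - δ) (t₀ + δ) := by
    intro t ht
    have h1 := (le_max_left _ _).trans ht.1
    have h2 := (le_max_right _ _).trans ht.1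
    exact ⟨Icc_subset_timeInterval hsT ⟨h1, by linarith [ht.2]⟩, by linarith, by linarith [ht.2]⟩
  obtain ⟨lam, hlam, C, hC⟩ := h.exists_isParabolicAt hΓ hF hΦ hFJ
    (K := Icc (max 0 (t₀ - δ')) (t₀ + δ') ×ˢ Metric.closedBall y₀ (r / 2))
    (isCompact_Icc.prod (isCompact_closedBall _ _)) (prod_mono hsub' hrb)
  have hsub2 : Metric.ball y₀ (r / 2) ⊆ Metric.closedBall y₀
      (r / 2) := Metric.ball_subset_closedBall
  refine ⟨δ', hδ', r / 2, by linarith, hsub2.trans (hrb.trans hrt), ?_, lam, hlam, max C 0,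
    le_max_right _ _, fun p hp h0 => ?_⟩
  · exact h.contDiffOn_speed.continuousOn.mono
      (prod_mono (hsub.trans hsub') (hsub2.trans hrb))
  · refine (hC p ⟨hsub hp.1, hsub2 hp.2⟩ ?_).mono le_rfl (le_max_left _ _)
    exact mem_interior_timeInterval_inter hp.1.1 (hsub' (hsub hp.1)).2 h0

end Parabolic

/-! ### Positivity of integrals over the hypersurface. -/

section Integral

open MeasureTheory

variable {n : ℕ} {M N : Type*}
  [TopologicalSpace M] [ChartedSpace (EuclideanSpace ℝ (Fin n)) M]
  [TopologicalSpace N] [ChartedSpace (EuclideanSpace ℝ (Fin (n + 1))) N]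
  {g : ∀ p : N, TangentSpace (𝓡 (n + 1)) p →L[ℝ] TangentSpace (𝓡 (n + 1)) p →L[ℝ] ℝ}
  {x : M → N} {u : M → ℝ}

theorem hypersurfaceIntegral_neg [CompactSpace M] [T2Space M] :
    hypersurfaceIntegral g x (fun ξ => -u ξ) = -hypersurfaceIntegral g x u := by
  simp only [hypersurfaceIntegral, mul_neg, neg_mul, integral_neg]
  exact finsum_neg_distrib _

theorem exists_ne_zero_of_hypersurfaceIntegral_ne_zero [CompactSpace M] [T2Space M]
    (h : hypersurfaceIntegral g x u ≠ 0) : ∃ ξ, u ξ ≠ 0 := by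
  by_contra! hu
  exact h (by simp [hypersurfaceIntegral, hu])

theorem volumeDensity_nonneg (c : M) (y : EuclideanSpace ℝ (Fin n)) :
    0 ≤ volumeDensity g x c y := Real.sqrt_nonneg _

variable [IsManifold (𝓡 n) 6 M] [IsManifold (𝓡 (n + 1)) 6 N] {σ : ℝ}

/-- Replaces the preferred chart of N at the image point, which changes with y, by a fixed chart, in
which continuity in y becomes visible. -/
theorem volumeDensity_inCharts (hx : ∀ ξ, ContMDiffAt (𝓡 n) (𝓡 (n + 1)) 3 x ξ) {c : M} {q : N}
    {y : EuclideanSpace ℝ (Fin n)} (hy : y ∈ (extChartAt (𝓡 n) c).target)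
    (hq : x ((extChartAt (𝓡 n) c).symm y) ∈ (extChartAt (𝓡 (n + 1)) q).source) :
    volumeDensity g x c y = Real.sqrt (Matrix.det (Matrix.of fun i j : Fin n =>
      metricInChart g q (extChartAt (𝓡 (n + 1)) q (x ((extChartAt (𝓡 n) c).symm y)))
      (fderiv ℝ (fun y => extChartAt (𝓡 (n + 1)) q (x ((extChartAt (𝓡 n) c).symm y))) y
        (EuclideanSpace.single i 1))
      (fderiv ℝ (fun y => extChartAt (𝓡 (n + 1)) q (x ((extChartAt (𝓡 n) c).symm y))) y
        (EuclideanSpace.single j 1)))) := by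
  have h := fun v w => inducedMetric_inCharts (g := g) (hx _) ((extChartAt (𝓡 n) c).map_target hy)
    hq v w
  rw [(extChartAt (𝓡 n) c).right_inv hy] at h
  simp only [h]
  rfl

theorem continuousAt_volumeDensity (hg : IsAmbientMetric σ g)
    (hx : ∀ ξ, ContMDiffAt (𝓡 n) (𝓡 (n + 1)) 3 x ξ) {c : M}
    {y : EuclideanSpace ℝ (Fin n)} (hy : y ∈ (extChartAt (𝓡 n) c).target) :
    ContinuousAt (volumeDensity g x c) y := by
  set q := x ((extChartAt (𝓡 n) c).symm y) with hqdef
  have hs : ContMDiffAt 𝓘(ℝ, EuclideanSpace ℝ (Fin n)) (𝓡 n) 3 (extChartAt (𝓡 n) c).symm y :=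
    (contMDiffOn_extChartAt_symm (n := 3) c).contMDiffAt (extChartAt_target_mem_nhds' hy)
  have hX : ContMDiffAt 𝓘(ℝ, EuclideanSpace ℝ (Fin n)) 𝓘(ℝ, EuclideanSpace ℝ (Fin (n + 1))) 3
      (fun y => extChartAt (𝓡 (n + 1)) q (x ((extChartAt (𝓡 n) c).symm y))) y :=
    (contMDiffAt_extChartAt (n := 3) (x := q)).comp y ((hx _).comp y hs)
  have hX' := hX.contDiffAt
  have hX1 : ContinuousAt (fderiv ℝ
      fun y => extChartAt (𝓡 (n + 1)) q (x ((extChartAt (𝓡 n) c).symm y))) y :=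
    (hX'.fderiv_right (m := 2) (by norm_num)).continuousAt
  have hG : ContinuousAt (metricInChart g q) (extChartAt (𝓡 (n + 1)) q q) :=
    ((hg.contDiffOn q).contDiffAt (extChartAt_target_mem_nhds q)).continuousAt
  have hG' : ContinuousAt (fun y => metricInChart g q
      (extChartAt (𝓡 (n + 1)) q (x ((extChartAt (𝓡 n) c).symm y)))) y :=
    ContinuousAt.comp (f := fun y => extChartAt (𝓡 (n + 1)) q (x ((extChartAt (𝓡 n) c).symm y)))
      hG hX'.continuousAt
  have hev : ∀ᶠ z in 𝓝 y, x ((extChartAt (𝓡 n) c).symm z) ∈ (extChartAt (𝓡 (n + 1)) q).source :=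
    ((hx _).comp y hs).continuousAt.eventually (extChartAt_source_mem_nhds q)
  have hev' : (fun y => Real.sqrt (Matrix.det (Matrix.of fun i j : Fin n =>
      metricInChart g q (extChartAt (𝓡 (n + 1)) q (x ((extChartAt (𝓡 n) c).symm y)))
      (fderiv ℝ (fun y => extChartAt (𝓡 (n + 1)) q (x ((extChartAt (𝓡 n) c).symm y))) y
        (EuclideanSpace.single i 1))
      (fderiv ℝ (fun y => extChartAt (𝓡 (n + 1)) q (x ((extChartAt (𝓡 n) c).symm y))) y
        (EuclideanSpace.single j 1))))) =ᶠ[𝓝 y] volumeDensity g x c := by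
    filter_upwards [hev, extChartAt_target_mem_nhds' hy] with z h1 h2
    exact (volumeDensity_inCharts hx h2 h1).symm
  refine ContinuousAt.congr ?_ hev'
  refine Real.continuous_sqrt.continuousAt.comp
    ((continuous_id.matrix_det).continuousAt.comp (g := fun A : Matrix (Fin n) (Fin n) ℝ => A.det)
    ?_)
  refine continuousAt_pi.2 fun i => continuousAt_pi.2 fun j => ?_
  exact (hG'.clm_apply (hX1.clm_apply continuousAt_const)).clm_apply
    (hX1.clm_apply continuousAt_const)

theorem volumeDensity_pos (hg : IsAmbientMetric σ g) (hs : IsSpacelike g x) {c : M}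
    {y : EuclideanSpace ℝ (Fin n)} (hy : y ∈ (extChartAt (𝓡 n) c).target) :
    0 < volumeDensity g x c y := by
  refine Real.sqrt_pos.2 (Matrix.PosDef.det_pos ?_)
  set ξ := (extChartAt (𝓡 n) c).symm y with hξdef
  have hξ : ξ ∈ (extChartAt (𝓡 n) c).source := (extChartAt (𝓡 n) c).map_target hy
  set A : EuclideanSpace ℝ (Fin n) →L[ℝ] EuclideanSpace ℝ (Fin n) :=
    fderiv ℝ (extChartAt (𝓡 n) ξ ∘ (extChartAt (𝓡 n) c).symm) y with hA
  -- The reverse chart change inverts `A`, so positivity of the induced metric carries over to the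
  -- coordinate matrix.
  have hinj : ∀ v, A v = 0 → v = 0 := by
    intro v hv
    have h1 := fderiv_chartChange_comp hξ (mem_extChartAt_source ξ) hξ v
    rw [fderiv_chartChange_self hξ, hξdef, (extChartAt (𝓡 n) c).right_inv hy, ← hξdef, ← hA, hv,
      map_zero] at h1
    exact h1.symm
  let D : EuclideanSpace ℝ (Fin n) →L[ℝ] TangentSpace (𝓡 (n + 1)) (x ξ) :=
    (mfderiv (𝓡 n) (𝓡 (n + 1)) x ξ).comp A
  refine Matrix.PosDef.of_dotProduct_mulVec_pos ?_ fun w hw => ?_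
  · ext i j
    exact hg.symm _ _ _
  · have hv : (∑ i, w i • EuclideanSpace.single i (1 : ℝ) : EuclideanSpace ℝ (Fin n)) ≠ 0 := by
      intro h0
      refine hw (funext fun i => ?_)
      have := congrArg (fun z : EuclideanSpace ℝ (Fin n) => z i) h0
      simpa [Pi.single_apply] using this
    have h1 := hs ξ _ fun h0 => hv (hinj _ h0)
    have h2 : inducedMetric g x ξ (A (∑ i, w i • EuclideanSpace.single i (1 : ℝ)))
        (A (∑ i, w i • EuclideanSpace.single i (1 : ℝ))) =
        g (x ξ) (D (∑ i, w i • EuclideanSpace.single i (1 : ℝ)))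
          (D (∑ i, w i • EuclideanSpace.single i (1 : ℝ))) := rfl
    rw [h2] at h1
    refine h1.trans_eq ?_
    simp only [map_sum, map_smul, sum_apply, smul_apply, smul_eq_mul,
      dotProduct, Matrix.mulVec, Matrix.of_apply, star_trivial, Finset.mul_sum]
    refine Finset.sum_comm.trans (Finset.sum_congr rfl fun i _ => Finset.sum_congr rfl fun j _ =>
        ?_)
    rw [mul_left_comm, mul_comm (w j)]
    rfl

/-- All chart contributions are nonnegative, and a chart whose partition function is positive at ξ₀
contributes strictly: its continuous integrand is positive at the coordinates of ξ₀, hence nonzero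
on a set of positive measure. -/
theorem hypersurfaceIntegral_pos [CompactSpace M] [T2Space M] (hg : IsAmbientMetric σ g)
    (hx : ∀ ξ, ContMDiffAt (𝓡 n) (𝓡 (n + 1)) 3 x ξ) (hs : IsSpacelike g x) (hu : Continuous u)
    (hnonneg : ∀ ξ, 0 ≤ u ξ) {ξ₀ : M} (hpos : 0 < u ξ₀) : 0 < hypersurfaceIntegral g x u := by
  have hterm : ∀ c : M, 0 ≤ fun y : EuclideanSpace ℝ (Fin n) =>
      chartPartition n M c ((extChartAt (𝓡 n) c).symm y) * u ((extChartAt (𝓡 n) c).symm y)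
        * volumeDensity g x c y := fun c y =>
    mul_nonneg (mul_nonneg ((chartPartition n M).nonneg _ _) (hnonneg _)) (volumeDensity_nonneg _ _)
  refine finsum_pos (fun c => integral_nonneg (hterm c)) ?_ ?_
  · obtain ⟨c, hc⟩ : ∃ c : M, 0 < chartPartition n M c ξ₀ :=
      (chartPartition n M).exists_pos (mem_univ ξ₀)
    have hsub : tsupport (chartPartition n M c) ⊆ (extChartAt (𝓡 n) c).source := by
      rw [extChartAt_source]
      exact (exists_chartPartition n M).choose_spec c
    have hξ₀ : ξ₀ ∈ (extChartAt (𝓡 n) c).source :=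
      hsub (subset_tsupport _ hc.ne')
    have hcont : ∀ y ∈ (extChartAt (𝓡 n) c).target, ContinuousAt (fun y =>
        chartPartition n M c ((extChartAt (𝓡 n) c).symm y) * u ((extChartAt (𝓡 n) c).symm y)
        * volumeDensity g x c y) y := by
      intro y hy
      have h1 : ContinuousAt (extChartAt (𝓡 n) c).symm y :=
        continuousAt_extChartAt_symm'' hy
      exact ((((chartPartition n M c).continuous.continuousAt.comp h1).mul
        (hu.continuousAt.comp h1))).mul (continuousAt_volumeDensity hg hx hy)
    have hK : IsCompact (extChartAt (𝓡 n) c '' tsupport (chartPartition n M c)) :=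
      (isClosed_tsupport _).isCompact.image_of_continuousOn
        ((continuousOn_extChartAt c).mono hsub)
    have hKt : extChartAt (𝓡 n) c '' tsupport (chartPartition n M c) ⊆
        (extChartAt (𝓡 n) c).target := by
      rintro _ ⟨ξ, hξ, rfl⟩
      exact (extChartAt (𝓡 n) c).map_source (hsub hξ)
    have hint : IntegrableOn (fun y =>
        chartPartition n M c ((extChartAt (𝓡 n) c).symm y) * u ((extChartAt (𝓡 n) c).symm y)
        * volumeDensity g x c y) (extChartAt (𝓡 n) c).target := by
      -- The integrand need not be controlled near the boundary of the chart, since it vanishes off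
      -- the compact image of the support of the partition function.
      refine IntegrableOn.of_forall_sdiff_eq_zero
          (s := extChartAt (𝓡 n) c '' tsupport (chartPartition n M c))
        (ContinuousOn.integrableOn_compact hK fun y hy => (hcont y (hKt hy)).continuousWithinAt)
        (isOpen_extChartAt_target c).measurableSet fun y hy => ?_
      have h0 : chartPartition n M c ((extChartAt (𝓡 n) c).symm y) = 0 :=
        image_eq_zero_of_notMem_tsupport fun h => hy.2 ⟨_, h, (extChartAt (𝓡 n) c).right_inv hy.1⟩
      simp only [h0, zero_mul]
    refine ⟨c, (setIntegral_pos_iff_support_of_nonneg_ae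
      (Filter.Eventually.of_forall (hterm c)) hint).2 ?_⟩
    have hy₀ := (extChartAt (𝓡 n) c).map_source hξ₀
    refine Measure.measure_pos_of_mem_nhds volume (x := extChartAt (𝓡 n) c ξ₀)
      (Filter.inter_mem ?_ (extChartAt_target_mem_nhds' hy₀))
    refine (hcont _ hy₀).eventually_ne ?_
    rw [(extChartAt (𝓡 n) c).left_inv hξ₀]
    exact (mul_pos (mul_pos hc hpos) (volumeDensity_pos hg hs hy₀)).ne'
  -- Local finiteness on a compact space leaves finitely many nonzero terms. This is essential,
  -- since a `finsum` with infinite support would be 0 by convention.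
  · refine ((chartPartition n M).locallyFinite.finite_nonempty_of_compact).subset fun c hc => ?_
    by_contra hempty
    rw [mem_ofPred_eq, not_nonempty_iff_eq_empty, support_eq_empty_iff] at hempty
    exact hc (by simp [hempty])

end Integral

/-! ### Conservation of the sign of the integral along the flow. -/

section Sign

variable {n : ℕ} {M N : Type*}
  [TopologicalSpace M] [ChartedSpace (EuclideanSpace ℝ (Fin n)) M] [IsManifold (𝓡 n) 6 M]
  [CompactSpace M] [T2Space M]
  [TopologicalSpace N] [ChartedSpace (EuclideanSpace ℝ (Fin (n + 1))) N]
  [IsManifold (𝓡 (n + 1)) 6 N] {σ : ℝ}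
  {g : ∀ p : N, TangentSpace (𝓡 (n + 1)) p →L[ℝ] TangentSpace (𝓡 (n + 1)) p →L[ℝ] ℝ}
  {Γ : Set (Fin n → ℝ)} {F : (Fin n → ℝ) → ℝ} {J : Set ℝ} {Φ : ℝ → ℝ} {Ω : Set N} {f : N → ℝ}
  {T : EReal} {x : ℝ → M → N} {ν : ∀ (t : ℝ) (ξ : M), TangentSpace (𝓡 (n + 1)) (x t ξ)}
  {κ : ℝ → M → Fin n → ℝ}

theorem IsCurvatureFlow.hypersurfaceIntegral_pos (hx : IsCurvatureFlow σ g Γ F Φ Ω f T x ν κ)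
    (hg : IsAmbientMetric σ g) {u : ℝ → M → ℝ} (hu : IsLocallyParabolic (n := n) T u)
    (h0 : ∀ ξ, 0 ≤ u 0 ξ) (hint : 0 < hypersurfaceIntegral g (x 0) (u 0)) {t : ℝ}
    (ht : t ∈ timeInterval T) : 0 < hypersurfaceIntegral g (x t) (u t) := by
  obtain ⟨ξ₀, hξ₀⟩ := exists_ne_zero_of_hypersurfaceIntegral_ne_zero hint.ne'
  have hcont : Continuous (u t) := by
    rw [← continuousOn_univ]
    exact hu.continuousOn.comp (f := fun ξ => (t, ξ)) (by fun_prop) fun ξ _ => ⟨ht, mem_univ ξ⟩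
  exact HypersurfaceFlow.hypersurfaceIntegral_pos hg (hx.contMDiffAt ht) (hx.spacelike t ht) hcont
    (hu.nonneg h0 ht) (hu.pos h0 ((h0 ξ₀).lt_of_ne' hξ₀) ht)

end Sign

end HypersurfaceFlow

theorem mainTheorem2 {n : ℕ} (hn : 1 ≤ n)
    {N : Type*} [TopologicalSpace N] [T2Space N] [SecondCountableTopology N]
    [ChartedSpace (EuclideanSpace ℝ (Fin (n + 1))) N] [IsManifold (𝓡 (n + 1)) 6 N]
    {M : Type*} [TopologicalSpace M] [T2Space M] [CompactSpace M]
    [ChartedSpace (EuclideanSpace ℝ (Fin n)) M] [IsManifold (𝓡 n) 6 M]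
    (σ : ℝ) (g : ∀ p : N, TangentSpace (𝓡 (n + 1)) p →L[ℝ] TangentSpace (𝓡 (n + 1)) p →L[ℝ] ℝ)
    (hg : HypersurfaceFlow.IsAmbientMetric σ g)
    (Γ : Set (Fin n → ℝ)) (hΓ : HypersurfaceFlow.IsCurvatureCone Γ)
    (F : (Fin n → ℝ) → ℝ) (hF : HypersurfaceFlow.IsCurvatureFunction Γ F)
    (J : Set ℝ) (Φ : ℝ → ℝ) (hΦ : HypersurfaceFlow.IsSpeedFunction J Φ)
    (Ω : Set N) (hΩ : IsOpen Ω) (f : N → ℝ) (hf : ContMDiffOn (𝓡 (n + 1)) 𝓘(ℝ, ℝ) 4 f Ω)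
    (hFJ : ∀ κ ∈ Γ, F κ ∈ J) (hfJ : ∀ p ∈ Ω, f p ∈ J)
    (T : EReal) (hT : 0 < T) (x : ℝ → M → N)
    (ν : ∀ (t : ℝ) (ξ : M), TangentSpace (𝓡 (n + 1)) (x t ξ)) (κ : ℝ → M → Fin n → ℝ)
    (hx : HypersurfaceFlow.IsCurvatureFlow σ g Γ F Φ Ω f T x ν κ) :
    ((∀ ξ : M, 0 ≤ HypersurfaceFlow.speed Φ F f x κ 0 ξ) →
      0 < HypersurfaceFlow.hypersurfaceIntegral g (x 0)
        (HypersurfaceFlow.speed Φ F f x κ 0) →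
      ∀ t ∈ HypersurfaceFlow.timeInterval T,
        0 < HypersurfaceFlow.hypersurfaceIntegral g (x t)
          (HypersurfaceFlow.speed Φ F f x κ t)) ∧
    ((∀ ξ : M, HypersurfaceFlow.speed Φ F f x κ 0 ξ ≤ 0) →
      HypersurfaceFlow.hypersurfaceIntegral g (x 0)
        (HypersurfaceFlow.speed Φ F f x κ 0) < 0 →
      ∀ t ∈ HypersurfaceFlow.timeInterval T,
        HypersurfaceFlow.hypersurfaceIntegral g (x t)
          (HypersurfaceFlow.speed Φ F f x κ t) < 0) := by
  have hu := hx.isLocallyParabolic_speed hg hΓ hF hΦ hΩ hf hFJ hfJ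
  refine ⟨fun h0 hint t ht => hx.hypersurfaceIntegral_pos hg hu h0 hint ht,
    fun h0 hint t ht => ?_⟩
  -- Only the linear equation is changed to the one for −u; the flow itself, including the concave
  -- function F, is left as it is.
  have h := hx.hypersurfaceIntegral_pos hg hu.neg (fun ξ => neg_nonneg.2 (h0 ξ))
    (by rw [HypersurfaceFlow.hypersurfaceIntegral_neg]; exact neg_pos.2 hint) ht
  rw [HypersurfaceFlow.hypersurfaceIntegral_neg] at h
  exact neg_pos.1 h
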